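/- Let $\alpha>0$ be fixed. For each $M\ge 1$ let $N=N(M)$ be a positive integer, let $\mathbf X=\mathbf X_M$ be an $M\times N$ random matrix whose entries have mutually independent real and imaginary parts, all of law $\mathcal N(0,1/2)$, and let $\mathbf R=\mathbf R_M\in\mathbb C^{M\times M}$ and $\mathbf T=\mathbf T_N\in\mathbb C^{N\times N}$ be deterministic Hermitian positive definite matrices with $$\sup_M\|\mathbf R_M\|<\infty,\quad \sup_M\|\mathbf T_N\|<\infty,\quad \inf_M\|\mathbf R_M^{-1}\|^{-1}>0,\quad \inf_M\|\mathbf T_N^{-1}\|^{-1}>0$$ (spectral norm). Assume that $M\to\infty$ with $0<\liminf M/N\le\limsup M/N<\infty$. Let $\mathbf{\tilde Z}=\mathbf{\tilde Z}_N\in\mathbb C^{N\times N}$ be deterministic diagonal matrices with $\sup_M\|\mathbf{\tilde Z}_N\|<\infty$, and let $\mathbf\Theta=\mathbf\Theta_M\in\mathbb C^{M\times M}$ be deterministic Hermitian positive semidefinite matrices with $\sup_M\|\mathbf\Theta_M\|_{\mathrm{tr}}<\infty$ and $\inf_M\operatorname{tr}[\mathbf\Theta_M]>0$, where $\|\mathbf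 A\|_{\mathrm{tr}}=\operatorname{tr}[(\mathbf A^*\mathbf A)^{1/2}]$. Put $$\mathbf Q=\Big(\tfrac1N\mathbf X\mathbf T\mathbf X^*+\alpha\mathbf R^{-1}\Big)^{-1},\qquad \mathbf E=\mathbf R\big(\tilde\delta\,\mathbf R+\alpha\mathbf I_M\big)^{-1},$$ where $(\tilde\delta,\delta)=(\tilde\delta_M,\delta_M)$ is the unique pair of positive numbers such that $$\tilde\delta=\tfrac1N\operatorname{tr}\big[\mathbf T(\mathbf I_N+\delta\mathbf T)^{-1}\big],\qquad \delta=\tfrac1N\operatorname{tr}\big[\mathbf R(\tilde\delta\,\mathbf R+\alpha\mathbf I_M)^{-1}\big].$$ Then, for all sufficiently large $M$, $\operatorname{tr}[\mathbf\Theta\mathbf Q]$ and $\operatorname{tr}[\mathbf\Theta\mathbf Q\,\mathbf X\mathbf{\tilde Z}\mathbf X^*/N]$ are integrable, and as $M\to\infty$ $$\mathbb E\operatorname{tr}[\mathbf\Theta\mathbf Q]=\operatorname{tr}[\mathbf\Theta\mathbf E]+\mathcal O\!\left(\frac{\|\mathbf\Theta\|_F}{N^{3/2}}\right),$$ $$\mathbb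 E\operatorname{tr}\!\Big[\mathbf\Theta\mathbf Q\,\frac{\mathbf X\mathbf{\tilde Z}\mathbf X^*}{N}\Big]=\frac1N\operatorname{tr}\big[\mathbf{\tilde Z}(\mathbf I_N+\delta\mathbf T)^{-1}\big]\operatorname{tr}[\mathbf\Theta\mathbf E]+\mathcal O\!\left(\frac{\|\mathbf\Theta\|_F}{N^{3/2}}\right),$$ where $\|\mathbf A\|_F=(\operatorname{tr}[\mathbf A^*\mathbf A])^{1/2}$ and $f=\mathcal O(g)$ means $|f|\le K|g|$ for all sufficiently large $M$. The constant $K$ depends only on $\alpha$, on the upper and lower bounds for the spectra of $\mathbf R_M$ and $\mathbf T_N$, on the bound for $\|\mathbf{\tilde Z}_N\|$, and on the bounds for $\liminf M/N$ and $\limsup M/N$. -/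

import Mathlib

open Filter Topology MeasureTheory ProbabilityTheory
open scoped NNReal ENNReal ComplexOrder Matrix.Norms.L2Operator

/-- The Frobenius norm `‖A‖_F = (tr[A* A])^{1/2}`. -/
noncomputable def frobeniusNorm {m n : ℕ} (A : Matrix (Fin m) (Fin n) ℂ) : ℝ :=
  Real.sqrt (A.conjTranspose * A).trace.re

/-- The trace (nuclear) norm `‖A‖_tr = tr[(A* A)^{1/2}]`, the sum of the square roots of the
eigenvalues of `A* A`. -/
noncomputable def traceNorm {m n : ℕ} (A : Matrix (Fin m) (Fin n) ℂ) : ℝ :=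
  ∑ i, Real.sqrt ((Matrix.isHermitian_conjTranspose_mul_self A).eigenvalues i)

/-- `X` is a random matrix whose entries are i.i.d. standard complex Gaussian: the real and
imaginary parts of all the entries are mutually independent, each of law `N(0, 1/2)`. -/
structure IsStdComplexGaussianMatrix {Ω : Type*} [MeasurableSpace Ω] (P : Measure Ω) {m n : ℕ}
    (X : Ω → Matrix (Fin m) (Fin n) ℂ) : Prop where
  indep : iIndepFun (fun (k : (Fin m × Fin n) ⊕ (Fin m × Fin n)) (ω : Ω) =>
    Sum.elim (fun p => (X ω p.1 p.2).re) (fun p => (X ω p.1 p.2).im) k) P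
  law_re : ∀ i j, HasLaw (fun ω => (X ω i j).re) (gaussianReal 0 (1 / 2)) P
  law_im : ∀ i j, HasLaw (fun ω => (X ω i j).im) (gaussianReal 0 (1 / 2)) P

/-- The resolvent `Q = (N⁻¹ X T X* + α R⁻¹)⁻¹`. -/
noncomputable def resolventQ {M N : ℕ} (α : ℝ) (R : Matrix (Fin M) (Fin M) ℂ)
    (T : Matrix (Fin N) (Fin N) ℂ) (X : Matrix (Fin M) (Fin N) ℂ) :
    Matrix (Fin M) (Fin M) ℂ :=
  ((1 / (N : ℂ)) • (X * T * X.conjTranspose) + (α : ℂ) • R⁻¹)⁻¹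

/-- `p = (δ̃, δ)` is a positive solution of the system
`δ̃ = N⁻¹ tr[T (I + δ T)⁻¹]`, `δ = N⁻¹ tr[R (δ̃ R + α I)⁻¹]`. -/
def IsPositiveSolution {M N : ℕ} (α : ℝ) (R : Matrix (Fin M) (Fin M) ℂ)
    (T : Matrix (Fin N) (Fin N) ℂ) (p : ℝ × ℝ) : Prop :=
  0 < p.1 ∧ 0 < p.2 ∧
    (p.1 : ℂ) = 1 / (N : ℂ) * (T * (1 + (p.2 : ℂ) • T)⁻¹).trace ∧
    (p.2 : ℂ) = 1 / (N : ℂ) * (R * ((p.1 : ℂ) • R + (α : ℂ) • 1)⁻¹).trace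

theorem trace_mul_inv_affine {n : ℕ} {A : Matrix (Fin n) (Fin n) ℂ} (hA : A.IsHermitian)
    (a b : ℝ) (h : ∀ i, b * hA.eigenvalues i + a ≠ 0) :
    (A * ((b : ℂ) • A + (a : ℂ) • 1)⁻¹).trace =
      ((∑ i, hA.eigenvalues i / (b * hA.eigenvalues i + a) : ℝ) : ℂ) := by
  set U : Matrix (Fin n) (Fin n) ℂ := (hA.eigenvectorUnitary : Matrix (Fin n) (Fin n) ℂ) with hU
  set l := hA.eigenvalues with hl
  have h1 : U * star U = 1 := Unitary.coe_mul_star_self hA.eigenvectorUnitary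
  have h2 : star U * U = 1 := Unitary.coe_star_mul_self hA.eigenvectorUnitary
  have hs : A = U * Matrix.diagonal (fun i => (l i : ℂ)) * star U := by
    have := hA.spectral_theorem
    rw [Unitary.conjStarAlgAut_apply] at this
    exact this
  have hd : (b : ℂ) • A + (a : ℂ) • 1 =
      U * Matrix.diagonal (fun i => ((b * l i + a : ℝ) : ℂ)) * star U := by
    have e : Matrix.diagonal (fun i => ((b * l i + a : ℝ) : ℂ)) =
        (b : ℂ) • Matrix.diagonal (fun i => (l i : ℂ)) + (a : ℂ) • 1 := by
      ext i j
      by_cases hij : i = j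
      · subst hij; simp
      · simp [hij]
    rw [e, mul_add, add_mul]
    conv_lhs => rw [hs]
    simp [h1]
  have hinv : ((b : ℂ) • A + (a : ℂ) • 1)⁻¹ =
      U * Matrix.diagonal (fun i => (((b * l i + a)⁻¹ : ℝ) : ℂ)) * star U := by
    apply Matrix.inv_eq_right_inv
    rw [hd]
    calc _ = U * (Matrix.diagonal (fun i => ((b * l i + a : ℝ) : ℂ)) * (star U * U) *
          Matrix.diagonal (fun i => (((b * l i + a)⁻¹ : ℝ) : ℂ))) * star U := by
            simp only [mul_assoc]
      _ = 1 := by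
        rw [h2, mul_one, Matrix.diagonal_mul_diagonal]
        have : (fun i => ((b * l i + a : ℝ) : ℂ) * (((b * l i + a)⁻¹ : ℝ) : ℂ)) = fun _ => 1 := by
          funext i
          rw [← Complex.ofReal_mul, mul_inv_cancel₀ (h i), Complex.ofReal_one]
        rw [this, Matrix.diagonal_one, mul_one, h1]
  rw [hinv]
  conv_lhs => rw [hs]
  calc _ = (U * (Matrix.diagonal (fun i => (l i : ℂ)) * (star U * U) *
          Matrix.diagonal (fun i => (((b * l i + a)⁻¹ : ℝ) : ℂ))) * star U).trace := by
            simp only [mul_assoc]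
    _ = _ := by
      rw [h2, mul_one, Matrix.diagonal_mul_diagonal, Matrix.trace_mul_comm, ← mul_assoc, h2,
        one_mul, Matrix.trace_diagonal]
      push_cast
      rfl

/-- Existence and uniqueness for the scalar form of the system. -/
theorem scalar_system {M N : ℕ} (hM : 0 < M) (hN : 0 < N) {α : ℝ} (hα : 0 < α)
    (r : Fin M → ℝ) (t : Fin N → ℝ) (hr : ∀ i, 0 < r i) (ht : ∀ i, 0 < t i) :
    ∃! p : ℝ × ℝ, 0 < p.1 ∧ 0 < p.2 ∧ p.1 = 1 / (N : ℝ) * ∑ j, t j / (p.2 * t j + 1) ∧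
      p.2 = 1 / (N : ℝ) * ∑ i, r i / (p.1 * r i + α) := by
  have : Nonempty (Fin M) := ⟨⟨0, hM⟩⟩
  have : Nonempty (Fin N) := ⟨⟨0, hN⟩⟩
  have hN' : (0 : ℝ) < 1 / (N : ℝ) := by positivity
  set d : ℝ → ℝ := fun x => 1 / (N : ℝ) * ∑ j, t j / (x * t j + 1) with hd
  set f : ℝ → ℝ := fun x => 1 / (N : ℝ) * ∑ i, r i / (d x * r i + α) with hf
  have ht1 : ∀ x, 0 ≤ x → ∀ j, 0 < x * t j + 1 := fun x hx j => by
    have := mul_nonneg hx (ht j).le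
    linarith
  have hdpos : ∀ x, 0 ≤ x → 0 < d x := fun x hx =>
    mul_pos hN' (Finset.sum_pos (fun j _ => div_pos (ht j) (ht1 x hx j)) Finset.univ_nonempty)
  have hr1 : ∀ x, 0 ≤ x → ∀ i, 0 < d x * r i + α := fun x hx i => by
    have := mul_pos (hdpos x hx) (hr i)
    linarith
  have hfpos : ∀ x, 0 ≤ x → 0 < f x := fun x hx =>
    mul_pos hN' (Finset.sum_pos (fun i _ => div_pos (hr i) (hr1 x hx i)) Finset.univ_nonempty)
  set B : ℝ := 1 / (N : ℝ) * ∑ i, r i / α with hB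
  have hfB : ∀ x, 0 ≤ x → f x ≤ B := fun x hx => by
    refine mul_le_mul_of_nonneg_left (Finset.sum_le_sum fun i _ => ?_) hN'.le
    have := mul_pos (hdpos x hx) (hr i)
    exact div_le_div_of_nonneg_left (hr i).le hα (by linarith)
  have hBpos : 0 < B := (hfpos 0 le_rfl).trans_le (hfB 0 le_rfl)
  have hdc : ContinuousOn d (Set.Icc 0 B) := by
    refine continuousOn_const.mul (continuousOn_finsetSum _ fun j _ => ?_)
    exact continuousOn_const.div (by fun_prop) fun x hx => (ht1 x hx.1 j).ne'
  have hfc : ContinuousOn f (Set.Icc 0 B) := by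
    refine continuousOn_const.mul (continuousOn_finsetSum _ fun i _ => ?_)
    exact continuousOn_const.div ((hdc.mul continuousOn_const).add continuousOn_const)
      fun x hx => (hr1 x hx.1 i).ne'
  obtain ⟨x, hx, hxe⟩ : ∃ x ∈ Set.Icc 0 B, x - f x = 0 := by
    have := intermediate_value_Icc hBpos.le (continuousOn_id.sub hfc)
    refine this ⟨?_, ?_⟩
    · have := hfpos 0 le_rfl
      simp only [Pi.sub_apply, id]
      linarith
    · have := hfB B hBpos.le
      simp only [Pi.sub_apply, id]
      linarith
  have hxf : x = f x := by linarith
  have hxpos : 0 < x := by rw [hxf]; exact hfpos x hx.1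
  -- two positive fixed points of `f` coincide
  have key : ∀ x y, 0 < x → x < y → x = f x → y = f y → False := by
    intro x y hx hxy hfx hfy
    have hy := hx.trans hxy
    have hm : x * d x ≤ y * d y := by
      have e : ∀ z, z * d z = 1 / (N : ℝ) * ∑ j, z * t j / (z * t j + 1) := fun z => by
        simp only [hd, Finset.mul_sum]
        exact Finset.sum_congr rfl fun j _ => by ring
      rw [e, e]
      refine mul_le_mul_of_nonneg_left (Finset.sum_le_sum fun j _ => ?_) hN'.le
      rw [div_le_div_iff₀ (ht1 x hx.le j) (ht1 y hy.le j)]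
      nlinarith [mul_le_mul_of_nonneg_right hxy.le (ht j).le]
    have one : ∀ z, 0 < z → z = f z →
        1 = 1 / (N : ℝ) * ∑ i, r i / (z * d z * r i + α * z) := fun z hz hfz => by
      have : 1 = f z / z := by rw [← hfz, div_self hz.ne']
      refine this.trans ?_
      simp only [hf]
      rw [mul_div_assoc, Finset.sum_div]
      refine congrArg (fun s : ℝ => 1 / (N : ℝ) * s) ?_
      refine Finset.sum_congr rfl fun i _ => ?_
      rw [div_div]
      congr 1
      ring
    have h1 := one x hx hfx
    have h2 := one y hy hfy
    have hlt : ∑ i, r i / (y * d y * r i + α * y) < ∑ i, r i / (x * d x * r i + α * x) := by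
      refine Finset.sum_lt_sum_of_nonempty Finset.univ_nonempty fun i _ => ?_
      have p1 := mul_pos (mul_pos hx (hdpos x hx.le)) (hr i)
      have p2 := mul_pos hα hx
      have p3 := mul_le_mul_of_nonneg_right hm (hr i).le
      have p4 := mul_lt_mul_of_pos_left hxy hα
      exact div_lt_div_of_pos_left (hr i) (by linarith) (by linarith)
    have := mul_lt_mul_of_pos_left hlt hN'
    linarith
  refine ⟨(d x, x), ⟨hdpos x hx.1, hxpos, rfl, hxf⟩, ?_⟩
  rintro ⟨a, y⟩ ⟨_, hy, ha, hyf⟩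
  simp only at hy ha hyf
  have ha' : a = d y := ha
  subst ha'
  have hyf' : y = f y := hyf
  rcases lt_trichotomy x y with h | h | h
  · exact (key x y hxpos h hxf hyf').elim
  · rw [h]
  · exact (key y x hy h hyf' hxf).elim

/-- The system has exactly one positive solution. -/
theorem existsUnique_isPositiveSolution {M N : ℕ} (hM : 0 < M) (hN : 0 < N) {α : ℝ} (hα : 0 < α)
    {R : Matrix (Fin M) (Fin M) ℂ} {T : Matrix (Fin N) (Fin N) ℂ}
    (hR : R.PosDef) (hT : T.PosDef) : ∃! p : ℝ × ℝ, IsPositiveSolution α R T p := by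
  have h := scalar_system hM hN hα hR.isHermitian.eigenvalues hT.isHermitian.eigenvalues
    hR.eigenvalues_pos hT.eigenvalues_pos
  refine (existsUnique_congr fun p => ?_).mp h
  refine and_congr_right fun h1 => and_congr_right fun h2 => ?_
  have eT := trace_mul_inv_affine hT.isHermitian 1 p.2 fun i =>
    (add_pos (mul_pos h2 (hT.eigenvalues_pos i)) one_pos).ne'
  have eR := trace_mul_inv_affine hR.isHermitian α p.1 fun i =>
    (add_pos (mul_pos h1 (hR.eigenvalues_pos i)) hα).ne'
  have c : (1 : Matrix (Fin N) (Fin N) ℂ) + (p.2 : ℂ) • T =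
      (p.2 : ℂ) • T + ((1 : ℝ) : ℂ) • 1 := by
    rw [Complex.ofReal_one, one_smul, add_comm]
  rw [c, eT, eR]
  refine and_congr ?_ ?_
  · rw [← Complex.ofReal_inj]; push_cast; rfl
  · rw [← Complex.ofReal_inj]; push_cast; rfl

open Classical in
/-- The positive solution `(δ̃, δ)` of the system (unique by `existsUnique_isPositiveSolution`). -/
noncomputable def systemSolution {M N : ℕ} (α : ℝ) (R : Matrix (Fin M) (Fin M) ℂ)
    (T : Matrix (Fin N) (Fin N) ℂ) : ℝ × ℝ :=
  if h : ∃ p : ℝ × ℝ, IsPositiveSolution α R T p then h.choose else (0, 0)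

theorem isPositiveSolution_systemSolution {M N : ℕ} (hM : 0 < M) (hN : 0 < N) {α : ℝ}
    (hα : 0 < α) {R : Matrix (Fin M) (Fin M) ℂ} {T : Matrix (Fin N) (Fin N) ℂ}
    (hR : R.PosDef) (hT : T.PosDef) : IsPositiveSolution α R T (systemSolution α R T) := by
  have h : ∃ p : ℝ × ℝ, IsPositiveSolution α R T p :=
    (existsUnique_isPositiveSolution hM hN hα hR hT).exists
  rw [systemSolution, dif_pos h]
  exact h.choose_spec

/-- `δ̃`. -/
noncomputable def deltaTilde {M N : ℕ} (α : ℝ) (R : Matrix (Fin M) (Fin M) ℂ)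
    (T : Matrix (Fin N) (Fin N) ℂ) : ℝ := (systemSolution α R T).1

/-- `δ`. -/
noncomputable def delta {M N : ℕ} (α : ℝ) (R : Matrix (Fin M) (Fin M) ℂ)
    (T : Matrix (Fin N) (Fin N) ℂ) : ℝ := (systemSolution α R T).2

/-- The deterministic equivalent `E = R (δ̃ R + α I)⁻¹` of the resolvent. -/
noncomputable def detEquivE {M N : ℕ} (α : ℝ) (R : Matrix (Fin M) (Fin M) ℂ)
    (T : Matrix (Fin N) (Fin N) ℂ) : Matrix (Fin M) (Fin M) ℂ :=
  R * ((deltaTilde α R T : ℂ) • R + (α : ℂ) • 1)⁻¹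

/-- `Φ = tr[Θ Q]`. -/
noncomputable def phi {M N : ℕ} (α : ℝ) (R : Matrix (Fin M) (Fin M) ℂ)
    (T : Matrix (Fin N) (Fin N) ℂ) (Θ : Matrix (Fin M) (Fin M) ℂ)
    (X : Matrix (Fin M) (Fin N) ℂ) : ℂ :=
  (Θ * resolventQ α R T X).trace

/-- `Ψ = tr[Θ Q (X Z̃ X* / N)]`. -/
noncomputable def psi {M N : ℕ} (α : ℝ) (R : Matrix (Fin M) (Fin M) ℂ)
    (T : Matrix (Fin N) (Fin N) ℂ) (Θ : Matrix (Fin M) (Fin M) ℂ)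
    (Zt : Matrix (Fin N) (Fin N) ℂ) (X : Matrix (Fin M) (Fin N) ℂ) : ℂ :=
  (Θ * resolventQ α R T X * ((1 / (N : ℂ)) • (X * Zt * X.conjTranspose))).trace

/-! Put `V = X/√N`, `S = α R⁻¹`, `σ = 1/N`, so that `Q = (V T V* + S)⁻¹`, and let `β = σ E tr Q`.
Gaussian integration by parts (`integral_trace_resolvent_mul`) expresses `E tr[A Q V B V*]` through
`E tr[A Q]` and `E(tr Q · tr[A Q V T B V*])`. In the last term `tr Q` is its mean plus a
fluctuation. The choice `B = (I + βT)⁻¹ C` absorbs the mean part, whence `E tr[A Q V C V*] = σ tr[(I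
+ βT)⁻¹ C] E tr[A Q] - σ Cov` (`integral_trace_form_eq`). Taking `C = T` and using `Q V T V* = I - Q
S` gives `E tr[Θ Q] = tr[Θ (β̃ + S)⁻¹] + σ Cov` with `β̃ = σ tr[T (I + βT)⁻¹]`
(`integral_trace_resolvent_eq`).

The covariances are controlled by a Poincaré inequality (`norm_covariance_le`). The mean squared
directional derivative is `O(1)` for `tr Q` and `O(σ ‖C‖² ‖A‖_F²)` for `tr[A Q V C V*]`, because
`Q`, `QV` and `V* Q V` are bounded uniformly in `V`. So `σ Cov` has order `N^{-3/2} ‖Θ‖_F`.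

It remains to replace `β` by `δ`. With `Θ = I` the identity says that `β` solves the fixed point
equation for `δ` up to `O(N⁻²)`. That equation is stable (`abs_sub_fixedPoint_le`), so `β - δ =
O(N⁻²)`. Replacing `β` by `δ` costs a factor `√M ‖Θ‖_F`, which again leaves `N^{-3/2} ‖Θ‖_F`.

Integration by parts and the Poincaré inequality both come from one fact: for a centered Gaussian
`μ`, the measure `μ × μ` is invariant under the rotations `(x, y) ↦ (x cos θ + y sin θ, -x sin θ + y
cos θ)`. -/

/-! ### Gaussian integration by parts, Poincaré inequality and covariance bound from rotation
invariance. -/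

section RotationInvariance

variable {E F : Type*} [NormedAddCommGroup E] [NormedAddCommGroup F]

/-- Continuous functions with at most polynomial growth. -/
structure PolyGrowth (f : E → F) : Prop where
  continuous : Continuous f
  bound : ∃ (C : ℝ) (k : ℕ), 0 ≤ C ∧ ∀ x, ‖f x‖ ≤ C * (1 + ‖x‖) ^ k

namespace PolyGrowth

theorem of_le {G : Type*} [NormedAddCommGroup G] {f : E → F} {g : E → G} (hf : PolyGrowth f)
    (hg : Continuous g) {c : ℝ} (hc : 0 ≤ c) (h : ∀ x, ‖g x‖ ≤ c * ‖f x‖) : PolyGrowth g := by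
  obtain ⟨C, k, hC, hb⟩ := hf.bound
  refine ⟨hg, c * C, k, by positivity, fun x => (h x).trans ?_⟩
  rw [mul_assoc]
  exact mul_le_mul_of_nonneg_left (hb x) hc

theorem of_bounded {f : E → F} (hf : Continuous f) {C : ℝ} (h : ∀ x, ‖f x‖ ≤ C) :
    PolyGrowth f :=
  ⟨hf, C, 0, (norm_nonneg _).trans (h 0), by simpa using h⟩

theorem const (c : F) : PolyGrowth (fun _ : E => c) :=
  of_bounded continuous_const fun _ => le_rfl

theorem id : PolyGrowth (fun x : E => x) :=
  ⟨continuous_id, 1, 1, zero_le_one, fun _ => by simp⟩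

theorem bilin {G H : Type*} [NormedAddCommGroup G] [NormedAddCommGroup H] {f : E → F} {g : E → G}
    {b : E → H} (hf : PolyGrowth f) (hg : PolyGrowth g) (hb : Continuous b)
    (h : ∀ x, ‖b x‖ ≤ ‖f x‖ * ‖g x‖) : PolyGrowth b := by
  obtain ⟨C, k, hC, h1⟩ := hf.bound
  obtain ⟨D, l, hD, h2⟩ := hg.bound
  refine ⟨hb, C * D, k + l, by positivity, fun x => (h x).trans ?_⟩
  calc ‖f x‖ * ‖g x‖ ≤ (C * (1 + ‖x‖) ^ k) * (D * (1 + ‖x‖) ^ l) := by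
        gcongr
        exacts [h1 x, h2 x]
    _ = C * D * (1 + ‖x‖) ^ (k + l) := by ring

theorem add {f g : E → F} (hf : PolyGrowth f) (hg : PolyGrowth g) :
    PolyGrowth (fun x => f x + g x) := by
  obtain ⟨C, k, hC, h1⟩ := hf.bound
  obtain ⟨D, l, hD, h2⟩ := hg.bound
  refine ⟨hf.continuous.add hg.continuous, C + D, k + l, by positivity, fun x => ?_⟩
  have h0 : (1 : ℝ) ≤ 1 + ‖x‖ := by linarith [norm_nonneg x]
  calc ‖f x + g x‖ ≤ C * (1 + ‖x‖) ^ k + D * (1 + ‖x‖) ^ l :=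
        (norm_add_le _ _).trans (add_le_add (h1 x) (h2 x))
    _ ≤ C * (1 + ‖x‖) ^ (k + l) + D * (1 + ‖x‖) ^ (k + l) := by
        gcongr
        exacts [Nat.le_add_right _ _, Nat.le_add_left _ _]
    _ = _ := by ring

theorem neg {f : E → F} (hf : PolyGrowth f) : PolyGrowth (fun x => -f x) :=
  hf.of_le hf.continuous.neg zero_le_one fun x => by simp

theorem sub {f g : E → F} (hf : PolyGrowth f) (hg : PolyGrowth g) :
    PolyGrowth (fun x => f x - g x) := by
  simpa only [sub_eq_add_neg] using hf.add hg.neg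

theorem norm {f : E → F} (hf : PolyGrowth f) : PolyGrowth (fun x => ‖f x‖) :=
  hf.of_le hf.continuous.norm zero_le_one fun x => by simp

theorem mul {f g : E → ℂ} (hf : PolyGrowth f) (hg : PolyGrowth g) :
    PolyGrowth (fun x => f x * g x) :=
  hf.bilin hg (hf.continuous.mul hg.continuous) fun _ => (norm_mul _ _).le

theorem norm_sq {f : E → F} (hf : PolyGrowth f) : PolyGrowth (fun x => ‖f x‖ ^ 2) :=
  hf.bilin hf (hf.continuous.norm.pow 2) fun x => by simp [sq]

theorem comp {G : Type*} [NormedAddCommGroup G] {f : F → G} (hf : PolyGrowth f) {g : E → F}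
    (hg : Continuous g) {c : ℝ} (hc : 0 ≤ c) (h : ∀ x, ‖g x‖ ≤ c * ‖x‖) :
    PolyGrowth (fun x => f (g x)) := by
  obtain ⟨C, k, hC, hb⟩ := hf.bound
  refine ⟨hf.continuous.comp hg, C * (1 + c) ^ k, k, by positivity, fun x => (hb _).trans ?_⟩
  rw [mul_assoc, ← mul_pow]
  have := h x
  have h0 := norm_nonneg x
  gcongr
  nlinarith

theorem comp_fst {G : Type*} [NormedAddCommGroup G] {f : E → F} (hf : PolyGrowth f) :
    PolyGrowth (fun p : E × G => f p.1) :=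
  hf.comp continuous_fst zero_le_one fun p => by simpa only [one_mul] using norm_fst_le p

theorem comp_snd {G : Type*} [NormedAddCommGroup G] {f : F → G} (hf : PolyGrowth f) :
    PolyGrowth (fun p : E × F => f p.2) :=
  hf.comp continuous_snd zero_le_one fun p => by simpa only [one_mul] using norm_snd_le p

/-- Gaussian measures have moments of every order, so all integrability and domination questions
below reduce to membership in this class, which is closed under the operations needed. -/
theorem integrable [NormedSpace ℝ E] [MeasurableSpace E] [BorelSpace E]
    [SecondCountableTopology E] [CompleteSpace E] {f : E → F} (hf : PolyGrowth f) (μ : Measure E)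
    [IsGaussian μ] : Integrable f μ := by
  obtain ⟨C, k, hC, hb⟩ := hf.bound
  have h1 : MemLp (fun x : E => 1 + ‖x‖) k μ :=
    (memLp_const (1 : ℝ)).add (IsGaussian.memLp_id μ k (by simp)).norm
  have h2 := (h1.integrable_norm_pow').const_mul C
  refine h2.mono' hf.continuous.aestronglyMeasurable (ae_of_all _ fun x => ?_)
  rw [Real.norm_of_nonneg (by positivity)]
  exact hb x

end PolyGrowth

variable [NormedSpace ℝ E]

theorem norm_rotation_le (θ : ℝ) (p : E × E) : ‖ContinuousLinearMap.rotation θ p‖ ≤ 2 * ‖p‖ := by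
  have h1 := norm_fst_le p
  have h2 := norm_snd_le p
  have hc := Real.abs_cos_le_one θ
  have hs := Real.abs_sin_le_one θ
  have key : ∀ a b : ℝ, |a| ≤ 1 → |b| ≤ 1 → ‖a • p.1 + b • p.2‖ ≤ 2 * ‖p‖ := fun a b ha hb => by
    calc ‖a • p.1 + b • p.2‖ ≤ |a| * ‖p.1‖ + |b| * ‖p.2‖ := by
          simpa [norm_smul] using norm_add_le (a • p.1) (b • p.2)
      _ ≤ 1 * ‖p‖ + 1 * ‖p‖ := by gcongr
      _ = _ := by ring
  rw [ContinuousLinearMap.rotation_apply, Prod.norm_def]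
  exact max_le (key _ _ hc hs) (key _ _ (by simpa using hs) hc)

theorem continuous_rotation :
    Continuous fun q : ℝ × (E × E) => ContinuousLinearMap.rotation q.1 q.2 := by
  simp only [ContinuousLinearMap.rotation_apply]
  fun_prop

theorem continuous_rotation_apply (p : E × E) :
    Continuous fun θ : ℝ => ContinuousLinearMap.rotation θ p := by
  simp only [ContinuousLinearMap.rotation_apply]
  fun_prop

variable [MeasurableSpace E] [BorelSpace E] [SecondCountableTopology E] [CompleteSpace E]
  {μ : Measure E} [IsGaussian μ]

/-- Integration by parts for a centered Gaussian measure: the infinitesimal form of the invariance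
of `μ × μ` under rotations. -/
theorem integral_rotationDeriv_eq_zero
    (hμ : ∀ θ, (μ.prod μ).map (ContinuousLinearMap.rotation θ) = μ.prod μ)
    {J DJ : E × E → ℂ} (hJ : PolyGrowth J) (hDJ : PolyGrowth DJ)
    (hd : ∀ p θ, HasDerivAt (fun θ => J (ContinuousLinearMap.rotation θ p))
      (DJ (ContinuousLinearMap.rotation θ p)) θ) :
    ∫ p, DJ p ∂(μ.prod μ) = 0 := by
  obtain ⟨C, k, hC, hb⟩ := hDJ.bound
  -- The dominating function must not depend on `θ`; the factor 2 is that of `norm_rotation_le`.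
  have hB : PolyGrowth (fun p : E × E => C * (1 + 2 * ‖p‖) ^ k) := by
    refine ⟨by fun_prop, C * 2 ^ k, k, by positivity, fun p => ?_⟩
    rw [Real.norm_of_nonneg (by positivity), mul_assoc, ← mul_pow]
    gcongr
    linarith
  have hJr : ∀ θ, PolyGrowth (fun p : E × E => J (ContinuousLinearMap.rotation θ p)) := fun θ =>
    hJ.comp (ContinuousLinearMap.rotation θ).continuous zero_le_two (norm_rotation_le θ)
  have hDr : ∀ θ, PolyGrowth (fun p : E × E => DJ (ContinuousLinearMap.rotation θ p)) := fun θ =>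
    hDJ.comp (ContinuousLinearMap.rotation θ).continuous zero_le_two (norm_rotation_le θ)
  have key := (hasDerivAt_integral_of_dominated_loc_of_deriv_le (μ := μ.prod μ) (𝕜 := ℝ)
    (F := fun θ p => J (ContinuousLinearMap.rotation θ p))
    (F' := fun θ p => DJ (ContinuousLinearMap.rotation θ p)) (x₀ := 0)
    (bound := fun p => C * (1 + 2 * ‖p‖) ^ k) univ_mem
    (Eventually.of_forall fun θ => (hJr θ).continuous.aestronglyMeasurable)
    ((hJr 0).integrable _) (hDr 0).continuous.aestronglyMeasurable
    (ae_of_all _ fun p θ _ => (hb _).trans (by gcongr; exact norm_rotation_le θ p))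
    (hB.integrable _) (ae_of_all _ fun p θ _ => hd p θ)).2
  -- By invariance the integral does not depend on `θ`, so its derivative at `θ = 0` vanishes.
  have hconst : (fun θ : ℝ => ∫ p, J (ContinuousLinearMap.rotation θ p) ∂(μ.prod μ)) =
      fun _ => ∫ p, J p ∂(μ.prod μ) := by
    funext θ
    conv_rhs => rw [← hμ θ]
    rw [integral_map (ContinuousLinearMap.rotation θ).continuous.aemeasurable
      hJ.continuous.aestronglyMeasurable]
  rw [hconst] at key
  have h0 := key.unique (hasDerivAt_const _ _)
  have hr : ∀ p : E × E, ContinuousLinearMap.rotation 0 p = p := fun p => by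
    simp [ContinuousLinearMap.rotation_apply]
  simpa only [hr] using h0

/-- Cauchy–Schwarz against the constant 1, read off from the nonnegativity of the integral of `(‖g‖
- s/a)²`, where `s/a` is the mean of `‖g‖`. -/
theorem sq_norm_intervalIntegral_le {a : ℝ} (ha : 0 < a) {g : ℝ → ℂ} (hg : Continuous g) :
    ‖∫ θ in 0..a, g θ‖ ^ 2 ≤ a * ∫ θ in 0..a, ‖g θ‖ ^ 2 := by
  have h1 : ‖∫ θ in 0..a, g θ‖ ≤ ∫ θ in 0..a, ‖g θ‖ :=
    intervalIntegral.norm_integral_le_integral_norm ha.le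
  set s := ∫ θ in 0..a, ‖g θ‖ with hs
  have h2 : 0 ≤ ∫ θ in 0..a, (‖g θ‖ - s / a) ^ 2 :=
    intervalIntegral.integral_nonneg ha.le fun _ _ => sq_nonneg _
  have h3 : ∫ θ in 0..a, (‖g θ‖ - s / a) ^ 2 =
      (∫ θ in 0..a, ‖g θ‖ ^ 2) - s ^ 2 / a := by
    have e : ∀ θ, (‖g θ‖ - s / a) ^ 2 = ‖g θ‖ ^ 2 - (2 * (s / a)) * ‖g θ‖ + (s / a) ^ 2 :=
      fun θ => by ring
    simp only [e]
    rw [intervalIntegral.integral_add, intervalIntegral.integral_sub,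
      intervalIntegral.integral_const_mul, ← hs, intervalIntegral.integral_const, smul_eq_mul]
    · field_simp; ring
    all_goals exact Continuous.intervalIntegrable (by fun_prop) _ _
  rw [h3] at h2
  have h4 : s ^ 2 ≤ a * ∫ θ in 0..a, ‖g θ‖ ^ 2 := by
    have := mul_nonneg ha.le h2
    rw [mul_sub, mul_div_cancel₀ _ ha.ne'] at this
    linarith
  exact (pow_le_pow_left₀ (norm_nonneg _) h1 2).trans h4

/-- The Poincaré inequality for a centered Gaussian measure (with a non-optimal constant). -/
theorem integral_sq_norm_sub_le
    (hμ : ∀ θ, (μ.prod μ).map (ContinuousLinearMap.rotation θ) = μ.prod μ)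
    {f : E → ℂ} {Df : E × E → ℂ} (hf : PolyGrowth f) (hDf : PolyGrowth Df)
    (hd : ∀ p θ, HasDerivAt (fun θ => f (ContinuousLinearMap.rotation θ p).1)
      (Df (ContinuousLinearMap.rotation θ p)) θ) :
    ∫ p, ‖f p.1 - f p.2‖ ^ 2 ∂(μ.prod μ) ≤
      (Real.pi / 2) ^ 2 * ∫ p, ‖Df p‖ ^ 2 ∂(μ.prod μ) := by
  have ha : 0 < Real.pi / 2 := by positivity
  set a := Real.pi / 2 with hadef
  obtain ⟨C, k, hC, hb⟩ := hDf.norm_sq.bound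
  have hDc : Continuous fun q : (E × E) × ℝ => ‖Df (ContinuousLinearMap.rotation q.2 q.1)‖ ^ 2 :=
    (hDf.continuous.comp (continuous_rotation.comp continuous_swap)).norm.pow 2
  have hB : PolyGrowth (fun p : E × E => C * (1 + 2 * ‖p‖) ^ k) := by
    refine ⟨by fun_prop, C * 2 ^ k, k, by positivity, fun p => ?_⟩
    rw [Real.norm_of_nonneg (by positivity), mul_assoc, ← mul_pow]
    gcongr
    linarith
  have hint : Integrable (fun q : (E × E) × ℝ => ‖Df (ContinuousLinearMap.rotation q.2 q.1)‖ ^ 2)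
      ((μ.prod μ).prod (volume.restrict (Set.Ioc 0 a))) := by
    refine ((hB.integrable (μ.prod μ)).comp_fst _).mono' hDc.aestronglyMeasurable
      (ae_of_all _ fun q => (hb _).trans ?_)
    gcongr
    exact norm_rotation_le _ _
  -- The first component of the rotated pair runs from `p.1` at `θ = 0` to `p.2` at `θ = π/2`, so `f
  -- p.2 - f p.1` is the integral of the derivative along this arc.
  have hpt : ∀ p : E × E, ‖f p.1 - f p.2‖ ^ 2 ≤
      a * ∫ θ in 0..a, ‖Df (ContinuousLinearMap.rotation θ p)‖ ^ 2 := fun p => by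
    have hc : Continuous fun θ => Df (ContinuousLinearMap.rotation θ p) :=
      hDf.continuous.comp (continuous_rotation_apply p)
    have hft := intervalIntegral.integral_eq_sub_of_hasDerivAt (a := 0) (b := a)
      (f := fun θ => f (ContinuousLinearMap.rotation θ p).1)
      (f' := fun θ => Df (ContinuousLinearMap.rotation θ p)) (fun θ _ => hd p θ) (hc.intervalIntegrable _ _)
    have e : f p.2 - f p.1 = ∫ θ in 0..a, Df (ContinuousLinearMap.rotation θ p) := by
      rw [hft]
      simp [ContinuousLinearMap.rotation_apply, hadef]
    rw [norm_sub_rev, e]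
    exact sq_norm_intervalIntegral_le ha hc
  calc ∫ p, ‖f p.1 - f p.2‖ ^ 2 ∂(μ.prod μ)
      ≤ ∫ p, (a * ∫ θ in 0..a, ‖Df (ContinuousLinearMap.rotation θ p)‖ ^ 2) ∂(μ.prod μ) := by
        refine integral_mono ((hf.comp_fst.sub hf.comp_snd).norm_sq.integrable _) ?_ hpt
        refine Integrable.const_mul ?_ _
        have := hint.integral_prod_left
        simpa only [intervalIntegral.integral_of_le ha.le] using this
    _ = a * ∫ θ in 0..a, ∫ p, ‖Df (ContinuousLinearMap.rotation θ p)‖ ^ 2 ∂(μ.prod μ) := by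
        rw [integral_const_mul]
        congr 1
        simp only [intervalIntegral.integral_of_le ha.le]
        exact integral_integral_swap
          (f := fun p θ => ‖Df (ContinuousLinearMap.rotation θ p)‖ ^ 2) hint
    -- After Fubini, every angle contributes the same amount by invariance.
    _ = a * ∫ θ in 0..a, ∫ p, ‖Df p‖ ^ 2 ∂(μ.prod μ) := by
        congr 2
        funext θ
        conv_rhs => rw [← hμ θ]
        rw [integral_map (ContinuousLinearMap.rotation θ).continuous.aemeasurable
          hDf.norm_sq.continuous.aestronglyMeasurable]
    _ = _ := by
        rw [intervalIntegral.integral_const, smul_eq_mul]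
        ring

theorem integral_mul_le_sqrt_mul_sqrt {α : Type*} [MeasurableSpace α] {ν : Measure α} {f g : α → ℝ}
    (hf0 : ∀ x, 0 ≤ f x) (hg0 : ∀ x, 0 ≤ g x) (hf : MemLp f 2 ν) (hg : MemLp g 2 ν) :
    ∫ x, f x * g x ∂ν ≤ √(∫ x, f x ^ 2 ∂ν) * √(∫ x, g x ^ 2 ∂ν) := by
  have h := integral_mul_le_Lp_mul_Lq_of_nonneg (μ := ν) Real.HolderConjugate.two_two
    (ae_of_all _ hf0) (ae_of_all _ hg0) (by simpa using hf) (by simpa using hg)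
  simpa only [Real.sqrt_eq_rpow, Real.rpow_two] using h

/-- Covariance bound for functions of a centered Gaussian vector. -/
theorem norm_integral_sub_mul_le
    (hμ : ∀ θ, (μ.prod μ).map (ContinuousLinearMap.rotation θ) = μ.prod μ)
    {f g : E → ℂ} {Df Dg : E × E → ℂ} (hf : PolyGrowth f) (hDf : PolyGrowth Df)
    (hg : PolyGrowth g) (hDg : PolyGrowth Dg)
    (hdf : ∀ p θ, HasDerivAt (fun θ => f (ContinuousLinearMap.rotation θ p).1)
      (Df (ContinuousLinearMap.rotation θ p)) θ)
    (hdg : ∀ p θ, HasDerivAt (fun θ => g (ContinuousLinearMap.rotation θ p).1)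
      (Dg (ContinuousLinearMap.rotation θ p)) θ) :
    ‖∫ x, (f x - ∫ y, f y ∂μ) * g x ∂μ‖ ≤
      2 * (√(∫ p, ‖Df p‖ ^ 2 ∂(μ.prod μ)) * √(∫ p, ‖Dg p‖ ^ 2 ∂(μ.prod μ))) := by
  -- Symmetrization with an independent copy: twice the covariance is the mean of a product of
  -- differences, to which the Poincaré inequality applies factor by factor.
  have e : ∫ p, (f p.1 - f p.2) * (g p.1 - g p.2) ∂(μ.prod μ) =
      2 * ∫ x, (f x - ∫ y, f y ∂μ) * g x ∂μ := by
    have i1 := (hf.mul hg).integrable μ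
    have i2 := hf.integrable μ
    have i3 := hg.integrable μ
    have e1 : ∀ p : E × E, (f p.1 - f p.2) * (g p.1 - g p.2) =
        (f p.1 * g p.1 - f p.1 * g p.2) + (f p.2 * g p.2 - g p.1 * f p.2) := fun p => by ring
    simp only [e1, sub_mul]
    rw [integral_add, integral_sub, integral_sub, integral_sub, integral_const_mul,
      integral_prod_mul, integral_prod_mul, integral_fun_fst (fun x => f x * g x),
      integral_fun_snd (fun x => f x * g x)]
    · simp; ring
    · exact i1
    · exact i3.const_mul _
    · exact i1.comp_snd _
    · exact i3.mul_prod i2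
    · exact i1.comp_fst _
    · exact i2.mul_prod i3
    · exact (i1.comp_fst _).sub (i2.mul_prod i3)
    · exact (i1.comp_snd _).sub (i3.mul_prod i2)
  have hfs := (hf.comp_fst (G := E)).sub hf.comp_snd
  have hgs := (hg.comp_fst (G := E)).sub hg.comp_snd
  have m : ∀ {h : E × E → ℂ}, PolyGrowth h → MemLp (fun p => ‖h p‖) 2 (μ.prod μ) := fun hh =>
    (memLp_two_iff_integrable_sq hh.norm.continuous.aestronglyMeasurable).2
      (hh.norm_sq.integrable _)
  have h1 : ‖∫ p, (f p.1 - f p.2) * (g p.1 - g p.2) ∂(μ.prod μ)‖ ≤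
      √(∫ p, ‖f p.1 - f p.2‖ ^ 2 ∂(μ.prod μ)) * √(∫ p, ‖g p.1 - g p.2‖ ^ 2 ∂(μ.prod μ)) := by
    refine (norm_integral_le_integral_norm _).trans ?_
    simp only [norm_mul]
    exact integral_mul_le_sqrt_mul_sqrt (fun _ => norm_nonneg _) (fun _ => norm_nonneg _)
      (m hfs) (m hgs)
  have bd : ∀ {h : E → ℂ} {Dh : E × E → ℂ}, PolyGrowth h → PolyGrowth Dh →
      (∀ p θ, HasDerivAt (fun θ => h (ContinuousLinearMap.rotation θ p).1)
        (Dh (ContinuousLinearMap.rotation θ p)) θ) →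
      √(∫ p, ‖h p.1 - h p.2‖ ^ 2 ∂(μ.prod μ)) ≤ 2 * √(∫ p, ‖Dh p‖ ^ 2 ∂(μ.prod μ)) := by
    intro h Dh hh hDh hd
    refine Real.sqrt_le_iff.2 ⟨by positivity, (integral_sq_norm_sub_le hμ hh hDh hd).trans ?_⟩
    rw [mul_pow, Real.sq_sqrt (integral_nonneg fun _ => by positivity)]
    -- The crude constant 2 enters once for each function; the symmetrization halves the product 4
    -- to the 2 of the statement.
    have : Real.pi / 2 ≤ 2 := by linarith [Real.pi_le_four]
    gcongr
  rw [e, norm_mul, Complex.norm_ofNat] at h1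
  have h2 := mul_le_mul (bd hf hDf hdf) (bd hg hDg hdg) (Real.sqrt_nonneg _) (by positivity)
  nlinarith

end RotationInvariance

/-! ### Frobenius and operator norm inequalities, and bounds on the resolvent uniform in `V`. -/

section MatrixBounds

open scoped MatrixOrder

variable {m n l : ℕ}

theorem frobeniusNorm_nonneg (A : Matrix (Fin m) (Fin n) ℂ) : 0 ≤ frobeniusNorm A :=
  Real.sqrt_nonneg _

theorem sq_frobeniusNorm (A : Matrix (Fin m) (Fin n) ℂ) :
    frobeniusNorm A ^ 2 = ∑ j, ∑ i, ‖A i j‖ ^ 2 := by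
  have h : (A.conjTranspose * A).trace.re = ∑ j, ∑ i, ‖A i j‖ ^ 2 := by
    simp only [Matrix.trace, Matrix.diag, Matrix.mul_apply, Matrix.conjTranspose_apply,
      Complex.re_sum]
    refine Finset.sum_congr rfl fun j _ => Finset.sum_congr rfl fun i _ => ?_
    rw [Complex.star_def, Complex.conj_mul', ← Complex.ofReal_pow, Complex.ofReal_re]
  rw [frobeniusNorm, h, Real.sq_sqrt (by positivity)]

theorem frobeniusNorm_conjTranspose (A : Matrix (Fin m) (Fin n) ℂ) :
    frobeniusNorm A.conjTranspose = frobeniusNorm A := by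
  rw [← sq_eq_sq₀ (frobeniusNorm_nonneg _) (frobeniusNorm_nonneg _), sq_frobeniusNorm,
    sq_frobeniusNorm, Finset.sum_comm]
  simp

/-- The operator norm bound is applied to each column of `B` and the squares are summed. -/
theorem frobeniusNorm_mul_le_left (A : Matrix (Fin l) (Fin m) ℂ) (B : Matrix (Fin m) (Fin n) ℂ) :
    frobeniusNorm (A * B) ≤ ‖A‖ * frobeniusNorm B := by
  rw [← sq_le_sq₀ (frobeniusNorm_nonneg _) (mul_nonneg (norm_nonneg _) (frobeniusNorm_nonneg _)),
    mul_pow, sq_frobeniusNorm, sq_frobeniusNorm, Finset.mul_sum]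
  refine Finset.sum_le_sum fun j _ => ?_
  have h := A.l2_opNorm_mulVec (WithLp.toLp 2 fun i => B i j)
  have h2 := pow_le_pow_left₀ (norm_nonneg _) h 2
  rw [mul_pow, EuclideanSpace.norm_sq_eq, EuclideanSpace.norm_sq_eq] at h2
  simpa [Matrix.mulVec, dotProduct, Matrix.mul_apply] using h2

theorem frobeniusNorm_mul_le_right (A : Matrix (Fin l) (Fin m) ℂ) (B : Matrix (Fin m) (Fin n) ℂ) :
    frobeniusNorm (A * B) ≤ frobeniusNorm A * ‖B‖ := by
  rw [← frobeniusNorm_conjTranspose, Matrix.conjTranspose_mul, mul_comm,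
    ← frobeniusNorm_conjTranspose A, ← Matrix.l2_opNorm_conjTranspose B]
  exact frobeniusNorm_mul_le_left _ _

theorem frobeniusNorm_one : frobeniusNorm (1 : Matrix (Fin m) (Fin m) ℂ) = √m := by
  simp [frobeniusNorm]

theorem frobeniusNorm_le (A : Matrix (Fin m) (Fin n) ℂ) : frobeniusNorm A ≤ ‖A‖ * √n := by
  have := frobeniusNorm_mul_le_left A (1 : Matrix (Fin n) (Fin n) ℂ)
  rwa [Matrix.mul_one, frobeniusNorm_one] at this

/-- Cauchy–Schwarz over the pairs of indices. -/
theorem norm_trace_mul_le (A : Matrix (Fin m) (Fin n) ℂ) (B : Matrix (Fin n) (Fin m) ℂ) :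
    ‖(A * B).trace‖ ≤ frobeniusNorm A * frobeniusNorm B := by
  rw [← sq_le_sq₀ (norm_nonneg _) (mul_nonneg (frobeniusNorm_nonneg _) (frobeniusNorm_nonneg _)),
    mul_pow, sq_frobeniusNorm, ← frobeniusNorm_conjTranspose B, sq_frobeniusNorm]
  have e : (A * B).trace = ∑ p : Fin n × Fin m, A p.2 p.1 * B p.1 p.2 := by
    simp only [Matrix.trace, Matrix.diag, Matrix.mul_apply]
    rw [Fintype.sum_prod_type, Finset.sum_comm]
  have h1 : ‖(A * B).trace‖ ≤ ∑ p : Fin n × Fin m, ‖A p.2 p.1‖ * ‖B p.1 p.2‖ := by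
    rw [e]
    exact (norm_sum_le _ _).trans (Finset.sum_le_sum fun p _ => (norm_mul _ _).le)
  refine (pow_le_pow_left₀ (norm_nonneg _) h1 2).trans
    ((Finset.sum_mul_sq_le_sq_mul_sq _ _ _).trans (le_of_eq ?_))
  rw [Fintype.sum_prod_type, Fintype.sum_prod_type]
  simp

theorem norm_trace_le (A : Matrix (Fin m) (Fin m) ℂ) : ‖A.trace‖ ≤ m * ‖A‖ := by
  have h := norm_trace_mul_le A (1 : Matrix (Fin m) (Fin m) ℂ)
  rw [mul_one, frobeniusNorm_one] at h
  refine (h.trans (mul_le_mul_of_nonneg_right (frobeniusNorm_le A) (Real.sqrt_nonneg _))).trans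
    (le_of_eq ?_)
  rw [mul_assoc, Real.mul_self_sqrt (Nat.cast_nonneg _), mul_comm]

theorem Matrix.PosSemidef.norm_le_norm {A B : Matrix (Fin m) (Fin m) ℂ} (hA : A.PosSemidef)
    (h : (B - A).PosSemidef) : ‖A‖ ≤ ‖B‖ :=
  CStarAlgebra.norm_le_norm_of_nonneg_of_le (Matrix.nonneg_iff_posSemidef.2 hA)
    (Matrix.le_iff.2 h)

theorem Matrix.PosSemidef.real_smul {A : Matrix (Fin m) (Fin m) ℂ} (hA : A.PosSemidef) {s : ℝ}
    (hs : 0 ≤ s) : ((s : ℂ) • A).PosSemidef :=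
  hA.smul (by exact_mod_cast hs)

/-- If `0 ≤ P` and `s P² ≤ P` then `‖P‖ ≤ 1 / s`. -/
theorem Matrix.PosSemidef.norm_le_of_sub_sq {P : Matrix (Fin m) (Fin m) ℂ} (hP : P.PosSemidef)
    {s : ℝ} (hs : 0 < s) (h : (P - (s : ℂ) • (P * P)).PosSemidef) : ‖P‖ ≤ s⁻¹ := by
  have h2 : (P * P).PosSemidef := by
    have := Matrix.posSemidef_conjTranspose_mul_self P
    rwa [hP.isHermitian.eq] at this
  have h1 := (h2.real_smul hs.le).norm_le_norm h
  have h3 : ‖P * P‖ = ‖P‖ * ‖P‖ := by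
    have := Matrix.l2_opNorm_conjTranspose_mul_self P
    rwa [hP.isHermitian.eq] at this
  rw [norm_smul, h3, Complex.norm_real, Real.norm_of_nonneg hs.le] at h1
  by_contra hlt
  rw [not_le, inv_lt_iff_one_lt_mul₀ hs] at hlt
  have hpos : 0 < ‖P‖ := by
    by_contra h0
    have : ‖P‖ = 0 := le_antisymm (not_lt.1 h0) (norm_nonneg _)
    rw [this, zero_mul] at hlt
    linarith
  nlinarith

theorem Matrix.IsHermitian.eigenvalues_le_norm {A : Matrix (Fin m) (Fin m) ℂ} (hA : A.IsHermitian)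
    (i : Fin m) : hA.eigenvalues i ≤ ‖A‖ := by
  have h : ‖WithLp.toLp 2 (A.mulVec (hA.eigenvectorBasis i))‖ ≤ ‖A‖ * ‖hA.eigenvectorBasis i‖ :=
    A.l2_opNorm_mulVec (hA.eigenvectorBasis i)
  rw [hA.mulVec_eigenvectorBasis, hA.eigenvectorBasis.norm_eq_one, mul_one, WithLp.toLp_smul,
    norm_smul, WithLp.toLp_ofLp, hA.eigenvectorBasis.norm_eq_one, mul_one] at h
  exact (le_abs_self _).trans h

theorem Matrix.PosDef.inv_norm_inv_le_eigenvalues {A : Matrix (Fin m) (Fin m) ℂ} (hA : A.PosDef)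
    (i : Fin m) : ‖A⁻¹‖⁻¹ ≤ hA.isHermitian.eigenvalues i := by
  have hdet : IsUnit A.det := (Matrix.isUnit_iff_isUnit_det _).1 hA.isUnit
  have h : ‖WithLp.toLp 2 (A⁻¹.mulVec (A.mulVec (hA.isHermitian.eigenvectorBasis i)))‖ ≤
      ‖A⁻¹‖ * ‖WithLp.toLp 2 (A.mulVec (hA.isHermitian.eigenvectorBasis i))‖ :=
    A⁻¹.l2_opNorm_mulVec (WithLp.toLp 2 (A.mulVec (hA.isHermitian.eigenvectorBasis i)))
  simp only [Matrix.mulVec_mulVec, Matrix.nonsing_inv_mul _ hdet, Matrix.one_mulVec] at h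
  rw [hA.isHermitian.mulVec_eigenvectorBasis, WithLp.toLp_smul,
    norm_smul, WithLp.toLp_ofLp, hA.isHermitian.eigenvectorBasis.norm_eq_one, mul_one,
    Real.norm_of_nonneg (hA.eigenvalues_pos i).le] at h
  have h0 : 0 < ‖A⁻¹‖ := by
    by_contra h0
    have : ‖A⁻¹‖ = 0 := le_antisymm (not_lt.1 h0) (norm_nonneg _)
    rw [this, zero_mul] at h
    linarith
  rwa [inv_le_iff_one_le_mul₀' h0]

/-- Turns the lower spectral bound into an inequality between Hermitian matrices, the form used by
the resolvent bounds. -/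
theorem Matrix.PosDef.sub_smul_one_posSemidef {A : Matrix (Fin m) (Fin m) ℂ} (hA : A.PosDef)
    {a : ℝ} (ha : a ≤ ‖A⁻¹‖⁻¹) : (A - (a : ℂ) • 1).PosSemidef := by
  set U : Matrix (Fin m) (Fin m) ℂ :=
    (hA.isHermitian.eigenvectorUnitary : Matrix (Fin m) (Fin m) ℂ) with hU
  have h1 : U * star U = 1 := Unitary.coe_mul_star_self hA.isHermitian.eigenvectorUnitary
  have hs : A = U * Matrix.diagonal (fun i => (hA.isHermitian.eigenvalues i : ℂ)) * star U := by
    have := hA.isHermitian.spectral_theorem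
    rw [Unitary.conjStarAlgAut_apply] at this
    exact this
  have e : A - (a : ℂ) • 1 =
      U * Matrix.diagonal (fun i => ((hA.isHermitian.eigenvalues i - a : ℝ) : ℂ)) *
        U.conjTranspose := by
    have : Matrix.diagonal (fun i => ((hA.isHermitian.eigenvalues i - a : ℝ) : ℂ)) =
        Matrix.diagonal (fun i => (hA.isHermitian.eigenvalues i : ℂ)) - (a : ℂ) • 1 := by
      ext i j
      by_cases hij : i = j
      · subst hij; simp
      · simp [hij]
    rw [this, mul_sub, sub_mul, ← Matrix.star_eq_conjTranspose, ← hs]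
    simp [h1]
  rw [e]
  refine (Matrix.PosSemidef.diagonal fun i => ?_).mul_mul_conjTranspose_same U
  have := hA.inv_norm_inv_le_eigenvalues i
  simp only [Pi.zero_apply]
  exact_mod_cast sub_nonneg.2 (ha.trans this)

/-- The inverse of a matrix which is at least `s`. -/
theorem Matrix.PosDef.norm_inv_le {H : Matrix (Fin m) (Fin m) ℂ} (hH : H.PosDef) {s : ℝ}
    (hs : 0 < s) (h : (H - (s : ℂ) • 1).PosSemidef) : ‖H⁻¹‖ ≤ s⁻¹ := by
  have hdet : IsUnit H.det := (Matrix.isUnit_iff_isUnit_det _).1 hH.isUnit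
  refine hH.inv.posSemidef.norm_le_of_sub_sq hs ?_
  -- Conjugation by `H⁻¹` turns `H - s ≥ 0` into `P - s P² ≥ 0` for `P = H⁻¹`.
  have := h.mul_mul_conjTranspose_same H⁻¹
  rw [hH.inv.isHermitian.eq, mul_sub, sub_mul, Matrix.nonsing_inv_mul _ hdet, one_mul] at this
  simpa using this

theorem norm_inv_one_add_smul_le {T : Matrix (Fin n) (Fin n) ℂ} (hT : T.PosSemidef) {x : ℝ}
    (hx : 0 ≤ x) : ‖(1 + (x : ℂ) • T)⁻¹‖ ≤ 1 := by
  have h := (Matrix.PosDef.one.add_posSemidef (hT.real_smul hx)).norm_inv_le (s := 1) one_pos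
    (by simpa using hT.real_smul hx)
  simpa using h

/-- The resolvent of `V T V* + S`. -/
noncomputable def gramResolvent (S : Matrix (Fin m) (Fin m) ℂ) (T : Matrix (Fin n) (Fin n) ℂ)
    (V : Matrix (Fin m) (Fin n) ℂ) : Matrix (Fin m) (Fin m) ℂ :=
  (V * T * V.conjTranspose + S)⁻¹

section Resolvent

variable {S : Matrix (Fin m) (Fin m) ℂ} {T : Matrix (Fin n) (Fin n) ℂ}

theorem posDef_resolvent_inv (hS : S.PosDef) (hT : T.PosSemidef) (V : Matrix (Fin m) (Fin n) ℂ) :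
    (V * T * V.conjTranspose + S).PosDef :=
  hS.posSemidef_add (hT.mul_mul_conjTranspose_same V)

theorem isUnit_det_resolvent_inv (hS : S.PosDef) (hT : T.PosSemidef)
    (V : Matrix (Fin m) (Fin n) ℂ) : IsUnit (V * T * V.conjTranspose + S).det :=
  (Matrix.isUnit_iff_isUnit_det _).1 (posDef_resolvent_inv hS hT V).isUnit

theorem resolvent_posDef (hS : S.PosDef) (hT : T.PosSemidef) (V : Matrix (Fin m) (Fin n) ℂ) :
    (gramResolvent S T V).PosDef :=
  (posDef_resolvent_inv hS hT V).inv

theorem norm_resolvent_le (hS : S.PosDef) (hT : T.PosSemidef) {q : ℝ} (hq : 0 < q)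
    (hSq : (S - ((q⁻¹ : ℝ) : ℂ) • 1).PosSemidef) (V : Matrix (Fin m) (Fin n) ℂ) :
    ‖gramResolvent S T V‖ ≤ q := by
  have h := (posDef_resolvent_inv hS hT V).norm_inv_le (inv_pos.2 hq) (by
    rw [add_sub_assoc]
    exact (hT.mul_mul_conjTranspose_same V).add hSq)
  rwa [inv_inv] at h

/-- Let `P = V* Q V`. Since `Q⁻¹ ≥ t V V*`, conjugation by `Q V` gives `P - t P² ≥ 0`. The bound
does not involve `‖V‖`, so no estimate on the operator norm of a Gaussian matrix is ever needed. -/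
theorem norm_conjTranspose_mul_resolvent_mul_le (hS : S.PosDef) (hT : T.PosSemidef) {t : ℝ}
    (ht : 0 < t) (hTt : (T - (t : ℂ) • 1).PosSemidef) (V : Matrix (Fin m) (Fin n) ℂ) :
    ‖V.conjTranspose * gramResolvent S T V * V‖ ≤ t⁻¹ := by
  set Q := gramResolvent S T V with hQ
  have hQp : Q.PosDef := resolvent_posDef hS hT V
  refine (hQp.posSemidef.conjTranspose_mul_mul_same V).norm_le_of_sub_sq ht ?_
  have h1 : (V * (T - (t : ℂ) • 1) * V.conjTranspose + S).PosSemidef :=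
    (hTt.mul_mul_conjTranspose_same V).add hS.posSemidef
  have h2 := h1.conjTranspose_mul_mul_same (Q * V)
  have hid : Q * (V * T * V.conjTranspose + S) = 1 :=
    Matrix.nonsing_inv_mul _ (isUnit_det_resolvent_inv hS hT V)
  have e : (Q * V).conjTranspose * (V * (T - (t : ℂ) • 1) * V.conjTranspose + S) * (Q * V) =
      V.conjTranspose * Q * V -
        (t : ℂ) • (V.conjTranspose * Q * V * (V.conjTranspose * Q * V)) := by
    have e1 : V * (T - (t : ℂ) • 1) * V.conjTranspose + S =
        (V * T * V.conjTranspose + S) - (t : ℂ) • (V * V.conjTranspose) := by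
      simp only [Matrix.mul_sub, Matrix.sub_mul, Matrix.mul_smul, Matrix.smul_mul, Matrix.mul_one]
      abel
    rw [e1, Matrix.mul_sub, Matrix.sub_mul, Matrix.conjTranspose_mul, hQp.isHermitian.eq,
      Matrix.mul_assoc _ Q, hid]
    simp only [Matrix.mul_smul, Matrix.smul_mul, Matrix.mul_one, Matrix.mul_assoc]
  rwa [e] at h2

/-- From `Q⁻¹ ≥ q⁻¹` follows `V* Q² V ≤ q V* Q V`, and the left side has norm `‖Q V‖²`. -/
theorem sq_norm_resolvent_mul_le (hS : S.PosDef) (hT : T.PosSemidef) {q t : ℝ} (hq : 0 < q)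
    (hSq : (S - ((q⁻¹ : ℝ) : ℂ) • 1).PosSemidef)
    (ht : 0 < t) (hTt : (T - (t : ℂ) • 1).PosSemidef) (V : Matrix (Fin m) (Fin n) ℂ) :
    ‖gramResolvent S T V * V‖ ^ 2 ≤ q * t⁻¹ := by
  have hb := norm_conjTranspose_mul_resolvent_mul_le hS hT ht hTt V
  set Q := gramResolvent S T V with hQ
  have hQp : Q.PosDef := resolvent_posDef hS hT V
  have hid : Q * (V * T * V.conjTranspose + S) = 1 :=
    Matrix.nonsing_inv_mul _ (isUnit_det_resolvent_inv hS hT V)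
  have h1 : (V * T * V.conjTranspose + (S - ((q⁻¹ : ℝ) : ℂ) • 1)).PosSemidef :=
    (hT.mul_mul_conjTranspose_same V).add hSq
  have h2 := (h1.conjTranspose_mul_mul_same (Q * V)).real_smul hq.le
  have e : (q : ℂ) • ((Q * V).conjTranspose *
      (V * T * V.conjTranspose + (S - ((q⁻¹ : ℝ) : ℂ) • 1)) * (Q * V)) =
      (q : ℂ) • (V.conjTranspose * Q * V) - (Q * V).conjTranspose * (Q * V) := by
    rw [← add_sub_assoc, Matrix.mul_sub, Matrix.sub_mul, smul_sub]
    congr 1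
    · rw [Matrix.conjTranspose_mul, hQp.isHermitian.eq, Matrix.mul_assoc _ Q, hid, Matrix.mul_one,
        Matrix.mul_assoc]
    · have : (q : ℂ) ≠ 0 := by exact_mod_cast hq.ne'
      simp [smul_smul, this]
  rw [e] at h2
  have h3 := (Matrix.posSemidef_conjTranspose_mul_self (Q * V)).norm_le_norm h2
  rw [Matrix.l2_opNorm_conjTranspose_mul_self, norm_smul, Complex.norm_real,
    Real.norm_of_nonneg hq.le] at h3
  rw [sq]
  exact h3.trans (mul_le_mul_of_nonneg_left hb hq.le)

end Resolvent

end MatrixBounds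

/-! ### Derivatives of matrix-valued curves and second moments of Gaussian matrices. -/

section MatrixCalculus

noncomputable instance Matrix.borelMeasurableSpace {m n : ℕ} :
    MeasurableSpace (Matrix (Fin m) (Fin n) ℂ) := borel _

instance Matrix.borelSpace {m n : ℕ} : BorelSpace (Matrix (Fin m) (Fin n) ℂ) := ⟨rfl⟩

variable {m n l : ℕ}

/-- Matrix multiplication as a continuous real bilinear map. -/
noncomputable def matrixMulCLM (l m n : ℕ) : Matrix (Fin l) (Fin m) ℂ →L[ℝ]
    Matrix (Fin m) (Fin n) ℂ →L[ℝ] Matrix (Fin l) (Fin n) ℂ :=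
  LinearMap.mkContinuous₂ (LinearMap.mk₂ ℝ (fun A B => A * B) Matrix.add_mul
    (fun c A B => Matrix.smul_mul c A B) Matrix.mul_add (fun c A B => Matrix.mul_smul A c B)) 1
    fun A B => by simpa using Matrix.l2_opNorm_mul A B

/-- The conjugate transpose as a continuous real linear map. -/
noncomputable def conjTransposeCLM (m n : ℕ) :
    Matrix (Fin m) (Fin n) ℂ →L[ℝ] Matrix (Fin n) (Fin m) ℂ :=
  LinearMap.toContinuousLinearMap
    { toFun := Matrix.conjTranspose
      map_add' := Matrix.conjTranspose_add
      map_smul' := fun c A => by ext i j; simp }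

/-- The trace as a continuous real linear map. -/
noncomputable def traceCLM (m : ℕ) : Matrix (Fin m) (Fin m) ℂ →L[ℝ] ℂ :=
  LinearMap.toContinuousLinearMap
    { toFun := Matrix.trace
      map_add' := Matrix.trace_add
      map_smul' := fun c A => Matrix.trace_smul c A }

/-- An entry of a matrix as a continuous real linear map. -/
noncomputable def entryCLM (i : Fin m) (j : Fin n) : Matrix (Fin m) (Fin n) ℂ →L[ℝ] ℂ :=
  LinearMap.toContinuousLinearMap
    { toFun := fun A => A i j
      map_add' := fun _ _ => rfl
      map_smul' := fun _ _ => rfl }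

theorem HasDerivAt.matrix_mul {f : ℝ → Matrix (Fin l) (Fin m) ℂ} {g : ℝ → Matrix (Fin m) (Fin n) ℂ}
    {f' : Matrix (Fin l) (Fin m) ℂ} {g' : Matrix (Fin m) (Fin n) ℂ} {x : ℝ}
    (hf : HasDerivAt f f' x) (hg : HasDerivAt g g' x) :
    HasDerivAt (fun t => f t * g t) (f' * g x + f x * g') x := by
  have h := ((matrixMulCLM l m n).hasFDerivAt_of_bilinear hf.hasFDerivAt hg.hasFDerivAt).hasDerivAt
  have e : ((matrixMulCLM l m n).precompR ℝ (f x) (ContinuousLinearMap.toSpanSingleton ℝ g') +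
      (matrixMulCLM l m n).precompL ℝ (ContinuousLinearMap.toSpanSingleton ℝ f') (g x)) 1 =
      f' * g x + f x * g' := by
    simp [matrixMulCLM, add_comm]
  rw [e] at h
  exact h

theorem HasDerivAt.matrix_conjTranspose {f : ℝ → Matrix (Fin m) (Fin n) ℂ}
    {f' : Matrix (Fin m) (Fin n) ℂ} {x : ℝ} (hf : HasDerivAt f f' x) :
    HasDerivAt (fun t => (f t).conjTranspose) f'.conjTranspose x :=
  (conjTransposeCLM m n).hasFDerivAt.comp_hasDerivAt x hf

theorem HasDerivAt.matrix_trace {f : ℝ → Matrix (Fin m) (Fin m) ℂ}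
    {f' : Matrix (Fin m) (Fin m) ℂ} {x : ℝ} (hf : HasDerivAt f f' x) :
    HasDerivAt (fun t => (f t).trace) f'.trace x :=
  (traceCLM m).hasFDerivAt.comp_hasDerivAt x hf

theorem HasDerivAt.matrix_inv {f : ℝ → Matrix (Fin m) (Fin m) ℂ}
    {f' : Matrix (Fin m) (Fin m) ℂ} {x : ℝ} (hf : HasDerivAt f f' x) (hu : IsUnit (f x)) :
    HasDerivAt (fun t => (f t)⁻¹) (-((f x)⁻¹ * f' * (f x)⁻¹)) x := by
  obtain ⟨u, hu⟩ := hu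
  have h := hasFDerivAt_ringInverse (𝕜 := ℝ) u
  rw [hu] at h
  have h2 := h.comp_hasDerivAt x hf
  have e : ((u⁻¹ : (Matrix (Fin m) (Fin m) ℂ)ˣ) : Matrix (Fin m) (Fin m) ℂ) = (f x)⁻¹ := by
    rw [← hu, Matrix.coe_units_inv]
  rw [e] at h2
  simpa [Function.comp_def, Matrix.nonsing_inv_eq_ringInverse] using h2

theorem continuous_gramResolvent {S : Matrix (Fin m) (Fin m) ℂ} {T : Matrix (Fin n) (Fin n) ℂ}
    (hS : S.PosDef) (hT : T.PosSemidef) : Continuous (gramResolvent S T) := by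
  refine continuous_iff_continuousAt.2 fun V => ?_
  obtain ⟨u, hu⟩ := (posDef_resolvent_inv hS hT V).isUnit
  have h := NormedRing.inverse_continuousAt u
  rw [hu] at h
  have hc : Continuous fun V : Matrix (Fin m) (Fin n) ℂ => V * T * V.conjTranspose + S := by
    fun_prop
  have := ContinuousAt.comp (f := fun V : Matrix (Fin m) (Fin n) ℂ => V * T * V.conjTranspose + S)
    h hc.continuousAt
  simp only [Function.comp_def, ← Matrix.nonsing_inv_eq_ringInverse] at this
  exact this

theorem HasDerivAt.gramResolvent_comp {S : Matrix (Fin m) (Fin m) ℂ} {T : Matrix (Fin n) (Fin n) ℂ}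
    (hS : S.PosDef) (hT : T.PosSemidef) {V : ℝ → Matrix (Fin m) (Fin n) ℂ}
    {V' : Matrix (Fin m) (Fin n) ℂ} {x : ℝ} (hV : HasDerivAt V V' x) :
    HasDerivAt (fun t => gramResolvent S T (V t))
      (-(gramResolvent S T (V x) * (V' * T * (V x).conjTranspose + V x * T * V'.conjTranspose) *
        gramResolvent S T (V x))) x := by
  have h := (((hV.matrix_mul (hasDerivAt_const x T)).matrix_mul
    hV.matrix_conjTranspose).add_const S).matrix_inv (posDef_resolvent_inv hS hT (V x)).isUnit
  simp only [Matrix.mul_zero, add_zero] at h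
  exact h

section

variable {E : Type*} [NormedAddCommGroup E] [NormedSpace ℝ E]

/-- Under rotation the velocity of the first component is the second one. Hence derivatives along
the rotation are functions of the pair, with `p.1` as base point and `p.2` as direction. -/
theorem hasDerivAt_rotation_fst (p : E × E) (θ : ℝ) :
    HasDerivAt (fun θ => (ContinuousLinearMap.rotation θ p).1)
      (ContinuousLinearMap.rotation θ p).2 θ := by
  simp only [ContinuousLinearMap.rotation_apply]
  exact ((Real.hasDerivAt_cos θ).smul_const p.1).add ((Real.hasDerivAt_sin θ).smul_const p.2)

theorem hasDerivAt_rotation_snd (p : E × E) (θ : ℝ) :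
    HasDerivAt (fun θ => (ContinuousLinearMap.rotation θ p).2)
      (-(ContinuousLinearMap.rotation θ p).1) θ := by
  simp only [ContinuousLinearMap.rotation_apply, neg_add, ← neg_smul]
  exact ((Real.hasDerivAt_sin θ).neg.smul_const p.1).add ((Real.hasDerivAt_cos θ).smul_const p.2)

end

namespace PolyGrowth

variable {E : Type*} [NormedAddCommGroup E]

theorem clm {F G : Type*} [NormedAddCommGroup F] [NormedAddCommGroup G] [NormedSpace ℝ F]
    [NormedSpace ℝ G] {f : E → F} (hf : PolyGrowth f) (L : F →L[ℝ] G) :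
    PolyGrowth (fun x => L (f x)) :=
  hf.of_le (L.continuous.comp hf.continuous) (norm_nonneg L) fun x => L.le_opNorm (f x)

theorem matrix_mul {f : E → Matrix (Fin l) (Fin m) ℂ} {g : E → Matrix (Fin m) (Fin n) ℂ}
    (hf : PolyGrowth f) (hg : PolyGrowth g) : PolyGrowth (fun x => f x * g x) :=
  hf.bilin hg (hf.continuous.matrix_mul hg.continuous) fun x => Matrix.l2_opNorm_mul (f x) (g x)

theorem conjTranspose {f : E → Matrix (Fin m) (Fin n) ℂ} (hf : PolyGrowth f) :
    PolyGrowth (fun x => (f x).conjTranspose) :=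
  hf.clm (conjTransposeCLM m n)

theorem trace {f : E → Matrix (Fin m) (Fin m) ℂ} (hf : PolyGrowth f) :
    PolyGrowth (fun x => (f x).trace) :=
  hf.clm (traceCLM m)

theorem entry {f : E → Matrix (Fin m) (Fin n) ℂ} (hf : PolyGrowth f) (i : Fin m) (j : Fin n) :
    PolyGrowth (fun x => f x i j) :=
  hf.clm (entryCLM i j)

theorem star {f : E → ℂ} (hf : PolyGrowth f) : PolyGrowth (fun x => star (f x)) :=
  hf.of_le hf.continuous.star zero_le_one fun x => by simp

end PolyGrowth

/-- The law of a matrix with i.i.d. centered circular complex Gaussian entries of variance `σ`. -/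
structure IsCircularGaussian (μ : Measure (Matrix (Fin m) (Fin n) ℂ)) (σ : ℝ) : Prop where
  isGaussian : IsGaussian μ
  map_rotation : ∀ θ, (μ.prod μ).map (ContinuousLinearMap.rotation θ) = μ.prod μ
  integral_mul_star : ∀ i j k l, ∫ Y, Y i j * star (Y k l) ∂μ = if i = k ∧ j = l then (σ : ℂ) else 0
  integral_mul : ∀ i j k l, ∫ Y, Y i j * Y k l ∂μ = 0

namespace IsCircularGaussian

variable {μ : Measure (Matrix (Fin m) (Fin n) ℂ)} {σ : ℝ} (hμ : IsCircularGaussian μ σ)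
include hμ

/-- Only the products of an entry with its own conjugate have nonzero mean, and they split the trace
into two. -/
theorem integral_trace_mul_conjTranspose (A : Matrix (Fin m) (Fin m) ℂ)
    (B : Matrix (Fin n) (Fin n) ℂ) :
    ∫ Y, (A * Y * B * Y.conjTranspose).trace ∂μ = σ * A.trace * B.trace := by
  have := hμ.isGaussian
  have e : ∀ Y : Matrix (Fin m) (Fin n) ℂ, (A * Y * B * Y.conjTranspose).trace =
      ∑ i, ∑ l, ∑ k, ∑ j, (A i j * B k l) * (Y j k * star (Y i l)) := fun Y => by
    simp only [Matrix.trace, Matrix.diag, Matrix.mul_apply, Finset.sum_mul,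
      Matrix.conjTranspose_apply]
    refine Finset.sum_congr rfl fun i _ => Finset.sum_congr rfl fun l _ =>
      Finset.sum_congr rfl fun k _ => Finset.sum_congr rfl fun j _ => by ring
  have hi : ∀ i j k l, Integrable (fun Y : Matrix (Fin m) (Fin n) ℂ =>
      (A i j * B k l) * (Y j k * star (Y i l))) μ := fun i j k l =>
    (((PolyGrowth.id.entry j k).mul (PolyGrowth.id.entry i l).star).integrable μ).const_mul _
  simp only [e]
  rw [integral_finsetSum _ fun i _ => integrable_finsetSum _ fun l _ =>
    integrable_finsetSum _ fun k _ => integrable_finsetSum _ fun j _ => hi i j k l]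
  have h2 : ∀ i, ∫ Y : Matrix (Fin m) (Fin n) ℂ, ∑ l, ∑ k, ∑ j,
      (A i j * B k l) * (Y j k * star (Y i l)) ∂μ =
      ∑ l, ∑ k, ∑ j, (A i j * B k l) * (if j = i ∧ k = l then (σ : ℂ) else 0) := fun i => by
    rw [integral_finsetSum _ fun l _ =>
      integrable_finsetSum _ fun k _ => integrable_finsetSum _ fun j _ => hi i j k l]
    refine Finset.sum_congr rfl fun l _ => ?_
    rw [integral_finsetSum _ fun k _ => integrable_finsetSum _ fun j _ => hi i j k l]
    refine Finset.sum_congr rfl fun k _ => ?_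
    rw [integral_finsetSum _ fun j _ => hi i j k l]
    refine Finset.sum_congr rfl fun j _ => ?_
    rw [integral_const_mul, hμ.integral_mul_star]
  simp only [h2, ite_and, mul_ite, mul_zero, Finset.sum_ite_eq',
    Finset.mem_univ, if_true, Matrix.trace, Matrix.diag]
  simp only [Finset.mul_sum, Finset.sum_mul]
  rw [Finset.sum_comm]
  exact Finset.sum_congr rfl fun l _ => Finset.sum_congr rfl fun k _ => by ring

/-- Circularity: this removes from the integration by parts the term in which the direction occurs
twice without a conjugate. -/
theorem integral_trace_mul_mul (A B : Matrix (Fin n) (Fin m) ℂ) :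
    ∫ Y, (A * Y * B * Y).trace ∂μ = 0 := by
  have := hμ.isGaussian
  have e : ∀ Y : Matrix (Fin m) (Fin n) ℂ, (A * Y * B * Y).trace =
      ∑ i, ∑ l, ∑ k, ∑ j, (A i j * B k l) * (Y j k * Y l i) := fun Y => by
    simp only [Matrix.trace, Matrix.diag, Matrix.mul_apply, Finset.sum_mul]
    refine Finset.sum_congr rfl fun i _ => Finset.sum_congr rfl fun l _ =>
      Finset.sum_congr rfl fun k _ => Finset.sum_congr rfl fun j _ => by ring
  have hi : ∀ i j k l, Integrable (fun Y : Matrix (Fin m) (Fin n) ℂ =>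
      (A i j * B k l) * (Y j k * Y l i)) μ := fun i j k l =>
    (((PolyGrowth.id.entry j k).mul (PolyGrowth.id.entry l i)).integrable μ).const_mul _
  simp only [e]
  rw [integral_finsetSum _ fun i _ => integrable_finsetSum _ fun l _ =>
    integrable_finsetSum _ fun k _ => integrable_finsetSum _ fun j _ => hi i j k l]
  refine Finset.sum_eq_zero fun i _ => ?_
  rw [integral_finsetSum _ fun l _ =>
    integrable_finsetSum _ fun k _ => integrable_finsetSum _ fun j _ => hi i j k l]
  refine Finset.sum_eq_zero fun l _ => ?_
  rw [integral_finsetSum _ fun k _ => integrable_finsetSum _ fun j _ => hi i j k l]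
  refine Finset.sum_eq_zero fun k _ => ?_
  rw [integral_finsetSum _ fun j _ => hi i j k l]
  refine Finset.sum_eq_zero fun j _ => ?_
  rw [integral_const_mul, hμ.integral_mul, mul_zero]

/-- Converts the mean square of a directional derivative over a Gaussian direction into a Frobenius
norm. -/
theorem integral_sq_norm_trace_mul (A : Matrix (Fin n) (Fin m) ℂ) :
    ∫ Y, ‖(A * Y).trace‖ ^ 2 ∂μ = σ * frobeniusNorm A ^ 2 := by
  have := hμ.isGaussian
  rw [← Complex.ofReal_inj, ← integral_complex_ofReal]
  have e : ∀ Y : Matrix (Fin m) (Fin n) ℂ, ((‖(A * Y).trace‖ ^ 2 : ℝ) : ℂ) =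
      ∑ i, ∑ j, ∑ k, ∑ l, (A i j * star (A k l)) * (Y j i * star (Y l k)) := fun Y => by
    rw [Complex.ofReal_pow, ← Complex.conj_mul']
    simp only [Matrix.trace, Matrix.diag, Matrix.mul_apply, map_sum, map_mul, Finset.sum_mul,
      Finset.mul_sum]
    refine Finset.sum_congr rfl fun i _ => ?_
    refine Finset.sum_congr rfl fun j _ => ?_
    refine Finset.sum_congr rfl fun k _ => Finset.sum_congr rfl fun l _ => ?_
    simp only [Complex.star_def]
    ring
  have hi : ∀ i j k l, Integrable (fun Y : Matrix (Fin m) (Fin n) ℂ =>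
      (A i j * star (A k l)) * (Y j i * star (Y l k))) μ := fun i j k l =>
    (((PolyGrowth.id.entry j i).mul (PolyGrowth.id.entry l k).star).integrable μ).const_mul _
  simp only [e]
  rw [integral_finsetSum _ fun i _ => integrable_finsetSum _ fun j _ =>
    integrable_finsetSum _ fun k _ => integrable_finsetSum _ fun l _ => hi i j k l]
  have h2 : ∀ i, ∫ Y : Matrix (Fin m) (Fin n) ℂ, ∑ j, ∑ k, ∑ l,
      (A i j * star (A k l)) * (Y j i * star (Y l k)) ∂μ =
      ∑ j, ∑ k, ∑ l, (A i j * star (A k l)) * (if j = l ∧ i = k then (σ : ℂ) else 0) :=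
        fun i => by
    rw [integral_finsetSum _ fun j _ =>
      integrable_finsetSum _ fun k _ => integrable_finsetSum _ fun l _ => hi i j k l]
    refine Finset.sum_congr rfl fun j _ => ?_
    rw [integral_finsetSum _ fun k _ => integrable_finsetSum _ fun l _ => hi i j k l]
    refine Finset.sum_congr rfl fun k _ => ?_
    rw [integral_finsetSum _ fun l _ => hi i j k l]
    refine Finset.sum_congr rfl fun l _ => ?_
    rw [integral_const_mul, hμ.integral_mul_star]
  simp only [h2, ite_and, mul_ite, mul_zero, Finset.sum_ite_eq,
    Finset.mem_univ, if_true]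
  rw [sq_frobeniusNorm, Finset.sum_comm]
  push_cast
  simp only [Finset.mul_sum]
  refine Finset.sum_congr rfl fun j _ => Finset.sum_congr rfl fun i _ => ?_
  rw [Complex.star_def, Complex.mul_conj', mul_comm]

theorem integral_sq_norm_trace_mul_conjTranspose (A : Matrix (Fin m) (Fin n) ℂ) :
    ∫ Y, ‖(A * Y.conjTranspose).trace‖ ^ 2 ∂μ = σ * frobeniusNorm A ^ 2 := by
  rw [← frobeniusNorm_conjTranspose, ← hμ.integral_sq_norm_trace_mul]
  refine integral_congr_ae (ae_of_all _ fun Y => ?_)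
  have : (A.conjTranspose * Y).trace = star (A * Y.conjTranspose).trace := by
    rw [← Matrix.trace_conjTranspose, Matrix.conjTranspose_mul, Matrix.conjTranspose_conjTranspose,
      Matrix.trace_mul_comm]
  simp only [this, norm_star]

/-- When `σ n = 1`, an unbounded factor `V*` in front of `A` costs nothing in mean square. -/
theorem integral_sq_frobeniusNorm_conjTranspose_mul (A : Matrix (Fin m) (Fin m) ℂ) :
    ∫ V, frobeniusNorm (V.conjTranspose * A) ^ 2 ∂μ = σ * n * frobeniusNorm A ^ 2 := by
  have := hμ.isGaussian
  have h := hμ.integral_trace_mul_conjTranspose (A * A.conjTranspose) 1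
  have e : ∀ {k : ℕ} (B : Matrix (Fin k) (Fin m) ℂ),
      frobeniusNorm B ^ 2 = (B * B.conjTranspose).trace.re := fun B => by
    rw [← frobeniusNorm_conjTranspose, frobeniusNorm, Matrix.conjTranspose_conjTranspose,
      Real.sq_sqrt]
    have := (Matrix.posSemidef_self_mul_conjTranspose B).trace_nonneg
    exact (Complex.le_def.1 this).1
  have h2 := congrArg Complex.re h
  rw [← RCLike.re_eq_complex_re, ← integral_re] at h2
  · rw [e A]
    refine (integral_congr_ae (ae_of_all _ fun V => ?_)).trans (h2.trans ?_)
    · simp only [RCLike.re_eq_complex_re]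
      rw [e, Matrix.conjTranspose_mul, Matrix.conjTranspose_conjTranspose, Matrix.mul_one,
        Matrix.trace_mul_comm _ V.conjTranspose]
      simp only [Matrix.mul_assoc]
    · simp only [RCLike.re_eq_complex_re, Matrix.trace_one, Fintype.card_fin]
      rw [mul_right_comm, ← Complex.ofReal_natCast, ← Complex.ofReal_mul, Complex.re_ofReal_mul]
  · exact (((((PolyGrowth.const _).matrix_mul PolyGrowth.id).matrix_mul
      (PolyGrowth.const _)).matrix_mul PolyGrowth.id.conjTranspose).trace).integrable μ

end IsCircularGaussian

end MatrixCalculus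

/-! ### Integration by parts for the resolvent and the covariance estimate. -/

section ResolventMoments

variable {m n : ℕ} {μ : Measure (Matrix (Fin m) (Fin n) ℂ)} {σ : ℝ}
  {S : Matrix (Fin m) (Fin m) ℂ} {T : Matrix (Fin n) (Fin n) ℂ} {q : ℝ}

theorem polyGrowth_gramResolvent (hS : S.PosDef) (hT : T.PosSemidef) (hq : 0 < q)
    (hSq : (S - ((q⁻¹ : ℝ) : ℂ) • 1).PosSemidef) : PolyGrowth (gramResolvent S T) :=
  .of_bounded (continuous_gramResolvent hS hT) (norm_resolvent_le hS hT hq hSq)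

/-- The derivative of the resolvent at `x` in the direction `y`. -/
noncomputable def gramResolventDeriv (S : Matrix (Fin m) (Fin m) ℂ) (T : Matrix (Fin n) (Fin n) ℂ)
    (p : Matrix (Fin m) (Fin n) ℂ × Matrix (Fin m) (Fin n) ℂ) : Matrix (Fin m) (Fin m) ℂ :=
  -(gramResolvent S T p.1 * (p.2 * T * p.1.conjTranspose + p.1 * T * p.2.conjTranspose) *
    gramResolvent S T p.1)

theorem polyGrowth_gramResolventDeriv (hS : S.PosDef) (hT : T.PosSemidef) (hq : 0 < q)
    (hSq : (S - ((q⁻¹ : ℝ) : ℂ) • 1).PosSemidef) : PolyGrowth (gramResolventDeriv S T) := by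
  have hG := (polyGrowth_gramResolvent hS hT hq hSq).comp_fst (G := Matrix (Fin m) (Fin n) ℂ)
  have h1 : PolyGrowth fun p : Matrix (Fin m) (Fin n) ℂ × Matrix (Fin m) (Fin n) ℂ => p.1 :=
    PolyGrowth.id.comp_fst
  have h2 : PolyGrowth fun p : Matrix (Fin m) (Fin n) ℂ × Matrix (Fin m) (Fin n) ℂ => p.2 :=
    PolyGrowth.id.comp_snd
  exact ((hG.matrix_mul (((h2.matrix_mul (.const T)).matrix_mul h1.conjTranspose).add
    ((h1.matrix_mul (.const T)).matrix_mul h2.conjTranspose))).matrix_mul hG).neg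

theorem hasDerivAt_gramResolvent_rotation (hS : S.PosDef) (hT : T.PosSemidef)
    (p : Matrix (Fin m) (Fin n) ℂ × Matrix (Fin m) (Fin n) ℂ) (θ : ℝ) :
    HasDerivAt (fun θ => gramResolvent S T (ContinuousLinearMap.rotation θ p).1)
      (gramResolventDeriv S T (ContinuousLinearMap.rotation θ p)) θ :=
  (hasDerivAt_rotation_fst p θ).gramResolvent_comp hS hT

/-- Cyclicity of the trace isolates the direction `p.2`: when `A` and `B` do not involve it, the
result is a linear form in the direction plus one in its adjoint. -/
theorem trace_mul_gramResolventDeriv_mul (p : Matrix (Fin m) (Fin n) ℂ × Matrix (Fin m) (Fin n) ℂ)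
    (A B : Matrix (Fin m) (Fin m) ℂ) :
    (A * gramResolventDeriv S T p * B).trace =
      -(((T * p.1.conjTranspose * gramResolvent S T p.1 * B * A * gramResolvent S T p.1) *
          p.2).trace +
        ((gramResolvent S T p.1 * B * A * gramResolvent S T p.1 * p.1 * T) *
          p.2.conjTranspose).trace) := by
  have e1 := Matrix.trace_mul_comm (A * gramResolvent S T p.1 * p.2)
    (T * p.1.conjTranspose * gramResolvent S T p.1 * B)
  have e2 := Matrix.trace_mul_comm (A * gramResolvent S T p.1 * p.1 * T * p.2.conjTranspose)
    (gramResolvent S T p.1 * B)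
  simp only [Matrix.mul_assoc] at e1 e2
  simp only [gramResolventDeriv, Matrix.mul_neg, Matrix.neg_mul, Matrix.mul_add, Matrix.add_mul,
    Matrix.trace_neg, Matrix.trace_add, Matrix.mul_assoc, e1, e2]

/-- Gaussian integration by parts for `E tr[A Q V B V*]`. -/
theorem integral_trace_resolvent_mul (hμ : IsCircularGaussian μ σ) (hS : S.PosDef)
    (hT : T.PosSemidef) (hq : 0 < q) (hSq : (S - ((q⁻¹ : ℝ) : ℂ) • 1).PosSemidef)
    (A : Matrix (Fin m) (Fin m) ℂ) (B : Matrix (Fin n) (Fin n) ℂ) :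
    ∫ V, (A * (gramResolvent S T V * V * B * V.conjTranspose)).trace ∂μ =
      σ * B.trace * ∫ V, (A * gramResolvent S T V).trace ∂μ -
      σ * ∫ V, (gramResolvent S T V).trace *
        (A * (gramResolvent S T V * V * (T * B) * V.conjTranspose)).trace ∂μ := by
  have := hμ.isGaussian
  have hG0 := polyGrowth_gramResolvent hS hT hq hSq
  have hG := hG0.comp_fst (G := Matrix (Fin m) (Fin n) ℂ)
  have hD := polyGrowth_gramResolventDeriv hS hT hq hSq
  have h1 : PolyGrowth fun p : Matrix (Fin m) (Fin n) ℂ × Matrix (Fin m) (Fin n) ℂ => p.1 :=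
    PolyGrowth.id.comp_fst
  have h2 : PolyGrowth fun p : Matrix (Fin m) (Fin n) ℂ × Matrix (Fin m) (Fin n) ℂ => p.2 :=
    PolyGrowth.id.comp_snd
  -- One of the two factors `V` is replaced by the independent copy `p.2`. Rotation turns this copy
  -- back into `-p.1`, which produces the left side of the claim, while the other terms are
  -- quadratic in `p.2`.
  have hJ : PolyGrowth fun p : Matrix (Fin m) (Fin n) ℂ × Matrix (Fin m) (Fin n) ℂ =>
      (A * (gramResolvent S T p.1 * p.2 * B * p.1.conjTranspose)).trace :=
    ((PolyGrowth.const A).matrix_mul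
      (((hG.matrix_mul h2).matrix_mul (.const B)).matrix_mul h1.conjTranspose)).trace
  have hDJ : PolyGrowth fun p : Matrix (Fin m) (Fin n) ℂ × Matrix (Fin m) (Fin n) ℂ =>
      (A * ((gramResolventDeriv S T p * p.2 + gramResolvent S T p.1 * -p.1) * B *
        p.1.conjTranspose + gramResolvent S T p.1 * p.2 * B * p.2.conjTranspose)).trace :=
    ((PolyGrowth.const A).matrix_mul
      (((((hD.matrix_mul h2).add (hG.matrix_mul h1.neg)).matrix_mul (.const B)).matrix_mul
        h1.conjTranspose).add
        (((hG.matrix_mul h2).matrix_mul (.const B)).matrix_mul h2.conjTranspose))).trace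
  have key := integral_rotationDeriv_eq_zero hμ.map_rotation hJ hDJ fun p θ => by
    have h := ((hasDerivAt_const θ A).matrix_mul
      ((((hasDerivAt_gramResolvent_rotation hS hT p θ).matrix_mul
        (hasDerivAt_rotation_snd p θ)).matrix_mul (hasDerivAt_const θ B)).matrix_mul
        (hasDerivAt_rotation_fst p θ).matrix_conjTranspose)).matrix_trace
    simp only [Matrix.mul_zero, Matrix.zero_mul, zero_add, add_zero] at h
    exact h
  rw [integral_prod _ (hDJ.integrable _)] at key
  -- The copy `y` is integrated out first, with `x` fixed. Of the three quadratic terms, the two of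
  -- the form `y ⋯ y*` give products of traces and the one of the form `y ⋯ y` vanishes.
  have inner : ∀ x : Matrix (Fin m) (Fin n) ℂ, ∫ y, (A * ((gramResolventDeriv S T (x, y) * y +
      gramResolvent S T x * -x) * B * x.conjTranspose +
        gramResolvent S T x * y * B * y.conjTranspose)).trace ∂μ =
      σ * B.trace * (A * gramResolvent S T x).trace -
      σ * ((gramResolvent S T x).trace *
        (A * (gramResolvent S T x * x * (T * B) * x.conjTranspose)).trace) -
      (A * (gramResolvent S T x * x * B * x.conjTranspose)).trace := fun x => by
    set G := gramResolvent S T x with hGdef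
    have e : ∀ y : Matrix (Fin m) (Fin n) ℂ, (A * ((gramResolventDeriv S T (x, y) * y +
        G * -x) * B * x.conjTranspose + G * y * B * y.conjTranspose)).trace =
        ((A * G) * y * B * y.conjTranspose).trace -
        (G * y * (B * x.conjTranspose * A * G * x * T) * y.conjTranspose).trace -
        ((B * x.conjTranspose * A * G) * y * (T * x.conjTranspose * G) * y).trace -
        (A * (G * x * B * x.conjTranspose)).trace := fun y => by
      have e0 := trace_mul_gramResolventDeriv_mul (S := S) (T := T) (x, y) A
        (y * B * x.conjTranspose)
      simp only [Matrix.mul_assoc, ← hGdef] at e0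
      have e1 : (T * (x.conjTranspose * (G * (y * (B * (x.conjTranspose * (A * (G * y)))))))).trace
          = (B * (x.conjTranspose * (A * (G * (y * (T * (x.conjTranspose * (G * y)))))))).trace := by
        have := Matrix.trace_mul_comm (T * x.conjTranspose * G * y) (B * x.conjTranspose * A * G * y)
        simpa only [Matrix.mul_assoc] using this
      simp only [Matrix.mul_add, Matrix.add_mul, Matrix.trace_add, Matrix.mul_neg, Matrix.neg_mul,
        Matrix.trace_neg, Matrix.mul_assoc, e0, e1]
      ring
    have i1 : PolyGrowth fun y : Matrix (Fin m) (Fin n) ℂ =>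
        ((A * G) * y * B * y.conjTranspose).trace :=
      ((((PolyGrowth.const _).matrix_mul .id).matrix_mul (.const B)).matrix_mul
        PolyGrowth.id.conjTranspose).trace
    have i2 : PolyGrowth fun y : Matrix (Fin m) (Fin n) ℂ =>
        (G * y * (B * x.conjTranspose * A * G * x * T) * y.conjTranspose).trace :=
      ((((PolyGrowth.const _).matrix_mul .id).matrix_mul (.const _)).matrix_mul
        PolyGrowth.id.conjTranspose).trace
    have i3 : PolyGrowth fun y : Matrix (Fin m) (Fin n) ℂ =>
        ((B * x.conjTranspose * A * G) * y * (T * x.conjTranspose * G) * y).trace :=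
      ((((PolyGrowth.const _).matrix_mul .id).matrix_mul (.const _)).matrix_mul .id).trace
    simp only [e]
    rw [integral_sub (((i1.sub i2).sub i3).integrable μ) (integrable_const _),
      integral_sub ((i1.sub i2).integrable μ) (i3.integrable μ),
      integral_sub (i1.integrable μ) (i2.integrable μ), hμ.integral_trace_mul_conjTranspose,
      hμ.integral_trace_mul_conjTranspose, hμ.integral_trace_mul_mul, integral_const]
    have e2 : (B * x.conjTranspose * A * G * x * T).trace =
        (A * (G * x * (T * B) * x.conjTranspose)).trace := by
      have := Matrix.trace_mul_comm (B * x.conjTranspose) (A * G * x * T)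
      simpa only [Matrix.mul_assoc] using this
    rw [e2]
    simp
    ring
  simp only [inner] at key
  have i1 : PolyGrowth fun x : Matrix (Fin m) (Fin n) ℂ => (A * gramResolvent S T x).trace :=
    ((PolyGrowth.const A).matrix_mul hG0).trace
  have i2 : ∀ B : Matrix (Fin n) (Fin n) ℂ, PolyGrowth fun x : Matrix (Fin m) (Fin n) ℂ =>
      (A * (gramResolvent S T x * x * B * x.conjTranspose)).trace := fun B =>
    ((PolyGrowth.const A).matrix_mul (((hG0.matrix_mul .id).matrix_mul (.const B)).matrix_mul
      PolyGrowth.id.conjTranspose)).trace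
  have i3 := hG0.trace.mul (i2 (T * B))
  have i4 := (PolyGrowth.const (E := Matrix (Fin m) (Fin n) ℂ) (σ * B.trace : ℂ)).mul i1
  have i5 := (PolyGrowth.const (E := Matrix (Fin m) (Fin n) ℂ) (σ : ℂ)).mul i3
  rw [integral_sub ((i4.sub i5).integrable μ) ((i2 B).integrable μ),
    integral_sub (i4.integrable μ) (i5.integrable μ), integral_const_mul, integral_const_mul] at key
  linear_combination -key

theorem integral_sq_norm_trace_add_le (hμ : IsCircularGaussian μ σ)
    (A : Matrix (Fin n) (Fin m) ℂ) (B : Matrix (Fin m) (Fin n) ℂ) :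
    ∫ Y, ‖(A * Y).trace + (B * Y.conjTranspose).trace‖ ^ 2 ∂μ ≤
      2 * σ * (frobeniusNorm A ^ 2 + frobeniusNorm B ^ 2) := by
  have := hμ.isGaussian
  have i1 : PolyGrowth fun Y : Matrix (Fin m) (Fin n) ℂ => (A * Y).trace :=
    ((PolyGrowth.const A).matrix_mul .id).trace
  have i2 : PolyGrowth fun Y : Matrix (Fin m) (Fin n) ℂ => (B * Y.conjTranspose).trace :=
    ((PolyGrowth.const B).matrix_mul PolyGrowth.id.conjTranspose).trace
  calc _ ≤ ∫ Y, (2 * ‖(A * Y).trace‖ ^ 2 + 2 * ‖(B * Y.conjTranspose).trace‖ ^ 2) ∂μ := by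
        refine integral_mono ((i1.add i2).norm_sq.integrable μ)
          (((i1.norm_sq.integrable μ).const_mul 2).add ((i2.norm_sq.integrable μ).const_mul 2))
          fun Y => ?_
        have h := norm_add_le (A * Y).trace (B * Y.conjTranspose).trace
        have h0 := norm_nonneg ((A * Y).trace + (B * Y.conjTranspose).trace)
        simp only
        nlinarith [sq_nonneg (‖(A * Y).trace‖ - ‖(B * Y.conjTranspose).trace‖)]
    _ = _ := by
        rw [integral_add ((i1.norm_sq.integrable μ).const_mul 2)
          ((i2.norm_sq.integrable μ).const_mul 2), integral_const_mul, integral_const_mul,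
          hμ.integral_sq_norm_trace_mul, hμ.integral_sq_norm_trace_mul_conjTranspose]
        ring

variable {t tS : ℝ}

/-- The derivative of `tr Q` in direction `y` has coefficients `T V* Q²` and `Q² V T`, with
Frobenius norm at most `‖Q‖_F ‖Q V‖ ‖T‖`, of order `√m`. Thus the bound stays `O(1)` as long as `σ
m` is bounded. -/
theorem integral_sq_norm_trace_gramResolventDeriv_le (hμ : IsCircularGaussian μ σ) (hσ : 0 ≤ σ)
    (hS : S.PosDef) (hT : T.PosSemidef) (hq : 0 < q)
    (hSq : (S - ((q⁻¹ : ℝ) : ℂ) • 1).PosSemidef) (ht : 0 < t)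
    (hTt : (T - (t : ℂ) • 1).PosSemidef) (hTS : ‖T‖ ≤ tS) :
    ∫ p, ‖(gramResolventDeriv S T p).trace‖ ^ 2 ∂(μ.prod μ) ≤
      4 * (σ * m) * (tS ^ 2 * (q * t⁻¹) * q ^ 2) := by
  have := hμ.isGaussian
  have hD := (polyGrowth_gramResolventDeriv hS hT hq hSq).trace.norm_sq
  have htS : 0 ≤ tS := (norm_nonneg _).trans hTS
  rw [integral_prod _ (hD.integrable _)]
  have inner : ∀ x : Matrix (Fin m) (Fin n) ℂ,
      ∫ y, ‖(gramResolventDeriv S T (x, y)).trace‖ ^ 2 ∂μ ≤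
        4 * (σ * m) * (tS ^ 2 * (q * t⁻¹) * q ^ 2) := fun x => by
    have hQ := norm_resolvent_le hS hT hq hSq x
    have hQV := sq_norm_resolvent_mul_le hS hT hq hSq ht hTt x
    have hQh : (gramResolvent S T x).conjTranspose = gramResolvent S T x :=
      (resolvent_posDef hS hT x).isHermitian.eq
    have e := fun y => trace_mul_gramResolventDeriv_mul (S := S) (T := T) (x, y) 1 1
    set G := gramResolvent S T x with hG
    simp only [Matrix.one_mul, Matrix.mul_one, ← hG] at e
    simp only [e, norm_neg]
    refine (integral_sq_norm_trace_add_le hμ _ _).trans ?_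
    have hF : frobeniusNorm (G * G * x * T) ^ 2 ≤ tS ^ 2 * (q * t⁻¹) * q ^ 2 * m := by
      have h1 : frobeniusNorm (G * G * x * T) ≤ frobeniusNorm G * ‖G * x‖ * ‖T‖ := by
        refine (frobeniusNorm_mul_le_right _ _).trans ?_
        gcongr
        rw [Matrix.mul_assoc]
        exact frobeniusNorm_mul_le_right _ _
      have h2 : frobeniusNorm G ≤ q * √m := (frobeniusNorm_le G).trans (by gcongr)
      calc frobeniusNorm (G * G * x * T) ^ 2 ≤ ((q * √m) * ‖G * x‖ * tS) ^ 2 := by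
            gcongr
            · exact frobeniusNorm_nonneg _
            · refine h1.trans ?_
              gcongr
        _ = (q ^ 2 * √m ^ 2) * ‖G * x‖ ^ 2 * tS ^ 2 := by ring
        _ ≤ (q ^ 2 * √m ^ 2) * (q * t⁻¹) * tS ^ 2 := by gcongr
        _ = _ := by rw [Real.sq_sqrt (Nat.cast_nonneg _)]; ring
    have hF' : frobeniusNorm (T * x.conjTranspose * G * G) = frobeniusNorm (G * G * x * T) := by
      rw [← frobeniusNorm_conjTranspose]
      simp only [Matrix.conjTranspose_mul, Matrix.conjTranspose_conjTranspose, hQh,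
        hT.isHermitian.eq, Matrix.mul_assoc]
    rw [hF']
    nlinarith
  calc _ ≤ ∫ _, 4 * (σ * m) * (tS ^ 2 * (q * t⁻¹) * q ^ 2) ∂μ :=
        integral_mono (hD.integrable _).integral_prod_left (integrable_const _) inner
    _ = _ := by simp

/-- The directional derivative of `tr[A Q V C V*]`. -/
noncomputable def gramFormDeriv (S : Matrix (Fin m) (Fin m) ℂ) (T : Matrix (Fin n) (Fin n) ℂ)
    (A : Matrix (Fin m) (Fin m) ℂ) (C : Matrix (Fin n) (Fin n) ℂ)
    (p : Matrix (Fin m) (Fin n) ℂ × Matrix (Fin m) (Fin n) ℂ) : ℂ :=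
  (A * ((gramResolventDeriv S T p * p.1 + gramResolvent S T p.1 * p.2) * C *
    p.1.conjTranspose + gramResolvent S T p.1 * p.1 * C * p.2.conjTranspose)).trace

theorem polyGrowth_gramFormDeriv (hS : S.PosDef) (hT : T.PosSemidef) (hq : 0 < q)
    (hSq : (S - ((q⁻¹ : ℝ) : ℂ) • 1).PosSemidef) (A : Matrix (Fin m) (Fin m) ℂ)
    (C : Matrix (Fin n) (Fin n) ℂ) : PolyGrowth (gramFormDeriv S T A C) := by
  have hG := (polyGrowth_gramResolvent hS hT hq hSq).comp_fst (G := Matrix (Fin m) (Fin n) ℂ)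
  have hD := polyGrowth_gramResolventDeriv hS hT hq hSq
  have h1 : PolyGrowth fun p : Matrix (Fin m) (Fin n) ℂ × Matrix (Fin m) (Fin n) ℂ => p.1 :=
    PolyGrowth.id.comp_fst
  have h2 : PolyGrowth fun p : Matrix (Fin m) (Fin n) ℂ × Matrix (Fin m) (Fin n) ℂ => p.2 :=
    PolyGrowth.id.comp_snd
  exact ((PolyGrowth.const A).matrix_mul
      (((((hD.matrix_mul h1).add (hG.matrix_mul h2)).matrix_mul (.const C)).matrix_mul
        h1.conjTranspose).add
        (((hG.matrix_mul h1).matrix_mul (.const C)).matrix_mul h2.conjTranspose))).trace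

/-- The bracketing exposes `V* Q V` and `Q V`, which are bounded uniformly in `V`, and leaves `V* A`
as the only unbounded factor. -/
theorem gramFormDeriv_eq (A : Matrix (Fin m) (Fin m) ℂ) (C : Matrix (Fin n) (Fin n) ℂ)
    (x y : Matrix (Fin m) (Fin n) ℂ) :
    gramFormDeriv S T A C (x, y) =
      (((C * (x.conjTranspose * A) * gramResolvent S T x) -
        T * (x.conjTranspose * gramResolvent S T x * x) *
          (C * (x.conjTranspose * A) * gramResolvent S T x)) * y).trace +
      ((A * (gramResolvent S T x * x) * C - (gramResolvent S T x * x) * C *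
        ((x.conjTranspose * A) * (gramResolvent S T x * x)) * T) * y.conjTranspose).trace := by
  have e0 := trace_mul_gramResolventDeriv_mul (S := S) (T := T) (x, y) A
    (x * C * x.conjTranspose)
  simp only [Matrix.mul_assoc] at e0
  have e1 : (A * (gramResolvent S T x * (y * (C * x.conjTranspose)))).trace =
      (C * (x.conjTranspose * (A * (gramResolvent S T x * y)))).trace := by
    have := Matrix.trace_mul_comm (A * gramResolvent S T x * y) (C * x.conjTranspose)
    simpa only [Matrix.mul_assoc] using this
  simp only [gramFormDeriv, Matrix.mul_add, Matrix.add_mul, Matrix.sub_mul, Matrix.trace_add,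
    Matrix.trace_sub, Matrix.mul_assoc, e0, e1]
  ring

/-- For fixed `V` the mean over directions is bounded by an affine function of `‖V* A‖_F²`, whose
expectation is `‖A‖_F²` because `σ n = 1`. -/
theorem integral_sq_norm_gramFormDeriv_le (hμ : IsCircularGaussian μ σ) (hσ : 0 ≤ σ)
    (hσn : σ * n = 1) (hS : S.PosDef) (hT : T.PosSemidef) (hq : 0 < q)
    (hSq : (S - ((q⁻¹ : ℝ) : ℂ) • 1).PosSemidef) (ht : 0 < t)
    (hTt : (T - (t : ℂ) • 1).PosSemidef) (hTS : ‖T‖ ≤ tS) (A : Matrix (Fin m) (Fin m) ℂ)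
    (C : Matrix (Fin n) (Fin n) ℂ) :
    ∫ p, ‖gramFormDeriv S T A C p‖ ^ 2 ∂(μ.prod μ) ≤
      2 * σ * ((1 + tS * t⁻¹) ^ 2 * q ^ 2 + 2 * (q * t⁻¹) + 2 * (q * t⁻¹) ^ 2 * tS ^ 2) *
        (‖C‖ * frobeniusNorm A) ^ 2 := by
  have := hμ.isGaussian
  have hD := (polyGrowth_gramFormDeriv hS hT hq hSq A C).norm_sq
  have htS : 0 ≤ tS := (norm_nonneg _).trans hTS
  have ht' : 0 < t⁻¹ := inv_pos.2 ht
  set b := q * t⁻¹ with hb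
  rw [integral_prod _ (hD.integrable _)]
  have inner : ∀ x : Matrix (Fin m) (Fin n) ℂ,
      ∫ y, ‖gramFormDeriv S T A C (x, y)‖ ^ 2 ∂μ ≤
        2 * σ * ‖C‖ ^ 2 * ((1 + tS * t⁻¹) ^ 2 * q ^ 2 + 2 * b ^ 2 * tS ^ 2) *
          frobeniusNorm (x.conjTranspose * A) ^ 2 +
        2 * σ * ‖C‖ ^ 2 * (2 * b) * frobeniusNorm A ^ 2 := fun x => by
    have hQ := norm_resolvent_le hS hT hq hSq x
    have hQV := sq_norm_resolvent_mul_le hS hT hq hSq ht hTt x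
    have hVQV := norm_conjTranspose_mul_resolvent_mul_le hS hT ht hTt x
    simp only [gramFormDeriv_eq]
    refine (integral_sq_norm_trace_add_le hμ _ _).trans ?_
    set G := gramResolvent S T x with hG
    set φ := frobeniusNorm (x.conjTranspose * A) with hφ
    have hφ0 : 0 ≤ φ := frobeniusNorm_nonneg _
    have hA0 := frobeniusNorm_nonneg A
    have hC0 := norm_nonneg C
    have sub_le : ∀ {k l : ℕ} (P P' : Matrix (Fin k) (Fin l) ℂ),
        frobeniusNorm (P - P') ^ 2 ≤ 2 * frobeniusNorm P ^ 2 + 2 * frobeniusNorm P' ^ 2 := by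
      intro k l P P'
      simp only [sq_frobeniusNorm, Finset.mul_sum, ← Finset.sum_add_distrib]
      refine Finset.sum_le_sum fun j _ => Finset.sum_le_sum fun i _ => ?_
      have h := norm_sub_le (P i j) (P' i j)
      have h0 := norm_nonneg (P i j - P' i j)
      rw [Matrix.sub_apply]
      nlinarith [sq_nonneg (‖P i j‖ - ‖P' i j‖)]
    have f1 : frobeniusNorm ((C * (x.conjTranspose * A) * G) -
        T * (x.conjTranspose * G * x) * (C * (x.conjTranspose * A) * G)) ^ 2 ≤
        ((1 + tS * t⁻¹) * (‖C‖ * φ * q)) ^ 2 := by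
      refine pow_le_pow_left₀ (frobeniusNorm_nonneg _) ?_ 2
      have e : (C * (x.conjTranspose * A) * G) -
          T * (x.conjTranspose * G * x) * (C * (x.conjTranspose * A) * G) =
          (1 - T * (x.conjTranspose * G * x)) * (C * (x.conjTranspose * A) * G) := by
        rw [Matrix.sub_mul, Matrix.one_mul]
      rw [e]
      refine (frobeniusNorm_mul_le_left _ _).trans ?_
      refine mul_le_mul ?_ ?_ (frobeniusNorm_nonneg _) (by positivity)
      · refine (norm_sub_le _ _).trans (add_le_add ?_ ?_)
        -- The case `T = 0`, `x = 0` yields `‖1‖ ≤ 1`.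
        · have := norm_inv_one_add_smul_le (Matrix.PosSemidef.zero (n := Fin n) (R := ℂ)) le_rfl
          simpa using this
        · exact (Matrix.l2_opNorm_mul _ _).trans (by gcongr)
      · refine (frobeniusNorm_mul_le_right _ _).trans ?_
        gcongr
        exact frobeniusNorm_mul_le_left _ _
    have f2 : frobeniusNorm (A * (G * x) * C) ^ 2 ≤ b * (frobeniusNorm A * ‖C‖) ^ 2 := by
      have : frobeniusNorm (A * (G * x) * C) ≤ frobeniusNorm A * ‖G * x‖ * ‖C‖ := by
        refine (frobeniusNorm_mul_le_right _ _).trans ?_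
        gcongr
        exact frobeniusNorm_mul_le_right _ _
      calc _ ≤ (frobeniusNorm A * ‖G * x‖ * ‖C‖) ^ 2 :=
            pow_le_pow_left₀ (frobeniusNorm_nonneg _) this 2
        _ = ‖G * x‖ ^ 2 * (frobeniusNorm A * ‖C‖) ^ 2 := by ring
        _ ≤ _ := by gcongr
    have f3 : frobeniusNorm ((G * x) * C * ((x.conjTranspose * A) * (G * x)) * T) ^ 2 ≤
        b ^ 2 * (‖C‖ * φ * tS) ^ 2 := by
      have : frobeniusNorm ((G * x) * C * ((x.conjTranspose * A) * (G * x)) * T) ≤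
          ‖G * x‖ * ‖C‖ * (φ * ‖G * x‖) * ‖T‖ := by
        refine (frobeniusNorm_mul_le_right _ _).trans ?_
        gcongr
        refine (frobeniusNorm_mul_le_left _ _).trans ?_
        refine mul_le_mul (Matrix.l2_opNorm_mul _ _) (frobeniusNorm_mul_le_right _ _)
          (frobeniusNorm_nonneg _) (by positivity)
      calc _ ≤ (‖G * x‖ * ‖C‖ * (φ * ‖G * x‖) * ‖T‖) ^ 2 :=
            pow_le_pow_left₀ (frobeniusNorm_nonneg _) this 2
        _ = (‖G * x‖ ^ 2) ^ 2 * (‖C‖ * φ * ‖T‖) ^ 2 := by ring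
        _ ≤ _ := by gcongr
    have f23 := sub_le (A * (G * x) * C) ((G * x) * C * ((x.conjTranspose * A) * (G * x)) * T)
    calc _ ≤ 2 * σ * (((1 + tS * t⁻¹) * (‖C‖ * φ * q)) ^ 2 +
          (2 * (b * (frobeniusNorm A * ‖C‖) ^ 2) + 2 * (b ^ 2 * (‖C‖ * φ * tS) ^ 2))) := by
            gcongr
            linarith
      _ = _ := by ring
  have iφ : Integrable (fun x : Matrix (Fin m) (Fin n) ℂ =>
      frobeniusNorm (x.conjTranspose * A) ^ 2) μ := by
    simp only [sq_frobeniusNorm]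
    refine integrable_finsetSum _ fun j _ => integrable_finsetSum _ fun i _ => ?_
    exact ((PolyGrowth.id.conjTranspose.matrix_mul (.const A)).entry i j).norm_sq.integrable μ
  calc _ ≤ ∫ x, (2 * σ * ‖C‖ ^ 2 * ((1 + tS * t⁻¹) ^ 2 * q ^ 2 + 2 * b ^ 2 * tS ^ 2) *
          frobeniusNorm (x.conjTranspose * A) ^ 2 +
        2 * σ * ‖C‖ ^ 2 * (2 * b) * frobeniusNorm A ^ 2) ∂μ :=
        integral_mono (hD.integrable _).integral_prod_left
          ((iφ.const_mul _).add (integrable_const _)) inner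
    _ = _ := by
        rw [integral_add (iφ.const_mul _) (integrable_const _), integral_const_mul,
          hμ.integral_sq_frobeniusNorm_conjTranspose_mul, hσn, integral_const]
        simp
        ring

/-- The constant of the covariance bound. -/
noncomputable def covConst (q t tS c : ℝ) : ℝ :=
  2 * (√(4 * c * (tS ^ 2 * (q * t⁻¹) * q ^ 2)) *
    √(2 * ((1 + tS * t⁻¹) ^ 2 * q ^ 2 + 2 * (q * t⁻¹) + 2 * (q * t⁻¹) ^ 2 * tS ^ 2)))

/-- The two mean squared derivatives are of order `σ m` and `σ`. As `σ m ≤ c`, a single factor `√σ`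
survives; the further `σ` in front of the covariance will complete the rate `N^{-3/2}`. -/
theorem norm_covariance_le (hμ : IsCircularGaussian μ σ) (hσ : 0 ≤ σ)
    (hσn : σ * n = 1) {c : ℝ} (hσm : σ * m ≤ c) (hS : S.PosDef) (hT : T.PosSemidef) (hq : 0 < q)
    (hSq : (S - ((q⁻¹ : ℝ) : ℂ) • 1).PosSemidef) (ht : 0 < t)
    (hTt : (T - (t : ℂ) • 1).PosSemidef) (hTS : ‖T‖ ≤ tS) (A : Matrix (Fin m) (Fin m) ℂ)
    (C : Matrix (Fin n) (Fin n) ℂ) :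
    ‖∫ V, ((gramResolvent S T V).trace - ∫ W, (gramResolvent S T W).trace ∂μ) *
      (A * (gramResolvent S T V * V * C * V.conjTranspose)).trace ∂μ‖ ≤
      covConst q t tS c * √σ * (‖C‖ * frobeniusNorm A) := by
  have := hμ.isGaussian
  have hG0 := polyGrowth_gramResolvent hS hT hq hSq
  have hg : PolyGrowth fun x => (A * (gramResolvent S T x * x * C * x.conjTranspose)).trace :=
    ((PolyGrowth.const A).matrix_mul (((hG0.matrix_mul .id).matrix_mul (.const C)).matrix_mul
      PolyGrowth.id.conjTranspose)).trace
  refine (norm_integral_sub_mul_le hμ.map_rotation hG0.trace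
    (polyGrowth_gramResolventDeriv hS hT hq hSq).trace hg
    (polyGrowth_gramFormDeriv hS hT hq hSq A C)
    (fun p θ => (hasDerivAt_gramResolvent_rotation hS hT p θ).matrix_trace) fun p θ => ?_).trans ?_
  · have h := ((hasDerivAt_const θ A).matrix_mul
      ((((hasDerivAt_gramResolvent_rotation hS hT p θ).matrix_mul
        (hasDerivAt_rotation_fst p θ)).matrix_mul (hasDerivAt_const θ C)).matrix_mul
        (hasDerivAt_rotation_fst p θ).matrix_conjTranspose)).matrix_trace
    simp only [Matrix.mul_zero, Matrix.zero_mul, zero_add, add_zero] at h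
    exact h
  · have b1 := integral_sq_norm_trace_gramResolventDeriv_le hμ hσ hS hT hq hSq ht hTt hTS
    have b2 := integral_sq_norm_gramFormDeriv_le hμ hσ hσn hS hT hq hSq ht hTt hTS A C
    have ht' : 0 < t⁻¹ := inv_pos.2 ht
    have hCA : 0 ≤ ‖C‖ * frobeniusNorm A := mul_nonneg (norm_nonneg _) (frobeniusNorm_nonneg _)
    have e : √(2 * σ * ((1 + tS * t⁻¹) ^ 2 * q ^ 2 + 2 * (q * t⁻¹) +
        2 * (q * t⁻¹) ^ 2 * tS ^ 2) * (‖C‖ * frobeniusNorm A) ^ 2) =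
        √(2 * ((1 + tS * t⁻¹) ^ 2 * q ^ 2 + 2 * (q * t⁻¹) + 2 * (q * t⁻¹) ^ 2 * tS ^ 2)) * √σ *
          (‖C‖ * frobeniusNorm A) := by
      rw [Real.sqrt_mul (by positivity), Real.sqrt_sq hCA, ← Real.sqrt_mul (by positivity)]
      congr 2
      ring
    calc _ ≤ 2 * (√(4 * c * (tS ^ 2 * (q * t⁻¹) * q ^ 2)) *
          √(2 * σ * ((1 + tS * t⁻¹) ^ 2 * q ^ 2 + 2 * (q * t⁻¹) +
            2 * (q * t⁻¹) ^ 2 * tS ^ 2) * (‖C‖ * frobeniusNorm A) ^ 2)) := by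
          gcongr
          refine b1.trans ?_
          gcongr
      _ = _ := by
          rw [e, covConst]
          ring

end ResolventMoments

/-! ### Quantitative stability of the scalar fixed point equation. -/

section Stability

/-- The map `x ↦ N⁻¹ tr[T (I + x T)⁻¹]` in terms of the eigenvalues `t` of `T`. -/
noncomputable def traceRatio {n : ℕ} (σ : ℝ) (t : Fin n → ℝ) (a x : ℝ) : ℝ :=
  σ * ∑ j, t j / (x * t j + a)

variable {m n : ℕ} {σ α rI rS tS c₁ c₂ : ℝ} {r : Fin m → ℝ} {t : Fin n → ℝ}

theorem traceRatio_nonneg (hσ : 0 ≤ σ) (ht : ∀ j, 0 ≤ t j) {a : ℝ} (ha : 0 < a) {x : ℝ}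
    (hx : 0 ≤ x) : 0 ≤ traceRatio σ t a x :=
  mul_nonneg hσ (Finset.sum_nonneg fun j _ => div_nonneg (ht j)
    (add_nonneg (mul_nonneg hx (ht j)) ha.le))

theorem traceRatio_le (hσ : 0 ≤ σ) (ht : ∀ j, 0 ≤ t j) (htS : ∀ j, t j ≤ tS) (hn : σ * n ≤ c₂)
    (htS0 : 0 ≤ tS) {a : ℝ} (ha : 0 < a) {x : ℝ} (hx : 0 ≤ x) :
    traceRatio σ t a x ≤ c₂ * (tS / a) := by
  have h : ∑ j, t j / (x * t j + a) ≤ ∑ _j : Fin n, tS / a := by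
    refine Finset.sum_le_sum fun j _ => ?_
    have := mul_nonneg hx (ht j)
    exact div_le_div₀ htS0 (htS j) ha (by linarith)
  simp only [Finset.sum_const, Finset.card_univ, Fintype.card_fin, nsmul_eq_mul] at h
  calc traceRatio σ t a x ≤ σ * (n * (tS / a)) := mul_le_mul_of_nonneg_left h hσ
    _ = σ * n * (tS / a) := by ring
    _ ≤ _ := mul_le_mul_of_nonneg_right hn (by positivity)

/-- Each summand `x t / (x t + 1)` increases, although `traceRatio` itself decreases. This
monotonicity takes the place of a contraction argument in the stability estimate. -/
theorem mul_traceRatio_mono (hσ : 0 ≤ σ) (ht : ∀ j, 0 ≤ t j) {x y : ℝ} (hx : 0 ≤ x)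
    (hxy : x ≤ y) : x * traceRatio σ t 1 x ≤ y * traceRatio σ t 1 y := by
  have e : ∀ z, z * traceRatio σ t 1 z = σ * ∑ j, z * t j / (z * t j + 1) := fun z => by
    simp only [traceRatio, Finset.mul_sum]
    exact Finset.sum_congr rfl fun j _ => by ring
  rw [e, e]
  refine mul_le_mul_of_nonneg_left (Finset.sum_le_sum fun j _ => ?_) hσ
  have h1 := mul_nonneg hx (ht j)
  have h2 := mul_le_mul_of_nonneg_right hxy (ht j)
  rw [div_le_div_iff₀ (by linarith) (by linarith)]
  nlinarith

theorem abs_traceRatio_sub_le (hσ : 0 ≤ σ) (hσn : σ * n ≤ 1) (ht : ∀ j, 0 ≤ t j)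
    (htS : ∀ j, t j ≤ tS) {x y : ℝ} (hx : 0 ≤ x) (hy : 0 ≤ y) :
    |traceRatio σ t 1 x - traceRatio σ t 1 y| ≤ tS ^ 2 * |x - y| := by
  have h : |∑ j, (t j / (x * t j + 1) - t j / (y * t j + 1))| ≤
      ∑ _j : Fin n, tS ^ 2 * |x - y| := by
    refine (Finset.abs_sum_le_sum_abs _ _).trans (Finset.sum_le_sum fun j _ => ?_)
    have h1 := mul_nonneg hx (ht j)
    have h2 := mul_nonneg hy (ht j)
    have e : t j / (x * t j + 1) - t j / (y * t j + 1) =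
        t j ^ 2 * (y - x) / ((x * t j + 1) * (y * t j + 1)) := by
      rw [div_sub_div _ _ (by positivity) (by positivity)]
      congr 1
      ring
    rw [e, abs_div, abs_mul, abs_of_nonneg (sq_nonneg (t j)), abs_sub_comm y x,
      abs_of_nonneg (by positivity : 0 ≤ (x * t j + 1) * (y * t j + 1))]
    refine (div_le_self (by positivity) (by nlinarith)).trans ?_
    gcongr
    exacts [ht j, htS j]
  rw [Finset.sum_sub_distrib, Finset.sum_const, Finset.card_univ, Fintype.card_fin,
    nsmul_eq_mul] at h
  rw [traceRatio, traceRatio, ← mul_sub, abs_mul, abs_of_nonneg hσ]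
  calc _ ≤ σ * (n * (tS ^ 2 * |x - y|)) := mul_le_mul_of_nonneg_left h hσ
    _ = (σ * n) * (tS ^ 2 * |x - y|) := by ring
    _ ≤ 1 * (tS ^ 2 * |x - y|) := mul_le_mul_of_nonneg_right hσn (by positivity)
    _ = _ := one_mul _

/-- A lower bound for the fixed point. -/
noncomputable def fixedPointLower (α rI rS tS c₁ : ℝ) : ℝ := c₁ * (rI / (tS * rS + α))

/-- The stability constant of the fixed point equation. -/
noncomputable def stabilityConst (α rI rS tS c₁ c₂ : ℝ) : ℝ :=
  c₂ * (rS / α) / (fixedPointLower α rI rS tS c₁ / 2) +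
  (c₁ * (rI * (fixedPointLower α rI rS tS c₁ / 2) * α /
    ((c₂ * (rS / α) * tS * rS + α * (c₂ * (rS / α))) *
      (c₂ * (rS / α) * tS * rS + α * (c₂ * (rS / α))))))⁻¹

/-- The inner trace is at most `tS`, so each summand of the outer one is at least `rI / (tS rS +
α)`. Being valid at every `x ≥ 0`, the bound applies to the fixed point and also shows that no small
`x` is nearly fixed. -/
theorem fixedPointLower_le (hα : 0 < α) (hrI : 0 < rI) (htS0 : 0 ≤ tS) (hσ : 0 ≤ σ)
    (hσm : c₁ ≤ σ * m) (hσn : σ * n ≤ 1)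
    (hr : ∀ i, rI ≤ r i) (hrS : ∀ i, r i ≤ rS) (hrIS : rI ≤ rS) (ht : ∀ j, 0 ≤ t j)
    (htS : ∀ j, t j ≤ tS) {x : ℝ} (hx : 0 ≤ x) :
    fixedPointLower α rI rS tS c₁ ≤ traceRatio σ r α (traceRatio σ t 1 x) := by
  have hd0 := traceRatio_nonneg hσ ht one_pos hx
  have hd := traceRatio_le hσ ht htS hσn htS0 one_pos hx
  rw [one_mul, div_one] at hd
  have hrS0 : 0 < rS := hrI.trans_le hrIS
  have h : ∑ _i : Fin m, rI / (tS * rS + α) ≤ ∑ i, r i / (traceRatio σ t 1 x * r i + α) := by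
    refine Finset.sum_le_sum fun i _ => ?_
    have h0 : 0 < r i := hrI.trans_le (hr i)
    refine div_le_div₀ h0.le (hr i) (by positivity) ?_
    have := hrS i
    gcongr
  simp only [Finset.sum_const, Finset.card_univ, Fintype.card_fin, nsmul_eq_mul] at h
  calc fixedPointLower α rI rS tS c₁ ≤ σ * m * (rI / (tS * rS + α)) :=
        mul_le_mul_of_nonneg_right hσm (by positivity)
    _ = σ * (m * (rI / (tS * rS + α))) := by ring
    _ ≤ _ := mul_le_mul_of_nonneg_left h hσ

/-- Write `f` for the composed map, `d` for the inner trace, and `f(x) = σ ∑ x r / (x d(x) r + α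
x)`. Let `h` be the same sum with `x d(x)` frozen at its value `D` for `δ`. Then `x - h = k (x - δ)`
exactly, with `k` bounded below. Since `x d(x)` is monotone, passing from `h` to `f` can only move
the value farther from `x`. Hence `|x - f| ≥ k |x - δ|`. -/
theorem abs_sub_fixedPoint_le (hα : 0 < α) (hrI : 0 < rI) (htS0 : 0 ≤ tS) (hc₁ : 0 < c₁)
    (hσ : 0 ≤ σ) (hσm : c₁ ≤ σ * m) (hσm' : σ * m ≤ c₂) (hσn : σ * n ≤ 1)
    (hr : ∀ i, rI ≤ r i) (hrS : ∀ i, r i ≤ rS) (hrIS : rI ≤ rS) (ht : ∀ j, 0 ≤ t j)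
    (htS : ∀ j, t j ≤ tS) {x δ : ℝ} (hx : 0 ≤ x) (hxB : x ≤ c₂ * (rS / α)) (hδ : 0 ≤ δ)
    (hfix : δ = traceRatio σ r α (traceRatio σ t 1 δ)) :
    |x - δ| ≤ stabilityConst α rI rS tS c₁ c₂ *
      |x - traceRatio σ r α (traceRatio σ t 1 x)| := by
  have hrS0 : 0 < rS := hrI.trans_le hrIS
  have hr0 : ∀ i, 0 < r i := fun i => hrI.trans_le (hr i)
  have hlow : ∀ {y : ℝ}, 0 ≤ y → fixedPointLower α rI rS tS c₁ ≤
      traceRatio σ r α (traceRatio σ t 1 y) := fun hy =>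
    fixedPointLower_le hα hrI htS0 hσ hσm hσn hr hrS hrIS ht htS hy
  have hd0 : ∀ {y : ℝ}, 0 ≤ y → 0 ≤ traceRatio σ t 1 y := traceRatio_nonneg hσ ht one_pos
  have hdle : ∀ {y : ℝ}, 0 ≤ y → traceRatio σ t 1 y ≤ tS := fun hy => by
    have := traceRatio_le hσ ht htS hσn htS0 one_pos hy
    rwa [one_mul, div_one] at this
  set x₀ := fixedPointLower α rI rS tS c₁ with hx₀
  have hx₀pos : 0 < x₀ := by rw [hx₀, fixedPointLower]; positivity
  set B := c₂ * (rS / α) with hB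
  have hδB : δ ≤ B := by
    rw [hfix]
    exact traceRatio_le hσ (fun i => (hr0 i).le) hrS hσm' hrS0.le hα (hd0 hδ)
  have hδlow : x₀ ≤ δ := by rw [hfix]; exact hlow hδ
  have hδpos := hx₀pos.trans_le hδlow
  have hBpos : 0 < B := hδpos.trans_le hδB
  set f := traceRatio σ r α (traceRatio σ t 1 x) with hf
  set W := B * tS * rS + α * B with hW
  have hWpos : 0 < W := by positivity
  set κ := c₁ * (rI * (x₀ / 2) * α / (W * W)) with hκ
  have hκpos : 0 < κ := by positivity
  have hK : stabilityConst α rI rS tS c₁ c₂ = B / (x₀ / 2) + κ⁻¹ := rfl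
  rw [hK]
  -- The lower bound on `k` needs `x` away from 0. For `x ≤ x₀/2` the residual is at least `x₀/2`,
  -- while `|x - δ| ≤ B`; this gives the first summand of the constant.
  rcases le_total x (x₀ / 2) with hsmall | hbig
  · have h1 : x₀ / 2 ≤ |x - f| := by
      rw [abs_sub_comm]
      have := hlow hx
      exact le_trans (by linarith) (le_abs_self _)
    have h2 : |x - δ| ≤ B := abs_sub_le_iff.2 ⟨by linarith, by linarith⟩
    calc |x - δ| ≤ B / (x₀ / 2) * (x₀ / 2) := by rw [div_mul_cancel₀ _ (by positivity)]; exact h2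
      _ ≤ (B / (x₀ / 2) + κ⁻¹) * |x - f| := by
        gcongr
        linarith [inv_pos.2 hκpos]
  · have hxpos : 0 < x := lt_of_lt_of_le (by positivity) hbig
    set D := δ * traceRatio σ t 1 δ with hD
    have hD0 : 0 ≤ D := mul_nonneg hδ (hd0 hδ)
    have hDB : D ≤ B * tS := mul_le_mul hδB (hdle hδ) (hd0 hδ) hBpos.le
    have hpos : ∀ {y : ℝ}, 0 < y → ∀ i, 0 < D * r i + α * y := fun hy i => by
      have := mul_nonneg hD0 (hr0 i).le
      have := mul_pos hα hy
      linarith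
    have hle : ∀ {y : ℝ}, y ≤ B → ∀ i, D * r i + α * y ≤ W := fun hy i => by
      have h1 := mul_le_mul hDB (hrS i) (hr0 i).le (by positivity)
      have h2 := mul_le_mul_of_nonneg_left hy hα.le
      linarith
    set h := σ * ∑ i, x * r i / (D * r i + α * x) with hh
    set k := σ * ∑ i, r i * x * α / ((D * r i + α * δ) * (D * r i + α * x)) with hk
    have hkκ : κ ≤ k := by
      have h1 : ∑ _i : Fin m, rI * (x₀ / 2) * α / (W * W) ≤
          ∑ i, r i * x * α / ((D * r i + α * δ) * (D * r i + α * x)) := by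
        refine Finset.sum_le_sum fun i _ => ?_
        have p1 := hpos hδpos i
        have p2 := hpos hxpos i
        have p3 := hle hδB i
        have p4 := hle hxB i
        have p5 := hr i
        have p6 := hr0 i
        refine div_le_div₀ (by positivity) ?_ (by positivity) ?_
        · gcongr
        · gcongr
      simp only [Finset.sum_const, Finset.card_univ, Fintype.card_fin, nsmul_eq_mul] at h1
      calc κ ≤ σ * m * (rI * (x₀ / 2) * α / (W * W)) :=
            mul_le_mul_of_nonneg_right hσm (by positivity)
        _ = σ * (m * (rI * (x₀ / 2) * α / (W * W))) := by ring
        _ ≤ k := mul_le_mul_of_nonneg_left h1 hσ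
    have hxh : x - h = k * (x - δ) := by
      -- The equation `δ = f(δ)` multiplied by `x/δ`, with `δ` moved into the denominators.
      have e1 : x = σ * ∑ i, x * r i / (D * r i + α * δ) := by
        have : x = x / δ * traceRatio σ r α (traceRatio σ t 1 δ) := by
          rw [← hfix, div_mul_cancel₀ _ hδpos.ne']
        conv_lhs => rw [this]
        rw [traceRatio, mul_left_comm, Finset.mul_sum]
        congr 1
        refine Finset.sum_congr rfl fun i _ => ?_
        rw [div_mul_div_comm]
        congr 1
        rw [hD]
        ring
      have e2 : k * (x - δ) = σ * ∑ i, (x * r i / (D * r i + α * δ) -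
          x * r i / (D * r i + α * x)) := by
        rw [hk, mul_assoc, Finset.sum_mul]
        congr 1
        refine Finset.sum_congr rfl fun i _ => ?_
        have p1 := (hpos hδpos i).ne'
        have p2 := (hpos hxpos i).ne'
        rw [div_sub_div _ _ p1 p2, div_mul_eq_mul_div]
        congr 1
        ring
      rw [e2, Finset.sum_sub_distrib, mul_sub, ← e1]
    have hfe : f = σ * ∑ i, x * r i / (x * traceRatio σ t 1 x * r i + α * x) := by
      rw [hf, traceRatio]
      congr 1
      refine Finset.sum_congr rfl fun i _ => ?_
      rw [← mul_div_mul_left _ _ hxpos.ne']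
      congr 1
      ring
    have hxd0 : 0 ≤ x * traceRatio σ t 1 x := mul_nonneg hx (hd0 hx)
    -- On either side of `δ`, the value `f` lies beyond `h` as seen from `x`: `f ≤ h ≤ x` if `δ ≤
    -- x`, and `x ≤ h ≤ f` if `x ≤ δ`.
    have main : κ * |x - δ| ≤ |x - f| := by
      rcases le_total δ x with hδx | hxδ
      · have hfh : f ≤ h := by
          rw [hfe, hh]
          refine mul_le_mul_of_nonneg_left (Finset.sum_le_sum fun i _ => ?_) hσ
          have := mul_le_mul_of_nonneg_right (mul_traceRatio_mono hσ ht hδ hδx) (hr0 i).le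
          exact div_le_div_of_nonneg_left (mul_nonneg hx (hr0 i).le) (hpos hxpos i) (by linarith)
        rw [abs_of_nonneg (sub_nonneg.2 hδx)]
        refine le_trans ?_ (le_abs_self _)
        have := mul_le_mul_of_nonneg_right hkκ (sub_nonneg.2 hδx)
        linarith
      · have hfh : h ≤ f := by
          rw [hfe, hh]
          refine mul_le_mul_of_nonneg_left (Finset.sum_le_sum fun i _ => ?_) hσ
          have h1 := mul_le_mul_of_nonneg_right (mul_traceRatio_mono hσ ht hx hxδ) (hr0 i).le
          have h2 := mul_nonneg hxd0 (hr0 i).le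
          have h3 := mul_pos hα hxpos
          exact div_le_div_of_nonneg_left (mul_nonneg hx (hr0 i).le) (by linarith) (by linarith)
        rw [abs_sub_comm, abs_of_nonneg (sub_nonneg.2 hxδ), abs_sub_comm]
        refine le_trans ?_ (le_abs_self _)
        have := mul_le_mul_of_nonneg_right hkκ (sub_nonneg.2 hxδ)
        linarith
    calc |x - δ| = κ⁻¹ * (κ * |x - δ|) := by rw [inv_mul_cancel_left₀ hκpos.ne']
      _ ≤ κ⁻¹ * |x - f| := by gcongr
      _ ≤ (B / (x₀ / 2) + κ⁻¹) * |x - f| := by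
        gcongr
        have : 0 ≤ B / (x₀ / 2) := by positivity
        linarith

end Stability

/-! ### Exact identities for the means, up to a covariance. -/

section DeterministicEquivalent

variable {m n : ℕ} {μ : Measure (Matrix (Fin m) (Fin n) ℂ)} {σ : ℝ}
  {S : Matrix (Fin m) (Fin m) ℂ} {T : Matrix (Fin n) (Fin n) ℂ} {q : ℝ}

theorem trace_mul_inv_one_add_smul (hT : T.PosSemidef) {x : ℝ} (hx : 0 ≤ x) :
    (T * (1 + (x : ℂ) • T)⁻¹).trace = ((∑ j, hT.isHermitian.eigenvalues j /
      (x * hT.isHermitian.eigenvalues j + 1) : ℝ) : ℂ) := by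
  have h := trace_mul_inv_affine hT.isHermitian 1 x fun j => by
    have := mul_nonneg hx (hT.eigenvalues_nonneg j)
    positivity
  rw [Complex.ofReal_one, one_smul, add_comm] at h
  exact h

/-- `E tr[A Q V C V*]` in terms of `E tr[A Q]`, up to a covariance. -/
theorem integral_trace_form_eq (hμ : IsCircularGaussian μ σ) (hS : S.PosDef)
    (hT : T.PosSemidef) (hq : 0 < q) (hSq : (S - ((q⁻¹ : ℝ) : ℂ) • 1).PosSemidef)
    {β : ℝ} (hβ : 0 ≤ β) (hβe : (β : ℂ) = σ * ∫ W, (gramResolvent S T W).trace ∂μ)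
    (A : Matrix (Fin m) (Fin m) ℂ) (C : Matrix (Fin n) (Fin n) ℂ) :
    ∫ V, (A * (gramResolvent S T V * V * C * V.conjTranspose)).trace ∂μ =
      σ * ((1 + (β : ℂ) • T)⁻¹ * C).trace * ∫ V, (A * gramResolvent S T V).trace ∂μ -
      σ * ∫ V, ((gramResolvent S T V).trace - ∫ W, (gramResolvent S T W).trace ∂μ) *
        (A * (gramResolvent S T V * V * (T * ((1 + (β : ℂ) • T)⁻¹ * C)) *
          V.conjTranspose)).trace ∂μ := by
  have := hμ.isGaussian
  have hG0 := polyGrowth_gramResolvent hS hT hq hSq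
  have i2 : ∀ B : Matrix (Fin n) (Fin n) ℂ, PolyGrowth fun x : Matrix (Fin m) (Fin n) ℂ =>
      (A * (gramResolvent S T x * x * B * x.conjTranspose)).trace := fun B =>
    ((PolyGrowth.const A).matrix_mul (((hG0.matrix_mul .id).matrix_mul (.const B)).matrix_mul
      PolyGrowth.id.conjTranspose)).trace
  have hu : IsUnit (1 + (β : ℂ) • T).det := (Matrix.isUnit_iff_isUnit_det _).1
    (Matrix.PosDef.one.add_posSemidef (hT.real_smul hβ)).isUnit
  -- With this `B` one has `C = B + β T B`, and the term `β T B` cancels the part of the integration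
  -- by parts in which `tr Q` is replaced by its mean.
  set B := (1 + (β : ℂ) • T)⁻¹ * C with hB
  have hBC : C = B + (β : ℂ) • (T * B) := by
    have : (1 + (β : ℂ) • T) * B = C := by
      rw [hB, ← Matrix.mul_assoc, Matrix.mul_nonsing_inv _ hu, Matrix.one_mul]
    rw [← this, Matrix.add_mul, Matrix.one_mul, Matrix.smul_mul]
  have h1 := integral_trace_resolvent_mul hμ hS hT hq hSq A B
  have h2 : ∫ V, (A * (gramResolvent S T V * V * C * V.conjTranspose)).trace ∂μ =
      ∫ V, (A * (gramResolvent S T V * V * B * V.conjTranspose)).trace ∂μ +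
      β * ∫ V, (A * (gramResolvent S T V * V * (T * B) * V.conjTranspose)).trace ∂μ := by
    rw [← integral_const_mul, ← integral_add ((i2 B).integrable μ)
      (((i2 (T * B)).integrable μ).const_mul _)]
    refine integral_congr_ae (ae_of_all _ fun V => ?_)
    simp only [hBC, Matrix.mul_add, Matrix.add_mul, Matrix.mul_smul, Matrix.smul_mul,
      Matrix.trace_add, Matrix.trace_smul, smul_eq_mul]
  have h3 : ∫ V, ((gramResolvent S T V).trace - ∫ W, (gramResolvent S T W).trace ∂μ) *
        (A * (gramResolvent S T V * V * (T * B) * V.conjTranspose)).trace ∂μ =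
      ∫ V, (gramResolvent S T V).trace *
        (A * (gramResolvent S T V * V * (T * B) * V.conjTranspose)).trace ∂μ -
      (∫ W, (gramResolvent S T W).trace ∂μ) *
        ∫ V, (A * (gramResolvent S T V * V * (T * B) * V.conjTranspose)).trace ∂μ := by
    simp only [sub_mul]
    rw [integral_sub ((hG0.trace.mul (i2 (T * B))).integrable μ)
      (((i2 (T * B)).integrable μ).const_mul _), integral_const_mul]
  rw [h2, h1, h3, hβe]
  ring

/-- `E tr[Θ Q]` in terms of its deterministic equivalent, up to a covariance. -/
theorem integral_trace_resolvent_eq (hμ : IsCircularGaussian μ σ) (hS : S.PosDef)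
    (hT : T.PosSemidef) (hq : 0 < q) (hSq : (S - ((q⁻¹ : ℝ) : ℂ) • 1).PosSemidef)
    {β βt : ℝ} (hβ : 0 ≤ β) (hβe : (β : ℂ) = σ * ∫ W, (gramResolvent S T W).trace ∂μ)
    (hβt : 0 ≤ βt) (hβte : (βt : ℂ) = σ * (T * (1 + (β : ℂ) • T)⁻¹).trace)
    (Θ : Matrix (Fin m) (Fin m) ℂ) :
    ∫ V, (Θ * gramResolvent S T V).trace ∂μ =
      (Θ * ((βt : ℂ) • 1 + S)⁻¹).trace +
      σ * ∫ V, ((gramResolvent S T V).trace - ∫ W, (gramResolvent S T W).trace ∂μ) *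
        ((((βt : ℂ) • 1 + S)⁻¹ * Θ) * (gramResolvent S T V * V *
          (T * ((1 + (β : ℂ) • T)⁻¹ * T)) * V.conjTranspose)).trace ∂μ := by
  have := hμ.isGaussian
  have hG0 := polyGrowth_gramResolvent hS hT hq hSq
  have hu : IsUnit ((βt : ℂ) • 1 + S).det := (Matrix.isUnit_iff_isUnit_det _).1
    (hS.posSemidef_add (Matrix.PosSemidef.one.real_smul hβt)).isUnit
  -- Chosen so that `Θ = β̃ A + S A`: the form identity with `C = T` produces `β̃ E tr[A Q]`, and
  -- the resolvent identity below produces `E tr[S A Q]`.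
  set A := ((βt : ℂ) • 1 + S)⁻¹ * Θ with hA
  have hΘ : Θ = (βt : ℂ) • A + S * A := by
    have : ((βt : ℂ) • 1 + S) * A = Θ := by
      rw [hA, ← Matrix.mul_assoc, Matrix.mul_nonsing_inv _ hu, Matrix.one_mul]
    rw [← this, Matrix.add_mul, Matrix.smul_mul, Matrix.one_mul]
  clear_value A
  have i1 : ∀ B : Matrix (Fin m) (Fin m) ℂ, PolyGrowth fun x : Matrix (Fin m) (Fin n) ℂ =>
      (B * gramResolvent S T x).trace := fun B => ((PolyGrowth.const B).matrix_mul hG0).trace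
  have h1 := integral_trace_form_eq hμ hS hT hq hSq hβ hβe A T
  rw [Matrix.trace_mul_comm _ T, ← hβte] at h1
  have h2 : ∫ V, (A * (gramResolvent S T V * V * T * V.conjTranspose)).trace ∂μ =
      A.trace - ∫ V, (S * A * gramResolvent S T V).trace ∂μ := by
    have e : ∀ V, (A * (gramResolvent S T V * V * T * V.conjTranspose)).trace =
        A.trace - (S * A * gramResolvent S T V).trace := fun V => by
      have hid : gramResolvent S T V * (V * T * V.conjTranspose + S) = 1 :=
        Matrix.nonsing_inv_mul _ (isUnit_det_resolvent_inv hS hT V)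
      -- The resolvent identity `Q V T V* = I - Q S`.
      have : gramResolvent S T V * V * T * V.conjTranspose = 1 - gramResolvent S T V * S := by
        rw [eq_sub_iff_add_eq, ← hid, Matrix.mul_add]
        simp only [Matrix.mul_assoc]
      rw [this, Matrix.mul_sub, Matrix.mul_one, Matrix.trace_sub, ← Matrix.mul_assoc,
        Matrix.trace_mul_comm _ S, Matrix.mul_assoc S A]
    simp only [e]
    rw [integral_sub (integrable_const _) ((i1 (S * A)).integrable μ)]
    simp
  have h3 : ∫ V, (Θ * gramResolvent S T V).trace ∂μ =
      βt * ∫ V, (A * gramResolvent S T V).trace ∂μ +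
        ∫ V, (S * A * gramResolvent S T V).trace ∂μ := by
    rw [← integral_const_mul, ← integral_add (((i1 A).integrable μ).const_mul _)
      ((i1 (S * A)).integrable μ)]
    refine integral_congr_ae (ae_of_all _ fun V => ?_)
    simp only
    rw [hΘ, Matrix.add_mul, Matrix.trace_add, Matrix.smul_mul, Matrix.trace_smul, smul_eq_mul]
  rw [h3, Matrix.trace_mul_comm Θ, ← hA]
  linear_combination h2 - h1

end DeterministicEquivalent

/-! ### From the exact identities to the error bounds in fixed dimension. -/

section Approximation

variable {m n : ℕ} {μ : Measure (Matrix (Fin m) (Fin n) ℂ)} {σ : ℝ}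
  {S : Matrix (Fin m) (Fin m) ℂ} {T : Matrix (Fin n) (Fin n) ℂ} {q : ℝ}

/-- The trace of a positive definite matrix is real and nonnegative, so `σ E tr Q` is a real number
to which the scalar stability estimate applies; the upper bound places it in the required range. -/
theorem exists_mean_trace_resolvent (hμ : IsCircularGaussian μ σ) (hσ : 0 ≤ σ) (hS : S.PosDef)
    (hT : T.PosSemidef) (hq : 0 < q) (hSq : (S - ((q⁻¹ : ℝ) : ℂ) • 1).PosSemidef) :
    ∃ β : ℝ, 0 ≤ β ∧ β ≤ σ * m * q ∧ (β : ℂ) = σ * ∫ W, (gramResolvent S T W).trace ∂μ := by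
  have := hμ.isGaussian
  have hG := (polyGrowth_gramResolvent hS hT hq hSq).trace
  have h0 : ∀ V, 0 ≤ (gramResolvent S T V).trace := fun V =>
    (resolvent_posDef hS hT V).posSemidef.trace_nonneg
  have hle : ∀ V, (gramResolvent S T V).trace.re ≤ m * q := fun V =>
    (Complex.re_le_norm _).trans ((norm_trace_le _).trans
      (mul_le_mul_of_nonneg_left (norm_resolvent_le hS hT hq hSq V) (Nat.cast_nonneg _)))
  refine ⟨σ * ∫ V, (gramResolvent S T V).trace.re ∂μ,
    mul_nonneg hσ (integral_nonneg fun V => (Complex.le_def.1 (h0 V)).1), ?_, ?_⟩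
  · have h1 : ∫ V, (gramResolvent S T V).trace.re ∂μ ≤ ∫ _, (m * q : ℝ) ∂μ :=
      integral_mono (hG.integrable μ).re (integrable_const _) hle
    rw [mul_assoc]
    refine mul_le_mul_of_nonneg_left ?_ hσ
    simpa using h1
  · rw [Complex.ofReal_mul, ← integral_complex_ofReal]
    congr 2
    funext V
    exact Complex.ext (by simp) (by simpa using (Complex.le_def.1 (h0 V)).2)

theorem norm_inv_smul_one_add_le (hS : S.PosDef) (hq : 0 < q)
    (hSq : (S - ((q⁻¹ : ℝ) : ℂ) • 1).PosSemidef) {x : ℝ} (hx : 0 ≤ x) :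
    ‖((x : ℂ) • 1 + S)⁻¹‖ ≤ q := by
  have hx1 : ((x : ℂ) • (1 : Matrix (Fin m) (Fin m) ℂ)).PosSemidef :=
    Matrix.PosSemidef.one.real_smul hx
  have h := (hS.posSemidef_add hx1).norm_inv_le (inv_pos.2 hq) (by
    rw [add_sub_assoc]
    exact hx1.add hSq)
  rwa [inv_inv] at h

theorem inv_sub_inv_eq {k : ℕ} {A B : Matrix (Fin k) (Fin k) ℂ} (hA : IsUnit A.det)
    (hB : IsUnit B.det) : A⁻¹ - B⁻¹ = A⁻¹ * (B - A) * B⁻¹ := by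
  rw [Matrix.mul_sub, Matrix.sub_mul, Matrix.nonsing_inv_mul _ hA, Matrix.mul_assoc,
    Matrix.mul_nonsing_inv _ hB, Matrix.mul_one, Matrix.one_mul]

theorem norm_inv_one_add_smul_sub_le (hT : T.PosSemidef) {x y : ℝ} (hx : 0 ≤ x) (hy : 0 ≤ y) :
    ‖(1 + (x : ℂ) • T)⁻¹ - (1 + (y : ℂ) • T)⁻¹‖ ≤ |x - y| * ‖T‖ := by
  have hu : ∀ {z : ℝ}, 0 ≤ z → IsUnit (1 + (z : ℂ) • T).det := fun hz =>
    (Matrix.isUnit_iff_isUnit_det _).1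
      (Matrix.PosDef.one.add_posSemidef (hT.real_smul hz)).isUnit
  have e : (1 + (y : ℂ) • T) - (1 + (x : ℂ) • T) = ((y - x : ℝ) : ℂ) • T := by
    rw [Complex.ofReal_sub, sub_smul]
    abel
  rw [inv_sub_inv_eq (hu hx) (hu hy), e]
  calc _ ≤ ‖(1 + (x : ℂ) • T)⁻¹‖ * ‖((y - x : ℝ) : ℂ) • T‖ * ‖(1 + (y : ℂ) • T)⁻¹‖ :=
        (Matrix.l2_opNorm_mul _ _).trans
          (mul_le_mul_of_nonneg_right (Matrix.l2_opNorm_mul _ _) (norm_nonneg _))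
    _ ≤ 1 * ‖((y - x : ℝ) : ℂ) • T‖ * 1 := by
        gcongr
        exacts [norm_inv_one_add_smul_le hT hx, norm_inv_one_add_smul_le hT hy]
    _ = _ := by
        rw [one_mul, mul_one, norm_smul, Complex.norm_real, Real.norm_eq_abs, abs_sub_comm]

/-- Resolvent identity and Cauchy–Schwarz. The factor `√m` is affordable because it will multiply a
difference of order `N⁻²`. -/
theorem norm_trace_mul_inv_sub_le (hS : S.PosDef) (hq : 0 < q)
    (hSq : (S - ((q⁻¹ : ℝ) : ℂ) • 1).PosSemidef) (Θ : Matrix (Fin m) (Fin m) ℂ) {x y : ℝ}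
    (hx : 0 ≤ x) (hy : 0 ≤ y) :
    ‖(Θ * ((x : ℂ) • 1 + S)⁻¹).trace - (Θ * ((y : ℂ) • 1 + S)⁻¹).trace‖ ≤
      |x - y| * (q ^ 2 * √m) * frobeniusNorm Θ := by
  have hu : ∀ {z : ℝ}, 0 ≤ z → IsUnit ((z : ℂ) • 1 + S).det := fun hz =>
    (Matrix.isUnit_iff_isUnit_det _).1
      (hS.posSemidef_add (Matrix.PosSemidef.one.real_smul hz)).isUnit
  have e : ((y : ℂ) • 1 + S) - ((x : ℂ) • 1 + S) = ((y - x : ℝ) : ℂ) • 1 := by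
    rw [Complex.ofReal_sub, sub_smul]
    abel
  rw [← Matrix.trace_sub, ← Matrix.mul_sub, inv_sub_inv_eq (hu hx) (hu hy), e]
  refine (norm_trace_mul_le _ _).trans ?_
  rw [mul_comm]
  refine mul_le_mul_of_nonneg_right ?_ (frobeniusNorm_nonneg _)
  refine (frobeniusNorm_le _).trans ?_
  rw [← mul_assoc]
  refine mul_le_mul_of_nonneg_right ?_ (Real.sqrt_nonneg _)
  rw [Matrix.mul_smul, Matrix.mul_one, Matrix.smul_mul, norm_smul, Complex.norm_real,
    Real.norm_eq_abs, abs_sub_comm, sq]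
  refine mul_le_mul_of_nonneg_left ((Matrix.l2_opNorm_mul _ _).trans ?_) (abs_nonneg _)
  exact mul_le_mul (norm_inv_smul_one_add_le hS hq hSq hx) (norm_inv_smul_one_add_le hS hq hSq hy)
    (norm_nonneg _) hq.le

variable {α rI rS tI tS c₁ c₂ ζ : ℝ} {R : Matrix (Fin m) (Fin m) ℂ}

theorem posDef_smul_inv (hα : 0 < α) (hR : R.PosDef) : ((α : ℂ) • R⁻¹).PosDef :=
  hR.inv.smul (by exact_mod_cast hα)

theorem smul_inv_sub_posSemidef (hα : 0 < α) (hR : R.PosDef) (hRS : ‖R‖ ≤ rS)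
    (hR0 : 0 < ‖R‖) : ((α : ℂ) • R⁻¹ - (((rS / α)⁻¹ : ℝ) : ℂ) • 1).PosSemidef := by
  have hdet : IsUnit R.det := (Matrix.isUnit_iff_isUnit_det _).1 hR.isUnit
  have h := hR.inv.sub_smul_one_posSemidef (a := rS⁻¹) (by
    rw [Matrix.nonsing_inv_nonsing_inv _ hdet]
    exact inv_anti₀ hR0 hRS)
  have h2 := h.real_smul hα.le
  rw [smul_sub, smul_smul, ← Complex.ofReal_mul] at h2
  rwa [inv_div, div_eq_mul_inv]

/-- Brings `E` to the form `(x + S)⁻¹` in which the integration by parts delivers it. -/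
theorem mul_inv_affine_eq (hα : 0 < α) (hR : R.PosDef) {x : ℝ} (hx : 0 ≤ x) :
    R * ((x : ℂ) • R + (α : ℂ) • 1)⁻¹ = ((x : ℂ) • 1 + (α : ℂ) • R⁻¹)⁻¹ := by
  have hdet : IsUnit R.det := (Matrix.isUnit_iff_isUnit_det _).1 hR.isUnit
  have hα1 : ((α : ℂ) • (1 : Matrix (Fin m) (Fin m) ℂ)).PosDef :=
    Matrix.PosDef.one.smul (by exact_mod_cast hα)
  have hu : IsUnit ((x : ℂ) • R + (α : ℂ) • 1).det := (Matrix.isUnit_iff_isUnit_det _).1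
    (hα1.posSemidef_add (hR.posSemidef.real_smul hx)).isUnit
  refine (Matrix.inv_eq_right_inv ?_).symm
  rw [← Matrix.mul_assoc, Matrix.add_mul, Matrix.smul_mul, Matrix.smul_mul, Matrix.one_mul,
    Matrix.nonsing_inv_mul _ hdet, Matrix.mul_nonsing_inv _ hu]

/-- The constant in the approximation of `|E N⁻¹ tr[Q] - δ|`. -/
noncomputable def meanConst (α rI rS tI tS c₁ c₂ : ℝ) : ℝ :=
  stabilityConst α rI rS tS c₁ c₂ * (covConst (rS / α) tI tS c₂ * tS ^ 2 * (rS / α))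

/-- The constant in the approximation of `E tr[Θ Q]`. -/
noncomputable def phiConst (α rI rS tI tS c₁ c₂ : ℝ) : ℝ :=
  covConst (rS / α) tI tS c₂ * tS ^ 2 * (rS / α) +
    tS ^ 2 * (rS / α) ^ 2 * (meanConst α rI rS tI tS c₁ c₂ * c₂)

/-- The constant in the approximation of `E tr[Θ Q V Z V*]`. -/
noncomputable def psiConst (α rI rS tI tS c₁ c₂ ζ : ℝ) : ℝ :=
  covConst (rS / α) tI tS c₂ * tS * ζ +
    meanConst α rI rS tI tS c₁ c₂ * c₂ * tS * ζ * (rS / α) +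
    ζ * phiConst α rI rS tI tS c₁ c₂

/-- The two approximations, for fixed dimensions. -/
theorem deterministic_equivalents (hα : 0 < α) (hrI : 0 < rI) (htI : 0 < tI) (hc₁ : 0 < c₁)
    (hm : 0 < m) (hn : 0 < n) (hc₁σ : c₁ ≤ 1 / n * m) (hc₂σ : 1 / n * m ≤ c₂)
    (hμ : IsCircularGaussian μ (1 / n)) (hR : R.PosDef) (hRS : ‖R‖ ≤ rS) (hRI : rI ≤ ‖R⁻¹‖⁻¹)
    (hT : T.PosDef) (hTS : ‖T‖ ≤ tS) (hTI : tI ≤ ‖T⁻¹‖⁻¹) {p : ℝ × ℝ}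
    (hp : IsPositiveSolution α R T p) (Θ : Matrix (Fin m) (Fin m) ℂ) :
    ‖∫ V, (Θ * gramResolvent ((α : ℂ) • R⁻¹) T V).trace ∂μ -
        (Θ * (R * ((p.1 : ℂ) • R + (α : ℂ) • 1)⁻¹)).trace‖ ≤
      phiConst α rI rS tI tS c₁ c₂ * (1 / n * √(1 / n)) * frobeniusNorm Θ ∧
    ∀ Z : Matrix (Fin n) (Fin n) ℂ, ‖Z‖ ≤ ζ →
      ‖∫ V, (Θ * (gramResolvent ((α : ℂ) • R⁻¹) T V * V * Z * V.conjTranspose)).trace ∂μ -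
        1 / (n : ℂ) * (Z * (1 + (p.2 : ℂ) • T)⁻¹).trace *
          (Θ * (R * ((p.1 : ℂ) • R + (α : ℂ) • 1)⁻¹)).trace‖ ≤
      psiConst α rI rS tI tS c₁ c₂ ζ * (1 / n * √(1 / n)) * frobeniusNorm Θ := by
  have := hμ.isGaussian
  obtain ⟨hp1, hp2, hpe1, hpe2⟩ := hp
  have hn' : (0 : ℝ) < n := by exact_mod_cast hn
  have hm' : (0 : ℝ) < m := by exact_mod_cast hm
  set σ : ℝ := 1 / n with hσdef
  have hσ : 0 < σ := by positivity
  have hσn : σ * n = 1 := by rw [hσdef]; field_simp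
  have hσc : (1 : ℂ) / (n : ℂ) = (σ : ℂ) := by rw [hσdef]; push_cast; rfl
  rw [hσc] at hpe1 hpe2 ⊢
  -- spectra
  have hrle : ∀ i, rI ≤ hR.isHermitian.eigenvalues i := fun i =>
    hRI.trans (hR.inv_norm_inv_le_eigenvalues i)
  have hrge : ∀ i, hR.isHermitian.eigenvalues i ≤ rS := fun i =>
    (hR.isHermitian.eigenvalues_le_norm i).trans hRS
  have hrIS : rI ≤ rS := (hrle ⟨0, hm⟩).trans (hrge ⟨0, hm⟩)
  have hrS : 0 < rS := hrI.trans_le hrIS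
  have hR0 : 0 < ‖R‖ := hrI.trans_le ((hrle ⟨0, hm⟩).trans (hR.isHermitian.eigenvalues_le_norm _))
  have htge : ∀ j, hT.posSemidef.isHermitian.eigenvalues j ≤ tS := fun j =>
    (hT.isHermitian.eigenvalues_le_norm j).trans hTS
  have ht0 : ∀ j, 0 ≤ hT.posSemidef.isHermitian.eigenvalues j := fun j => (hT.eigenvalues_pos j).le
  have htS : 0 ≤ tS := (norm_nonneg _).trans hTS
  have hTt := hT.sub_smul_one_posSemidef hTI
  have hc₂ : 0 < c₂ := hc₁.trans_le (hc₁σ.trans hc₂σ)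
  set q := rS / α with hqdef
  have hq : 0 < q := by positivity
  have hS : ((α : ℂ) • R⁻¹).PosDef := posDef_smul_inv hα hR
  have hSq : ((α : ℂ) • R⁻¹ - ((q⁻¹ : ℝ) : ℂ) • 1).PosSemidef :=
    smul_inv_sub_posSemidef hα hR hRS hR0
  set S := (α : ℂ) • R⁻¹ with hSdef
  set ρ := hR.isHermitian.eigenvalues with hρ
  set τ := hT.posSemidef.isHermitian.eigenvalues with hτ
  -- the scalar quantities
  obtain ⟨β, hβ0, hβB, hβe⟩ := exists_mean_trace_resolvent hμ hσ.le hS hT.posSemidef hq hSq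
  have htr : ∀ {x : ℝ}, 0 ≤ x → (σ : ℂ) * (T * (1 + (x : ℂ) • T)⁻¹).trace =
      (traceRatio σ τ 1 x : ℝ) := fun hx => by
    rw [trace_mul_inv_one_add_smul hT.posSemidef hx, ← Complex.ofReal_mul]
    rfl
  have hrr : ∀ {x : ℝ}, 0 ≤ x → (σ : ℂ) * ((x : ℂ) • 1 + S)⁻¹.trace =
      (traceRatio σ ρ α x : ℝ) := fun {x} hx => by
    rw [hSdef, ← mul_inv_affine_eq hα hR hx, trace_mul_inv_affine hR.isHermitian α x fun i => by
      have := mul_nonneg hx (hR.eigenvalues_pos i).le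
      positivity, ← Complex.ofReal_mul]
    rfl
  have hδt : p.1 = traceRatio σ τ 1 p.2 := by
    rw [← Complex.ofReal_inj, hpe1, htr hp2.le]
  have hδ : p.2 = traceRatio σ ρ α (traceRatio σ τ 1 p.2) := by
    rw [← hδt, ← Complex.ofReal_inj, hpe2, mul_inv_affine_eq hα hR hp1.le, hrr hp1.le]
  set βt := traceRatio σ τ 1 β with hβt
  have hβt0 : 0 ≤ βt := traceRatio_nonneg hσ.le ht0 one_pos hβ0
  rw [mul_inv_affine_eq hα hR hp1.le, ← hSdef]
  -- covariance bound
  set K₁ := covConst q tI tS c₂ with hK₁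
  have hK₁0 : 0 ≤ K₁ := by rw [hK₁, covConst]; positivity
  have hcov : ∀ (A : Matrix (Fin m) (Fin m) ℂ) (C : Matrix (Fin n) (Fin n) ℂ) (a c : ℝ),
      frobeniusNorm A ≤ a → ‖C‖ ≤ c → ‖(σ : ℂ) * ∫ V, ((gramResolvent S T V).trace -
        ∫ W, (gramResolvent S T W).trace ∂μ) *
        (A * (gramResolvent S T V * V * C * V.conjTranspose)).trace ∂μ‖ ≤
        K₁ * (σ * √σ) * (c * a) := fun A C a c ha hc => by
    have h := norm_covariance_le hμ hσ.le hσn hc₂σ hS hT.posSemidef hq hSq htI hTt hTS A C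
    rw [norm_mul, Complex.norm_real, Real.norm_of_nonneg hσ.le]
    calc _ ≤ σ * (K₁ * √σ * (‖C‖ * frobeniusNorm A)) := mul_le_mul_of_nonneg_left h hσ.le
      _ = K₁ * (σ * √σ) * (‖C‖ * frobeniusNorm A) := by ring
      _ ≤ _ := by
        have := (norm_nonneg C).trans hc
        have := frobeniusNorm_nonneg A
        gcongr
  have hinvβ := norm_inv_one_add_smul_le hT.posSemidef hβ0
  have hinvδ := norm_inv_one_add_smul_le hT.posSemidef hp2.le
  have hE' := norm_inv_smul_one_add_le hS hq hSq hβt0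
  -- Needed for two choices of `A`: the identity, which locates `β`, and `Θ` itself.
  have hphi' : ∀ A : Matrix (Fin m) (Fin m) ℂ, ‖∫ V, (A * gramResolvent S T V).trace ∂μ -
      (A * ((βt : ℂ) • 1 + S)⁻¹).trace‖ ≤ K₁ * tS ^ 2 * q * (σ * √σ) * frobeniusNorm A :=
      fun A => by
    rw [integral_trace_resolvent_eq hμ hS hT.posSemidef hq hSq hβ0 hβe hβt0 (htr hβ0).symm,
      add_sub_cancel_left]
    refine (hcov _ _ (q * frobeniusNorm A) (tS ^ 2) ?_ ?_).trans (le_of_eq (by ring))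
    · exact (frobeniusNorm_mul_le_left _ _).trans
        (mul_le_mul_of_nonneg_right hE' (frobeniusNorm_nonneg _))
    · calc _ ≤ ‖T‖ * (‖(1 + (β : ℂ) • T)⁻¹‖ * ‖T‖) := (Matrix.l2_opNorm_mul _ _).trans
            (mul_le_mul_of_nonneg_left (Matrix.l2_opNorm_mul _ _) (norm_nonneg _))
        _ ≤ tS * (1 * tS) := by gcongr
        _ = _ := by ring
  -- comparison of `β` and `δ`
  set D := meanConst α rI rS tI tS c₁ c₂ with hD
  have hK0 : 0 ≤ stabilityConst α rI rS tS c₁ c₂ := by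
    rw [stabilityConst, fixedPointLower]
    positivity
  have hD0 : 0 ≤ D := by rw [hD, meanConst]; positivity
  have hsm : √(m : ℝ) * √(m : ℝ) = m := Real.mul_self_sqrt hm'.le
  -- With `A = I` the Frobenius norm is `√m`, so the residual of `β` is `O(σ · σ^{3/2} √m)`.
  -- Multiplied by another `√m` it remains `O(σ^{3/2})`, since `σ m ≤ c₂`.
  have hβδ : |β - p.2| * √m ≤ D * c₂ * (σ * √σ) := by
    have h1 : |β - traceRatio σ ρ α βt| ≤ σ * (K₁ * tS ^ 2 * q * (σ * √σ) * √m) := by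
      have h := hphi' 1
      rw [frobeniusNorm_one] at h
      simp only [Matrix.one_mul] at h
      have e : ((β - traceRatio σ ρ α βt : ℝ) : ℂ) = σ * (∫ V, (gramResolvent S T V).trace ∂μ -
          ((βt : ℂ) • 1 + S)⁻¹.trace) := by
        rw [Complex.ofReal_sub, hβe, ← hrr hβt0, mul_sub]
      rw [← Real.norm_eq_abs, ← Complex.norm_real, e, norm_mul, Complex.norm_real,
        Real.norm_of_nonneg hσ.le]
      exact mul_le_mul_of_nonneg_left h hσ.le
    have h2 := abs_sub_fixedPoint_le hα hrI htS hc₁ hσ.le hc₁σ hc₂σ hσn.le hrle hrge hrIS ht0 htge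
      hβ0 (hβB.trans (mul_le_mul_of_nonneg_right hc₂σ hq.le)) hp2.le hδ
    calc |β - p.2| * √m ≤ (stabilityConst α rI rS tS c₁ c₂ *
          (σ * (K₁ * tS ^ 2 * q * (σ * √σ) * √m))) * √m := by
          refine mul_le_mul_of_nonneg_right (h2.trans ?_) (Real.sqrt_nonneg _)
          exact mul_le_mul_of_nonneg_left h1 hK0
      _ = stabilityConst α rI rS tS c₁ c₂ * (K₁ * tS ^ 2 * q) * (σ * (√m * √m)) * (σ * √σ) := by
          ring
      _ = D * (σ * m) * (σ * √σ) := by rw [hsm]; rfl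
      _ ≤ _ := by gcongr
  have hβδ' : |βt - p.1| * √m ≤ tS ^ 2 * (D * c₂ * (σ * √σ)) := by
    rw [hδt]
    calc _ ≤ tS ^ 2 * |β - p.2| * √m := mul_le_mul_of_nonneg_right
          (abs_traceRatio_sub_le hσ.le hσn.le ht0 htge hβ0 hp2.le) (Real.sqrt_nonneg _)
      _ = tS ^ 2 * (|β - p.2| * √m) := by ring
      _ ≤ _ := by gcongr
  have hF0 := frobeniusNorm_nonneg Θ
  have hphi : ‖∫ V, (Θ * gramResolvent S T V).trace ∂μ -
      (Θ * ((p.1 : ℂ) • 1 + S)⁻¹).trace‖ ≤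
      phiConst α rI rS tI tS c₁ c₂ * (σ * √σ) * frobeniusNorm Θ := by
    have h1 := hphi' Θ
    have h2 := norm_trace_mul_inv_sub_le hS hq hSq Θ hβt0 hp1.le
    have h3 : |βt - p.1| * (q ^ 2 * √m) * frobeniusNorm Θ ≤
        tS ^ 2 * q ^ 2 * (D * c₂) * (σ * √σ) * frobeniusNorm Θ := by
      refine mul_le_mul_of_nonneg_right ?_ hF0
      calc _ = q ^ 2 * (|βt - p.1| * √m) := by ring
        _ ≤ q ^ 2 * (tS ^ 2 * (D * c₂ * (σ * √σ))) := by gcongr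
        _ = _ := by ring
    refine (norm_sub_le_norm_sub_add_norm_sub _ _ _).trans
      ((add_le_add h1 (h2.trans h3)).trans (le_of_eq ?_))
    rw [phiConst]
    ring
  refine ⟨hphi, fun Z hZ => ?_⟩
  have hζ : 0 ≤ ζ := (norm_nonneg _).trans hZ
  set qΘ := ∫ V, (Θ * gramResolvent S T V).trace ∂μ with hqΘ
  -- The growth `√m` of this bound is compensated by `hβδ`.
  have hqn : ‖qΘ‖ ≤ frobeniusNorm Θ * (q * √m) := by
    have h := norm_integral_le_of_norm_le_const (μ := μ)
      (f := fun V => (Θ * gramResolvent S T V).trace) (C := frobeniusNorm Θ * (q * √m))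
      (ae_of_all _ fun V => (norm_trace_mul_le _ _).trans (by
        gcongr
        exact (frobeniusNorm_le _).trans (mul_le_mul_of_nonneg_right
          (norm_resolvent_le hS hT.posSemidef hq hSq V) (Real.sqrt_nonneg _))))
    simpa using h
  have hw : ‖∫ V, (Θ * (gramResolvent S T V * V * Z * V.conjTranspose)).trace ∂μ -
      σ * ((1 + (β : ℂ) • T)⁻¹ * Z).trace * qΘ‖ ≤
      K₁ * tS * ζ * (σ * √σ) * frobeniusNorm Θ := by
    rw [integral_trace_form_eq hμ hS hT.posSemidef hq hSq hβ0 hβe, sub_sub_cancel_left, norm_neg]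
    refine (hcov _ _ (frobeniusNorm Θ) (tS * ζ) le_rfl ?_).trans (le_of_eq (by ring))
    calc _ ≤ ‖T‖ * (‖(1 + (β : ℂ) • T)⁻¹‖ * ‖Z‖) := (Matrix.l2_opNorm_mul _ _).trans
          (mul_le_mul_of_nonneg_left (Matrix.l2_opNorm_mul _ _) (norm_nonneg _))
      _ ≤ tS * (1 * ζ) := by gcongr
      _ = _ := by ring
  have htrace : ∀ B : Matrix (Fin n) (Fin n) ℂ, ‖(σ : ℂ) * B.trace‖ ≤ ‖B‖ := fun B => by
    rw [norm_mul, Complex.norm_real, Real.norm_of_nonneg hσ.le]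
    calc _ ≤ σ * (n * ‖B‖) := mul_le_mul_of_nonneg_left (norm_trace_le B) hσ.le
      _ = _ := by rw [← mul_assoc, hσn, one_mul]
  have hdiff : ‖(σ : ℂ) * ((1 + (β : ℂ) • T)⁻¹ * Z).trace * qΘ -
      σ * ((1 + (p.2 : ℂ) • T)⁻¹ * Z).trace * qΘ‖ ≤
      D * c₂ * tS * ζ * q * (σ * √σ) * frobeniusNorm Θ := by
    rw [← sub_mul, ← mul_sub, ← Matrix.trace_sub, ← Matrix.sub_mul, norm_mul]
    calc _ ≤ (|β - p.2| * tS * ζ) * (frobeniusNorm Θ * (q * √m)) := by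
          refine mul_le_mul ((htrace _).trans ((Matrix.l2_opNorm_mul _ _).trans ?_)) hqn
            (norm_nonneg _) (by positivity)
          refine mul_le_mul ((norm_inv_one_add_smul_sub_le hT.posSemidef hβ0 hp2.le).trans ?_) hZ
            (norm_nonneg _) (by positivity)
          gcongr
      _ = (|β - p.2| * √m) * (tS * ζ * q * frobeniusNorm Θ) := by ring
      _ ≤ (D * c₂ * (σ * √σ)) * (tS * ζ * q * frobeniusNorm Θ) := by gcongr
      _ = _ := by ring
  have hlast : ‖(σ : ℂ) * ((1 + (p.2 : ℂ) • T)⁻¹ * Z).trace * qΘ -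
      σ * ((1 + (p.2 : ℂ) • T)⁻¹ * Z).trace * (Θ * ((p.1 : ℂ) • 1 + S)⁻¹).trace‖ ≤
      ζ * (phiConst α rI rS tI tS c₁ c₂ * (σ * √σ) * frobeniusNorm Θ) := by
    rw [← mul_sub, norm_mul]
    refine mul_le_mul ((htrace _).trans ((Matrix.l2_opNorm_mul _ _).trans ?_)) hphi
      (norm_nonneg _) hζ
    calc _ ≤ 1 * ζ := by gcongr
      _ = ζ := one_mul ζ
  rw [Matrix.trace_mul_comm Z]
  -- Three errors add up: the covariance, the replacement of `β` by `δ` in the prefactor, and the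
  -- replacement of `E tr[Θ Q]` by its equivalent.
  refine (norm_sub_le_norm_sub_add_norm_sub _ _ _).trans ((add_le_add hw
    ((norm_sub_le_norm_sub_add_norm_sub _ _ _).trans (add_le_add hdiff hlast))).trans
      (le_of_eq ?_))
  rw [psiConst]
  ring

end Approximation

/-! ### The scaled Gaussian matrix satisfies the abstract hypotheses. -/

section Law

variable {Ω : Type*} [MeasurableSpace Ω] {P : Measure Ω} {m n : ℕ}
  {X : Ω → Matrix (Fin m) (Fin n) ℂ}

/-- The real coordinates of a complex matrix. -/
noncomputable def realCoordinates (A : Matrix (Fin m) (Fin n) ℂ)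
    (k : (Fin m × Fin n) ⊕ (Fin m × Fin n)) : ℝ :=
  Sum.elim (fun p => (A p.1 p.2).re) (fun p => (A p.1 p.2).im) k

/-- The complex matrix with the given real coordinates, multiplied by `c`. -/
noncomputable def ofRealCoordinates (m n : ℕ) (c : ℝ) :
    ((Fin m × Fin n) ⊕ (Fin m × Fin n) → ℝ) →L[ℝ] Matrix (Fin m) (Fin n) ℂ :=
  LinearMap.toContinuousLinearMap
    { toFun := fun v => Matrix.of fun i j => (c : ℂ) * (v (.inl (i, j)) + v (.inr (i, j)) * Complex.I)
      map_add' := fun v w => by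
        ext i j
        simp only [Matrix.of_apply, Matrix.add_apply, Pi.add_apply, Complex.ofReal_add]
        ring
      map_smul' := fun a v => by
        ext i j
        simp only [Matrix.of_apply, Matrix.smul_apply, Pi.smul_apply, smul_eq_mul,
          Complex.ofReal_mul, RingHom.id_apply, Complex.real_smul]
        ring }

theorem ofRealCoordinates_apply (c : ℝ) (v : (Fin m × Fin n) ⊕ (Fin m × Fin n) → ℝ) (i : Fin m)
    (j : Fin n) : ofRealCoordinates m n c v i j =
      (c : ℂ) * (v (.inl (i, j)) + v (.inr (i, j)) * Complex.I) := rfl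

theorem ofRealCoordinates_realCoordinates (c : ℝ) (A : Matrix (Fin m) (Fin n) ℂ) :
    ofRealCoordinates m n c (realCoordinates A) = (c : ℂ) • A := by
  ext i j
  rw [ofRealCoordinates_apply, Matrix.smul_apply, smul_eq_mul]
  congr 1
  exact Complex.re_add_im (A i j)

theorem IsStdComplexGaussianMatrix.hasLaw (hX : IsStdComplexGaussianMatrix P X)
    (k : (Fin m × Fin n) ⊕ (Fin m × Fin n)) :
    HasLaw (fun ω => realCoordinates (X ω) k) (gaussianReal 0 (1 / 2)) P := by
  rcases k with p | p
  · exact hX.law_re p.1 p.2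
  · exact hX.law_im p.1 p.2

theorem IsStdComplexGaussianMatrix.integral_eq_zero (hX : IsStdComplexGaussianMatrix P X)
    (k : (Fin m × Fin n) ⊕ (Fin m × Fin n)) : ∫ ω, realCoordinates (X ω) k ∂P = 0 := by
  rw [(hX.hasLaw k).integral_eq, integral_id_gaussianReal]

theorem IsStdComplexGaussianMatrix.hasGaussianLaw (hX : IsStdComplexGaussianMatrix P X) :
    HasGaussianLaw (fun ω => realCoordinates (X ω)) P :=
  iIndepFun.hasGaussianLaw (fun k => (hX.hasLaw k).hasGaussianLaw) hX.indep

theorem IsStdComplexGaussianMatrix.integral_mul_eq (hX : IsStdComplexGaussianMatrix P X)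
    (k l : (Fin m × Fin n) ⊕ (Fin m × Fin n)) :
    ∫ ω, realCoordinates (X ω) k * realCoordinates (X ω) l ∂P = if k = l then 1 / 2 else 0 := by
  split_ifs with h
  · subst h
    have h1 := (hX.hasLaw k).variance_eq
    rw [variance_id_gaussianReal, variance_of_integral_eq_zero (hX.hasLaw k).aemeasurable
      (hX.integral_eq_zero k)] at h1
    simp only [sq] at h1
    rw [h1]
    norm_num
  · have hi : IndepFun (fun ω => realCoordinates (X ω) k) (fun ω => realCoordinates (X ω) l) P :=
      hX.indep.indepFun h
    rw [hi.integral_fun_mul_eq_mul_integral (hX.hasLaw k).aemeasurable.aestronglyMeasurable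
      (hX.hasLaw l).aemeasurable.aestronglyMeasurable, hX.integral_eq_zero, zero_mul]

theorem IsStdComplexGaussianMatrix.aemeasurable_smul (hX : IsStdComplexGaussianMatrix P X) (c : ℝ) :
    AEMeasurable (fun ω => (c : ℂ) • X ω) P := by
  have h := (ofRealCoordinates m n c).continuous.measurable.comp_aemeasurable
    hX.hasGaussianLaw.aemeasurable
  simpa only [Function.comp_def, ofRealCoordinates_realCoordinates] using h

/-- The matrix is a linear image of a Gaussian vector, and its mean is zero, which gives rotation
invariance. The variances 1/2 of the real and imaginary parts add up in `E Y Ȳ` and cancel in `E Y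
Y`. -/
theorem IsStdComplexGaussianMatrix.isCircularGaussian (hX : IsStdComplexGaussianMatrix P X)
    (c : ℝ) : IsCircularGaussian (P.map fun ω => (c : ℂ) • X ω) (c ^ 2) := by
  have hmap : P.map (fun ω => (c : ℂ) • X ω) =
      (P.map fun ω => realCoordinates (X ω)).map (ofRealCoordinates m n c) := by
    rw [AEMeasurable.map_map_of_aemeasurable (ofRealCoordinates m n c).continuous.aemeasurable
      hX.hasGaussianLaw.aemeasurable]
    simp only [Function.comp_def, ofRealCoordinates_realCoordinates]
  have hν : IsGaussian (P.map fun ω => realCoordinates (X ω)) := hX.hasGaussianLaw.isGaussian_map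
  have hg : IsGaussian (P.map fun ω => (c : ℂ) • X ω) := by
    rw [hmap]
    infer_instance
  have hmem : ∀ k, MemLp (fun ω => realCoordinates (X ω) k) 2 P := fun k =>
    (hX.hasLaw k).hasGaussianLaw.memLp_two
  have hint : ∀ k l, Integrable
      (fun ω => ((realCoordinates (X ω) k * realCoordinates (X ω) l : ℝ) : ℂ)) P := fun k l =>
    ((hmem k).integrable_mul (hmem l)).ofReal
  have hadd : ∀ k l k' l', Integrable
      (fun ω => ((realCoordinates (X ω) k * realCoordinates (X ω) l : ℝ) : ℂ) +
        ((realCoordinates (X ω) k' * realCoordinates (X ω) l' : ℝ) : ℂ)) P := fun k l k' l' =>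
    (hint k l).add (hint k' l')
  have hsub : ∀ k l k' l', Integrable
      (fun ω => ((realCoordinates (X ω) k * realCoordinates (X ω) l : ℝ) : ℂ) -
        ((realCoordinates (X ω) k' * realCoordinates (X ω) l' : ℝ) : ℂ)) P := fun k l k' l' =>
    (hint k l).sub (hint k' l')
  have hV : ∀ ω i j, ((c : ℂ) • X ω) i j = (c : ℂ) * (realCoordinates (X ω) (.inl (i, j)) +
      realCoordinates (X ω) (.inr (i, j)) * Complex.I) := fun ω i j => by
    rw [← ofRealCoordinates_realCoordinates]
    rfl
  refine ⟨hg, IsGaussian.map_rotation_eq_self_of_forall_strongDual_eq_zero fun L => ?_,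
    fun i j k l => ?_, fun i j k l => ?_⟩
  · rw [hmap, integral_map (ofRealCoordinates m n c).continuous.aemeasurable
      L.continuous.aestronglyMeasurable]
    have h := IsGaussian.integral_dual (μ := P.map fun ω => realCoordinates (X ω))
      (L.comp (ofRealCoordinates m n c))
    simp only [ContinuousLinearMap.coe_comp, Function.comp_def] at h
    rw [h]
    have h0 : ∫ v, v ∂(P.map fun ω => realCoordinates (X ω)) = 0 := by
      rw [integral_map hX.hasGaussianLaw.aemeasurable (by fun_prop)]
      funext k
      rw [eval_integral fun k => (hX.hasLaw k).hasGaussianLaw.integrable]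
      exact hX.integral_eq_zero k
    rw [h0]
    simp
  · rw [integral_map (hX.aemeasurable_smul c) (by
      exact ((PolyGrowth.id.entry i j).mul
        (PolyGrowth.id.entry k l).star).continuous.aestronglyMeasurable)]
    have e : ∀ ω, ((c : ℂ) • X ω) i j * star (((c : ℂ) • X ω) k l) = (c : ℂ) ^ 2 *
        (((realCoordinates (X ω) (.inl (i, j)) * realCoordinates (X ω) (.inl (k, l)) : ℝ) : ℂ) +
        ((realCoordinates (X ω) (.inr (i, j)) * realCoordinates (X ω) (.inr (k, l)) : ℝ) : ℂ) +
        Complex.I *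
        (((realCoordinates (X ω) (.inr (i, j)) * realCoordinates (X ω) (.inl (k, l)) : ℝ) : ℂ) -
        ((realCoordinates (X ω) (.inl (i, j)) * realCoordinates (X ω) (.inr (k, l)) : ℝ) : ℂ))) :=
        fun ω => by
      rw [hV, hV]
      simp only [Complex.star_def, map_mul, map_add, Complex.conj_ofReal, Complex.conj_I]
      push_cast
      ring_nf
      rw [Complex.I_sq]
      ring
    simp only [e]
    rw [integral_const_mul, integral_add (hadd _ _ _ _) ((hsub _ _ _ _).const_mul _), integral_add (hint _ _) (hint _ _),
      integral_const_mul, integral_sub (hint _ _) (hint _ _)]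
    simp only [integral_complex_ofReal, hX.integral_mul_eq]
    by_cases h : i = k ∧ j = l
    · simp [h]
      norm_num
    · simp [h]
  · rw [integral_map (hX.aemeasurable_smul c) (by
      exact ((PolyGrowth.id.entry i j).mul
        (PolyGrowth.id.entry k l)).continuous.aestronglyMeasurable)]
    have e : ∀ ω, ((c : ℂ) • X ω) i j * ((c : ℂ) • X ω) k l = (c : ℂ) ^ 2 *
        (((realCoordinates (X ω) (.inl (i, j)) * realCoordinates (X ω) (.inl (k, l)) : ℝ) : ℂ) -
        ((realCoordinates (X ω) (.inr (i, j)) * realCoordinates (X ω) (.inr (k, l)) : ℝ) : ℂ) +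
        Complex.I *
        (((realCoordinates (X ω) (.inr (i, j)) * realCoordinates (X ω) (.inl (k, l)) : ℝ) : ℂ) +
        ((realCoordinates (X ω) (.inl (i, j)) * realCoordinates (X ω) (.inr (k, l)) : ℝ) : ℂ))) :=
        fun ω => by
      rw [hV, hV]
      push_cast
      ring_nf
      rw [Complex.I_sq]
      ring
    simp only [e]
    rw [integral_const_mul, integral_add (hsub _ _ _ _) ((hadd _ _ _ _).const_mul _), integral_sub (hint _ _) (hint _ _),
      integral_const_mul, integral_add (hint _ _) (hint _ _)]
    simp only [integral_complex_ofReal, hX.integral_mul_eq]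
    simp

end Law

/-! ### Rescaling to `V = X/√N` and transfer to the random matrix. -/

section FixedDimension

variable {m n : ℕ} {α : ℝ} {R : Matrix (Fin m) (Fin m) ℂ} {T : Matrix (Fin n) (Fin n) ℂ}

/-- The factor `1/n` is shared between `X` and `X*`, so the entries of the rescaled matrix have
variance `σ = 1/n`. -/
theorem sampleCovariance_eq (B : Matrix (Fin n) (Fin n) ℂ) (X : Matrix (Fin m) (Fin n) ℂ) :
    (1 / (n : ℂ)) • (X * B * X.conjTranspose) =
      (((√(1 / n) : ℝ) : ℂ) • X) * B * (((√(1 / n) : ℝ) : ℂ) • X).conjTranspose := by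
  have h : ((√(1 / n : ℝ) : ℝ) : ℂ) * ((√(1 / n : ℝ) : ℝ) : ℂ) = 1 / (n : ℂ) := by
    rw [← Complex.ofReal_mul, Real.mul_self_sqrt (by positivity)]
    push_cast
    rfl
  rw [Matrix.conjTranspose_smul, Complex.star_def, Complex.conj_ofReal, Matrix.smul_mul,
    Matrix.smul_mul, Matrix.mul_smul, smul_smul, h]

theorem resolventQ_eq (X : Matrix (Fin m) (Fin n) ℂ) :
    resolventQ α R T X = gramResolvent ((α : ℂ) • R⁻¹) T (((√(1 / n) : ℝ) : ℂ) • X) := by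
  rw [resolventQ, sampleCovariance_eq]
  rfl

theorem phi_eq (Θ : Matrix (Fin m) (Fin m) ℂ) (X : Matrix (Fin m) (Fin n) ℂ) :
    phi α R T Θ X =
      (Θ * gramResolvent ((α : ℂ) • R⁻¹) T (((√(1 / n) : ℝ) : ℂ) • X)).trace := by
  rw [phi, resolventQ_eq]

theorem psi_eq (Θ : Matrix (Fin m) (Fin m) ℂ) (Z : Matrix (Fin n) (Fin n) ℂ)
    (X : Matrix (Fin m) (Fin n) ℂ) :
    psi α R T Θ Z X =
      (Θ * (gramResolvent ((α : ℂ) • R⁻¹) T (((√(1 / n) : ℝ) : ℂ) • X) *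
        (((√(1 / n) : ℝ) : ℂ) • X) * Z * (((√(1 / n) : ℝ) : ℂ) • X).conjTranspose)).trace := by
  rw [psi, resolventQ_eq, sampleCovariance_eq]
  simp only [Matrix.mul_assoc]

theorem one_div_mul_sqrt_eq (n : ℕ) :
    (1 / n : ℝ) * √(1 / n) = 1 / (n : ℝ) ^ (3 / 2 : ℝ) := by
  rw [show (3 / 2 : ℝ) = 1 + 1 / 2 by norm_num, Real.rpow_add_of_nonneg (Nat.cast_nonneg _)
    (by norm_num) (by norm_num), Real.rpow_one, ← Real.sqrt_eq_rpow, Real.sqrt_div zero_le_one,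
    Real.sqrt_one, div_mul_div_comm, one_mul]

theorem phi_psi_approximation {Ω : Type*} [MeasurableSpace Ω] {P : Measure Ω}
    [IsProbabilityMeasure P] {X : Ω → Matrix (Fin m) (Fin n) ℂ}
    (hX : IsStdComplexGaussianMatrix P X) {rI rS tI tS c₁ c₂ ζ : ℝ}
    (hα : 0 < α) (hrI : 0 < rI) (htI : 0 < tI) (hc₁ : 0 < c₁)
    (hm : 0 < m) (hn : 0 < n) (hc₁σ : c₁ ≤ m / n) (hc₂σ : m / n ≤ c₂)
    (hR : R.PosDef) (hRS : ‖R‖ ≤ rS) (hRI : rI ≤ ‖R⁻¹‖⁻¹)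
    (hT : T.PosDef) (hTS : ‖T‖ ≤ tS) (hTI : tI ≤ ‖T⁻¹‖⁻¹)
    (Θ : Matrix (Fin m) (Fin m) ℂ) {Z : Matrix (Fin n) (Fin n) ℂ} (hZ : ‖Z‖ ≤ ζ) :
    Integrable (fun ω => phi α R T Θ (X ω)) P ∧
    Integrable (fun ω => psi α R T Θ Z (X ω)) P ∧
    ‖(∫ ω, phi α R T Θ (X ω) ∂P) - (Θ * detEquivE α R T).trace‖ ≤
      phiConst α rI rS tI tS c₁ c₂ * (frobeniusNorm Θ / (n : ℝ) ^ (3 / 2 : ℝ)) ∧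
    ‖(∫ ω, psi α R T Θ Z (X ω) ∂P) -
        1 / (n : ℂ) * (Z * (1 + (delta α R T : ℂ) • T)⁻¹).trace * (Θ * detEquivE α R T).trace‖ ≤
      psiConst α rI rS tI tS c₁ c₂ ζ * (frobeniusNorm Θ / (n : ℝ) ^ (3 / 2 : ℝ)) := by
  have hμ := hX.isCircularGaussian (√(1 / n))
  rw [Real.sq_sqrt (by positivity)] at hμ
  have := hμ.isGaussian
  have hmeas := hX.aemeasurable_smul (√(1 / n))
  have hRpos : 0 < ‖R‖ := norm_pos_iff.2 fun h0 => by
    subst h0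
    have : Nonempty (Fin m) := ⟨⟨0, hm⟩⟩
    exact absurd hR.det_pos (by simp)
  have hG := polyGrowth_gramResolvent (T := T) (posDef_smul_inv hα hR) hT.posSemidef
    (div_pos (hRpos.trans_le hRS) hα) (smul_inv_sub_posSemidef hα hR hRS hRpos)
  have g1 := ((PolyGrowth.const Θ).matrix_mul hG).trace
  have g2 := ((PolyGrowth.const Θ).matrix_mul (((hG.matrix_mul .id).matrix_mul
    (.const Z)).matrix_mul PolyGrowth.id.conjTranspose)).trace
  have hp : IsPositiveSolution α R T (systemSolution α R T) :=
    isPositiveSolution_systemSolution hm hn hα hR hT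
  obtain ⟨h1, h2⟩ := deterministic_equivalents (c₁ := c₁) (c₂ := c₂) (ζ := ζ) hα hrI htI hc₁ hm hn
    (by rwa [one_div_mul_eq_div]) (by rwa [one_div_mul_eq_div]) hμ hR hRS hRI hT hTS hTI hp Θ
  have h2 := h2 Z hZ
  rw [one_div_mul_sqrt_eq, mul_assoc (phiConst _ _ _ _ _ _ _), one_div_mul_eq_div] at h1
  rw [one_div_mul_sqrt_eq, mul_assoc (psiConst _ _ _ _ _ _ _ _),
    one_div_mul_eq_div (_ ^ (3 / 2 : ℝ))] at h2
  rw [integral_map hmeas g1.continuous.aestronglyMeasurable] at h1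
  rw [integral_map hmeas g2.continuous.aestronglyMeasurable] at h2
  simp only [phi_eq, psi_eq]
  exact ⟨(g1.integrable _).comp_aemeasurable hmeas, (g2.integrable _).comp_aemeasurable hmeas,
    h1, h2⟩

end FixedDimension

/-! ### Passage from fixed dimensions to the asymptotic statement. -/

theorem mainTheorem5
    (α rInf rSup tInf tSup ζ : ℝ) (cInf cSup : ℝ≥0)
    (hα : 0 < α) (hrInf : 0 < rInf) (htInf : 0 < tInf) (hcInf : 0 < cInf) :
    ∃ K : ℝ,
      ∀ (Ω : Type*) [MeasurableSpace Ω] (P : Measure Ω) [IsProbabilityMeasure P]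
        (N : ℕ → ℕ)
        (R : (M : ℕ) → Matrix (Fin M) (Fin M) ℂ)
        (T : (M : ℕ) → Matrix (Fin (N M)) (Fin (N M)) ℂ)
        (Θ : (M : ℕ) → Matrix (Fin M) (Fin M) ℂ)
        (Zt : (M : ℕ) → Matrix (Fin (N M)) (Fin (N M)) ℂ)
        (X : (M : ℕ) → Ω → Matrix (Fin M) (Fin (N M)) ℂ),
        -- Gaussian observations
        (∀ M, IsStdComplexGaussianMatrix P (X M)) →
        -- covariance matrices, with spectra bounded above and away from zero
        (∀ M, 1 ≤ M → (R M).PosDef ∧ ‖R M‖ ≤ rSup ∧ rInf ≤ ‖(R M)⁻¹‖⁻¹) →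
        (∀ M, 1 ≤ M → 1 ≤ N M → (T M).PosDef ∧ ‖T M‖ ≤ tSup ∧ tInf ≤ ‖(T M)⁻¹‖⁻¹) →
        -- both dimensions grow at the same rate
        (cInf : ℝ≥0∞) ≤ liminf (fun M : ℕ => (M : ℝ≥0∞) / (N M : ℝ≥0∞)) atTop →
        limsup (fun M : ℕ => (M : ℝ≥0∞) / (N M : ℝ≥0∞)) atTop ≤ (cSup : ℝ≥0∞) →
        -- weights of bounded trace norm, with trace bounded away from zero
        (∀ M, 1 ≤ M → (Θ M).PosSemidef) →
        (∃ τ : ℝ, ∀ M, 1 ≤ M → traceNorm (Θ M) ≤ τ) →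
        (∃ θ : ℝ, 0 < θ ∧ ∀ M, 1 ≤ M → θ ≤ (Θ M).trace.re) →
        -- diagonal matrices of bounded spectral norm
        (∀ M, 1 ≤ M → (Zt M).IsDiag ∧ ‖Zt M‖ ≤ ζ) →
        ∀ᶠ M in atTop,
          Integrable (fun ω => phi α (R M) (T M) (Θ M) (X M ω)) P ∧
          Integrable (fun ω => psi α (R M) (T M) (Θ M) (Zt M) (X M ω)) P ∧
          ‖(∫ ω, phi α (R M) (T M) (Θ M) (X M ω) ∂P)
              - (Θ M * detEquivE α (R M) (T M)).trace‖
            ≤ K * (frobeniusNorm (Θ M) / (N M : ℝ) ^ (3 / 2 : ℝ)) ∧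
          ‖(∫ ω, psi α (R M) (T M) (Θ M) (Zt M) (X M ω) ∂P)
              - 1 / (N M : ℂ) * (Zt M * (1 + (delta α (R M) (T M) : ℂ) • T M)⁻¹).trace
                * (Θ M * detEquivE α (R M) (T M)).trace‖
            ≤ K * (frobeniusNorm (Θ M) / (N M : ℝ) ^ (3 / 2 : ℝ)) := by
  -- The slack `cInf / 2` and `cSup + 1` turns the bounds on liminf and limsup into inequalities
  -- that hold eventually, so the constant depends on the data only through these bounds.
  refine ⟨max (phiConst α rInf rSup tInf tSup (cInf / 2) (cSup + 1))
    (psiConst α rInf rSup tInf tSup (cInf / 2) (cSup + 1) ζ), ?_⟩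
  intro Ω _ P _ N R T Θ Zt X hX hR hT hinf hsup _ _ _ hZt
  have e1 : ∀ᶠ M : ℕ in atTop, ((cInf / 2 : ℝ≥0) : ℝ≥0∞) < (M : ℝ≥0∞) / (N M : ℝ≥0∞) :=
    eventually_lt_of_lt_liminf
      (lt_of_lt_of_le (ENNReal.coe_lt_coe.2 (NNReal.half_lt_self hcInf.ne')) hinf)
  have e2 : ∀ᶠ M : ℕ in atTop, (M : ℝ≥0∞) / (N M : ℝ≥0∞) < ((cSup + 1 : ℝ≥0) : ℝ≥0∞) :=
    eventually_lt_of_limsup_lt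
      (lt_of_le_of_lt hsup (ENNReal.coe_lt_coe.2 (lt_add_one cSup)))
  filter_upwards [e1, e2, eventually_ge_atTop 1] with M h1 h2 hM
  -- In `ℝ≥0∞` a nonzero `M` divided by 0 is `∞`, so the upper bound on the ratio excludes `N M =
  -- 0`.
  have hN : 1 ≤ N M := by
    by_contra h0
    have h0 : N M = 0 := by omega
    rw [h0, Nat.cast_zero, ENNReal.div_zero (by exact_mod_cast (by omega : M ≠ 0))] at h2
    exact not_top_lt h2
  have hdiv : (M : ℝ≥0∞) / (N M : ℝ≥0∞) = (((M : ℝ≥0) / (N M : ℝ≥0) : ℝ≥0) : ℝ≥0∞) := by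
    rw [ENNReal.coe_div (by exact_mod_cast (by omega : N M ≠ 0)), ENNReal.coe_natCast,
      ENNReal.coe_natCast]
  rw [hdiv, ENNReal.coe_lt_coe] at h1 h2
  have h1' : (cInf : ℝ) / 2 ≤ (M : ℝ) / (N M : ℝ) := by exact_mod_cast h1.le
  have h2' : (M : ℝ) / (N M : ℝ) ≤ (cSup : ℝ) + 1 := by exact_mod_cast h2.le
  obtain ⟨hR1, hR2, hR3⟩ := hR M hM
  obtain ⟨hT1, hT2, hT3⟩ := hT M hM hN
  have hc : (0 : ℝ) < (cInf : ℝ) / 2 := half_pos (by exact_mod_cast hcInf)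
  obtain ⟨i1, i2, b1, b2⟩ := phi_psi_approximation (hX M) hα hrInf htInf hc hM hN h1' h2'
    hR1 hR2 hR3 hT1 hT2 hT3 (Θ M) (hZt M hM).2
  have hF : 0 ≤ frobeniusNorm (Θ M) / (N M : ℝ) ^ (3 / 2 : ℝ) :=
    div_nonneg (frobeniusNorm_nonneg _) (by positivity)
  exact ⟨i1, i2, b1.trans (mul_le_mul_of_nonneg_right (le_max_left _ _) hF),
    b2.trans (mul_le_mul_of_nonneg_right (le_max_right _ _) hF)⟩
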